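/- Setting. Fix a number $n$ of processes, sets of methods, arguments and return values, and a sequential specification $Spec$, i.e. a set of finite sequences of operations $m(a)\Rightarrow b$, that is deterministic and non-blocking: $Spec$ is the set of traces of a labelled transition system (LTS) over operations in which, for every state, method $m$ and argument $a$, there is at most one (deterministic) and at least one (non-blocking) transition with a label $m(a)\Rightarrow\cdot$. For a concurrent object $\mathcal O$ (shared memory, and for every method a program of atomic, possibly nondeterministic commands), $[\![\mathcal O,n]\!]$ is the LTS of $n$ processes each of which repeatedly calls arbitrary methods of $\mathcal O$ with arbitrary arguments; its labels are call actions $call(P_i,m,a)$, return actions $return(P_i,m,b)$ and internal actions. A history $h$ (finite sequence of call and return actions in which returns match calls) is linearizable w.r.t. $Spec$ if there are an extension $h'$ of $h$ by zero or more return actions and a sequential history $s$ of $n$ processes whose sequence of operations is in $Spec$, such that $complete(h')$ ($h'$ without its pending calls) and $s$ have the same subhistory for every process, and whenever the return of an operation $o_1$ precedes the call of an operation $o_2$ in $h$, for operations $o_1,o_2$ of $complete(h')$, then it does so in $s$. $\mathcal O$ is linearizable w.r.t. $Spec$ for $n$ processes if the projection of every finite trace of $[\![\mathcal O,n]\!]$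 to call and return actions is linearizable w.r.t. $Spec$. For LTSs $A_1,A_2$, write $A_1\preceq_{(c,r)}A_2$ if there is a relation $R$ between their states that relates the initial states and such that, if $(c_1,c_2)\in R$ and $c_1\xrightarrow{\alpha}c_1'$, then some $c_2'$ with $(c_1',c_2')\in R$ is reachable from $c_2$ by a finite sequence of transitions with the same call and return actions as $\alpha$. A $\preceq_{(c,r)}$-class for $Spec$ is a nonempty set $S$ such that (1) each element of $S$ is $[\![\mathcal O,n]\!]$ for some object $\mathcal O$ linearizable w.r.t. $Spec$ for $n$ processes; (2) $A_1\preceq_{(c,r)}A_2$ and $A_2\preceq_{(c,r)}A_1$ for all $A_1,A_2\in S$; (3) if $\mathcal O$ is linearizable w.r.t. $Spec$ for $n$ processes, and $[\![\mathcal O,n]\!]\preceq_{(c,r)}A$ and $A\preceq_{(c,r)}[\![\mathcal O,n]\!]$ for some $A\in S$, then $[\![\mathcal O,n]\!]\in S$. Let $Set_{Spec}$ be the set of these classes, and let $S_1\preceq_{(c,r)}S_2$ mean that $A_1\preceq_{(c,r)}A_2$ for some $A_1\in S_1$, $A_2\in S_2$. Objects. Each method $m(a)$ of $LUB_{(\mathcal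 O_1,\mathcal O_2)}$, which has instances $o_1,o_2$ of $\mathcal O_1,\mathcal O_2$ and a location $choice$, initially $\bot$, does: if $choice=\bot$, nondeterministically execute $cas(choice,\bot,0)$ or $cas(choice,\bot,1)$; then return the result of $o_2.m(a)$ if $choice=0$, and of $o_1.m(a)$ otherwise. Each method $m(a)$ of $GLB_{(\mathcal O_1,\mathcal O_2)}$ starts both $o_1.m(a)$ and $o_2.m(a)$; as long as one of them has not returned, it nondeterministically executes one command of a call that has not returned; then it returns their common value if both returned the same value, and loops forever otherwise. The methods of $\mathcal D_{Spec}$ never return. $\mathcal U_{Spec}$ uses an atomic history recorder, a generator of unique operation identities, arrays $announce$ and $head$ with one entry per process, and a linked list of nodes with fields $(oid,m,a,hist,lin,decideNext,seq,next)$, where $decideNext$ is a consensus object; a new node has $seq=0$ and $hist=lin=next=null$. Initially the list consists of a sentinel node $tail$ with $seq=1$, and all entries of both arrays are $tail$. A call of $m$ with argument $a$ by process $pid$ does the following: (2) $oid:=genID()$; (3) record the call; (4) $announce[pid]:=$ new node for $(m,a,oid)$; (5) $head[pid]:=$ an entry of $head$ with maximal $seq$; (6) while $announce[pid].seq=0$: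 (7) $before:=head[pid]$; (8) $help:=announce[(before.seq+1)\bmod n]$; (9–12) $prefer:=help$ if $help.seq=0$, else $prefer:=announce[pid]$; (13) $after:=before.decideNext.decide(prefer)$; (14) read the recorded history $h_1$; (15) $cas(after.hist,null,h_1)$; (16) choose nondeterministically a linearization $l$ w.r.t. $Spec$ of the history $after.hist$ that contains the operation of $after$ and that contains the operation of every node of the linked list from $tail$ (excluded) to $before$, with the same return value as in the $lin$ field of that node; (17) $cas(after.lin,null,l)$; (18) $before.next:=after$; (19) $after.seq:=before.seq+1$; (20) $head[pid]:=after$. After the loop: (21) $head[pid]:=announce[pid]$; (22) $b:=$ the return value of operation $oid$ in the $lin$ field of its node in the list; (23) record the return of $b$; (24) return $b$. Theorem. $(Set_{Spec},\preceq_{(c,r)})$ is a bounded lattice. Every $[\![\mathcal O,n]\!]$ with $\mathcal O$ linearizable w.r.t. $Spec$ for $n$ processes lies in exactly one class. For all classes $S_1,S_2$ and all $[\![\mathcal O_1,n]\!]\in S_1$, $[\![\mathcal O_2,n]\!]\in S_2$, the least upper bound of $S_1,S_2$ is the class that contains $[\![LUB_{(\mathcal O_1,\mathcal O_2)},n]\!]$,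 and their greatest lower bound is the class that contains $[\![GLB_{(\mathcal O_1,\mathcal O_2)},n]\!]$. The maximum element is the class that contains $[\![\mathcal U_{Spec},n]\!]$, and the minimum element is the class that contains $[\![\mathcal D_{Spec},n]\!]$. -/

import Mathlib

universe u v

namespace LinLattice

/-! ## Labelled transition systems -/

/-- A labelled transition system over the alphabet `L`. -/
structure LTS (L : Type v) where
  State : Type u
  initial : State
  tr : State → L → State → Prop

namespace LTS

variable {L : Type v}

/-- `T.Path q ls q'`: the finite transition sequence labelled `ls` leads from `q` to `q'`. -/
inductive Path (T : LTS.{u, v} L) : T.State → List L → T.State → Prop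
  | nil (q : T.State) : Path T q [] q
  | cons {q q' q'' : T.State} {l : L} {ls : List L} :
      T.tr q l q' → Path T q' ls q'' → Path T q (l :: ls) q''

/-- The set of finite traces. -/
def traces (T : LTS.{u, v} L) : Set (List L) := {ls | ∃ q, T.Path T.initial ls q}

end LTS

/-! ## Sequential specifications -/

/-- An operation `m(a) ⇒ b`. -/
structure Op (M A B : Type u) where
  method : M
  arg : A
  val : B

/-- `Spec` is the trace set of an LTS over operations that is deterministic (at most one
transition labelled `m(a) ⇒ ·` from each state, for all `m` and `a`) and non-blocking (at least
one such transition). -/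
def IsDetNonBlocking {M A B : Type u} (Spec : Set (List (Op M A B))) : Prop :=
  ∃ T : LTS.{u, u} (Op M A B),
    T.traces = Spec ∧
    (∀ q m a b b' q' q'', T.tr q ⟨m, a, b⟩ q' → T.tr q ⟨m, a, b'⟩ q'' → b = b' ∧ q' = q'') ∧
    (∀ q m a, ∃ b q', T.tr q ⟨m, a, b⟩ q')

/-! ## Histories and linearizability -/

/-- Call and return actions of `n` processes. -/
inductive Event (n : ℕ) (M A B : Type u) where
  | call (i : Fin n) (m : M) (a : A)
  | ret (i : Fin n) (m : M) (b : B)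

namespace Event

variable {n : ℕ} {M A B : Type u}

/-- The process that performs the action. -/
def pid : Event n M A B → Fin n
  | call i _ _ => i
  | ret i _ _ => i

def isCall : Event n M A B → Bool
  | call _ _ _ => true
  | ret _ _ _ => false

def isRet : Event n M A B → Bool
  | call _ _ _ => false
  | ret _ _ _ => true

end Event

section Histories

variable {n : ℕ} {M A B : Type u}

/-- The subhistory of process `i`. -/
def subhistory (h : List (Event n M A B)) (i : Fin n) : List (Event n M A B) :=
  h.filter fun e => decide (e.pid = i)

/-- Calls and matching returns alternate, starting with a call (used for the subhistory of a
single process). -/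
def Alternating : List (Event n M A B) → Prop
  | [] => True
  | [.call _ _ _] => True
  | .call _ m _ :: .ret _ m' _ :: t => m = m' ∧ Alternating t
  | _ => False

/-- Every return action matches the preceding call action of the same process. -/
def WellFormed (h : List (Event n M A B)) : Prop := ∀ i, Alternating (subhistory h i)

/-- Remove the pending calls. (In a well-formed history a call is pending exactly when it is
followed by no return of its process.) -/
def complete : List (Event n M A B) → List (Event n M A B)
  | [] => []
  | .call i m a :: t =>
      if t.any (fun e => e.isRet && decide (e.pid = i)) then .call i m a :: complete t
      else complete t
  | .ret i m b :: t => .ret i m b :: complete t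

/-- The number of call actions of process `i` in `h`. -/
def numCalls (h : List (Event n M A B)) (i : Fin n) : ℕ :=
  h.countP fun e => e.isCall && decide (e.pid = i)

/-- The number of return actions of process `i` in `h`. -/
def numRets (h : List (Event n M A B)) (i : Fin n) : ℕ :=
  h.countP fun e => e.isRet && decide (e.pid = i)

/-- The happen-before relation `<_h`. The pair `(i, k)` stands for the `k`-th operation of
process `i` (counting from `0`), whose call and return are the `k`-th call and the `k`-th return
of process `i`. The relation says that the return of `o₁` occurs in `h` before the call of `o₂`:
some prefix of `h` contains the former and not the latter, and `h` contains the latter. -/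
def HappensBefore (h : List (Event n M A B)) (o₁ o₂ : Fin n × ℕ) : Prop :=
  ∃ p t, h = p ++ t ∧ o₁.2 < numRets p o₁.1 ∧ numCalls p o₂.1 ≤ o₂.2 ∧ o₂.2 < numCalls h o₂.1

/-- The sequential history of a sequence of operations, each executed by the given process. -/
def seqHistory : List (Fin n × Op M A B) → List (Event n M A B)
  | [] => []
  | (i, o) :: l => .call i o.method o.arg :: .ret i o.method o.val :: seqHistory l

/-- `l` (that is, `seqHistory l`) is a linearization of the history `h` with respect to `Spec`:
`h` has an extension `h'` by return actions such that `complete h'` is equivalent to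
`seqHistory l`, and the happen-before order of `h` between operations of `complete h'` is
preserved. -/
def IsLinearization (Spec : Set (List (Op M A B))) (h : List (Event n M A B))
    (l : List (Fin n × Op M A B)) : Prop :=
  l.map Prod.snd ∈ Spec ∧
  ∃ rs : List (Event n M A B),
    (∀ e ∈ rs, e.isRet = true) ∧
    WellFormed (h ++ rs) ∧
    (∀ i, subhistory (complete (h ++ rs)) i = subhistory (seqHistory l) i) ∧
    ∀ o₁ o₂ : Fin n × ℕ,
      o₁.2 < numRets (complete (h ++ rs)) o₁.1 → o₂.2 < numRets (complete (h ++ rs)) o₂.1 →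
      HappensBefore h o₁ o₂ → HappensBefore (seqHistory l) o₁ o₂

end Histories

/-! ## Concurrent objects and their operational semantics -/

/-- Transition labels of a concurrent system: visible call and return actions, and internal
actions of a process. -/
inductive Label (n : ℕ) (M A B : Type u) where
  | vis (e : Event n M A B)
  | internal (i : Fin n)

/-- The projection of a sequence of labels to call and return actions. -/
def history {n : ℕ} {M A B : Type u} (ls : List (Label n M A B)) : List (Event n M A B) :=
  ls.filterMap fun
    | .vis e => some e
    | .internal _ => none

/-- A concurrent object for `n` processes: a shared memory, and for every method a program given
by its local states (control state and registers), its local state `start i m a` right after the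
call of `m` with argument `a` by process `i`, its atomic, possibly nondeterministic, commands
`step`, and the value `result l` that is returned in a final local state `l`. -/
structure ConcObject (n : ℕ) (M A B : Type u) where
  Shared : Type u
  Loc : Type u
  initial : Shared
  start : Fin n → M → A → Loc
  step : Fin n → Loc → Shared → Loc → Shared → Prop
  result : Loc → Option B

section Semantics

variable {n : ℕ} {M A B : Type u}

/-- A configuration: the shared memory and, for each process, `none` if it is idle, or the
method it is executing with the local state. -/
structure Config (O : ConcObject n M A B) where
  shared : O.Shared
  ctrl : Fin n → Option (M × O.Loc)

/-- Transitions of the system in which each of the `n` processes runs the most general client. -/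
inductive Trans (O : ConcObject n M A B) : Config O → Label n M A B → Config O → Prop
  | call (c : Config O) (i : Fin n) (m : M) (a : A) : c.ctrl i = none →
      Trans O c (.vis (.call i m a))
        ⟨c.shared, Function.update c.ctrl i (some (m, O.start i m a))⟩
  | internal (c : Config O) (i : Fin n) (m : M) (l l' : O.Loc) (s' : O.Shared) :
      c.ctrl i = some (m, l) → O.step i l c.shared l' s' →
      Trans O c (.internal i) ⟨s', Function.update c.ctrl i (some (m, l'))⟩
  | ret (c : Config O) (i : Fin n) (m : M) (l : O.Loc) (b : B) :
      c.ctrl i = some (m, l) → O.result l = some b →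
      Trans O c (.vis (.ret i m b)) ⟨c.shared, Function.update c.ctrl i none⟩

/-- The operational semantics of the object `O` for `n` processes. -/
def sem (O : ConcObject n M A B) : LTS.{u, u} (Label n M A B) where
  State := Config O
  initial := ⟨O.initial, fun _ => none⟩
  tr := Trans O

/-- The object `O` is linearizable with respect to `Spec` for `n` processes. -/
def Linearizable (Spec : Set (List (Op M A B))) (O : ConcObject n M A B) : Prop :=
  ∀ e ∈ (sem O).traces, ∃ l, IsLinearization Spec (history e) l

/-- There is a forward simulation from `X` to `Y` for which exactly the call and return actions
are visible. -/
def Simulated (X Y : LTS.{u, u} (Label n M A B)) : Prop :=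
  ∃ R : X.State → Y.State → Prop,
    R X.initial Y.initial ∧
    ∀ c₁ c₂, R c₁ c₂ → ∀ α c₁', X.tr c₁ α c₁' →
      ∃ ls c₂', Y.Path c₂ ls c₂' ∧ history ls = history [α] ∧ R c₁' c₂'

/-- The classes of mutually similar systems of linearizable objects. -/
structure SimClass (n : ℕ) {M A B : Type u} (Spec : Set (List (Op M A B))) where
  carrier : Set (LTS.{u, u} (Label n M A B))
  nonempty : carrier.Nonempty
  linearizable : ∀ X ∈ carrier, ∃ O : ConcObject n M A B, Linearizable Spec O ∧ X = sem O
  similar : ∀ X ∈ carrier, ∀ Y ∈ carrier, Simulated X Y ∧ Simulated Y X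
  closed : ∀ O : ConcObject n M A B, Linearizable Spec O → ∀ X ∈ carrier,
    Simulated (sem O) X → Simulated X (sem O) → sem O ∈ carrier

end Semantics

/-! ## The least upper bound object -/

section LUB

variable {n : ℕ} {M A B : Type u}

/-- Local states of the least upper bound object, named after the lines of
```
1  if choice = ⊥ then
2    nondeterministically execute cas(choice, ⊥, 0) or cas(choice, ⊥, 1)
3  if choice = 0 then
4    retVal := o₂.m(a)
5  else
6    retVal := o₁.m(a)
7  return retVal
``` -/
inductive LUBLoc (O₁ O₂ : ConcObject n M A B) : Type u where
  | line1 (m : M) (a : A)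
  | line2 (m : M) (a : A)
  | line3 (m : M) (a : A)
  | line4 (l : O₂.Loc)
  | line6 (l : O₁.Loc)
  | line7 (retVal : B)

/-- Shared memory: that of the instances `o₁` and `o₂`, and `choice`, where `none` is `⊥`. -/
structure LUBShared (O₁ O₂ : ConcObject n M A B) : Type u where
  fst : O₁.Shared
  snd : O₂.Shared
  choice : Option (Fin 2)

inductive LUBStep (O₁ O₂ : ConcObject n M A B) (i : Fin n) :
    LUBLoc O₁ O₂ → LUBShared O₁ O₂ → LUBLoc O₁ O₂ → LUBShared O₁ O₂ → Prop
  | line1_bot (m a s) : s.choice = none → LUBStep O₁ O₂ i (.line1 m a) s (.line2 m a) s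
  | line1_set (m a s) : s.choice ≠ none → LUBStep O₁ O₂ i (.line1 m a) s (.line3 m a) s
  | cas_success (m a s) (x : Fin 2) : s.choice = none →
      LUBStep O₁ O₂ i (.line2 m a) s (.line3 m a) { s with choice := some x }
  | cas_fail (m a s) : s.choice ≠ none → LUBStep O₁ O₂ i (.line2 m a) s (.line3 m a) s
  | line3_zero (m a s) : s.choice = some 0 →
      LUBStep O₁ O₂ i (.line3 m a) s (.line4 (O₂.start i m a)) s
  | line3_nonzero (m a s) : s.choice ≠ some 0 →
      LUBStep O₁ O₂ i (.line3 m a) s (.line6 (O₁.start i m a)) s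
  | line4_step (l s l' t') : O₂.step i l s.snd l' t' →
      LUBStep O₁ O₂ i (.line4 l) s (.line4 l') { s with snd := t' }
  | line4_done (l s b) : O₂.result l = some b → LUBStep O₁ O₂ i (.line4 l) s (.line7 b) s
  | line6_step (l s l' t') : O₁.step i l s.fst l' t' →
      LUBStep O₁ O₂ i (.line6 l) s (.line6 l') { s with fst := t' }
  | line6_done (l s b) : O₁.result l = some b → LUBStep O₁ O₂ i (.line6 l) s (.line7 b) s

/-- The object `LUB(O₁, O₂)`. -/
def lubObject (O₁ O₂ : ConcObject n M A B) : ConcObject n M A B where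
  Shared := LUBShared O₁ O₂
  Loc := LUBLoc O₁ O₂
  initial := ⟨O₁.initial, O₂.initial, none⟩
  start _ m a := .line1 m a
  step := LUBStep O₁ O₂
  result
    | .line7 b => some b
    | _ => none

end LUB

/-! ## The greatest lower bound object -/

section GLB

variable {n : ℕ} {M A B : Type u}

/-- Local states of the greatest lower bound object, named after the lines of
```
1  execute o₁.call(m, a)
2  execute o₂.call(m, a)
3  while o₁.m(a) or o₂.m(a) does not return yet do
4    nondeterministically execute one command of some oᵢ that has not returned yet
5  if o₁.m(a) and o₂.m(a) return the same value then
6    return this value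
7  else
8    fall into an infinite loop
```
In the loop, `inl l` is a running call with local state `l`, and `inr b` is a call that has
returned `b`. -/
inductive GLBLoc (O₁ O₂ : ConcObject n M A B) : Type u where
  | line1 (m : M) (a : A)
  | line2 (m : M) (a : A) (l₁ : O₁.Loc)
  | loop (x₁ : O₁.Loc ⊕ B) (x₂ : O₂.Loc ⊕ B)
  | line6 (b : B)
  | line8

inductive GLBStep (O₁ O₂ : ConcObject n M A B) (i : Fin n) :
    GLBLoc O₁ O₂ → O₁.Shared × O₂.Shared → GLBLoc O₁ O₂ → O₁.Shared × O₂.Shared → Prop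
  | line1 (m a s) : GLBStep O₁ O₂ i (.line1 m a) s (.line2 m a (O₁.start i m a)) s
  | line2 (m a l₁ s) :
      GLBStep O₁ O₂ i (.line2 m a l₁) s (.loop (.inl l₁) (.inl (O₂.start i m a))) s
  | step₁ (l x₂ s₁ s₂ l' s₁') : O₁.step i l s₁ l' s₁' →
      GLBStep O₁ O₂ i (.loop (.inl l) x₂) (s₁, s₂) (.loop (.inl l') x₂) (s₁', s₂)
  | done₁ (l x₂ s b) : O₁.result l = some b →
      GLBStep O₁ O₂ i (.loop (.inl l) x₂) s (.loop (.inr b) x₂) s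
  | step₂ (x₁ l s₁ s₂ l' s₂') : O₂.step i l s₂ l' s₂' →
      GLBStep O₁ O₂ i (.loop x₁ (.inl l)) (s₁, s₂) (.loop x₁ (.inl l')) (s₁, s₂')
  | done₂ (x₁ l s b) : O₂.result l = some b →
      GLBStep O₁ O₂ i (.loop x₁ (.inl l)) s (.loop x₁ (.inr b)) s
  | line5_same (b s) : GLBStep O₁ O₂ i (.loop (.inr b) (.inr b)) s (.line6 b) s
  | line5_differ (b b' s) : b ≠ b' → GLBStep O₁ O₂ i (.loop (.inr b) (.inr b')) s .line8 s
  | line8 (s) : GLBStep O₁ O₂ i .line8 s .line8 s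

/-- The object `GLB(O₁, O₂)`. -/
def glbObject (O₁ O₂ : ConcObject n M A B) : ConcObject n M A B where
  Shared := O₁.Shared × O₂.Shared
  Loc := GLBLoc O₁ O₂
  initial := (O₁.initial, O₂.initial)
  start _ m a := .line1 m a
  step := GLBStep O₁ O₂
  result
    | .line6 b => some b
    | _ => none

end GLB

/-! ## The object that never returns -/

/-- The object whose methods all loop forever. -/
def neverObject (n : ℕ) (M A B : Type u) : ConcObject n M A B where
  Shared := PUnit
  Loc := PUnit
  initial := ⟨⟩
  start _ _ _ := ⟨⟩
  step _ _ _ _ _ := True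
  result _ := none

/-! ## The universal object -/

section Universal

variable {n : ℕ} {M A B : Type u}

/-- Operation identities. The identity generator gives the `k`-th operation of process `i` the
unique identity `(i, k)`, so the identity of a recorded action can be read off from the recorded
history. -/
abbrev Oid (n : ℕ) : Type := Fin n × ℕ

/-- References to nodes: `none` is the sentinel `tail`, and `some o` is the node created by the
operation with identity `o` (which is also the content of its field `oid`). -/
abbrev NodeRef (n : ℕ) : Type := Option (Oid n)

/-- The return value of the operation `o` in `l`; it is `none` if `o` is not in `l`. -/
def retValue (l : List (Fin n × Op M A B)) (o : Oid n) : Option B :=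
  ((l.filter fun x => decide (x.1 = o.1))[o.2]?).map fun x => x.2.val

/-- The fields of a node; `none` is `null` in the fields `hist`, `lin` and `next`. The consensus
object `decideNext` is represented by its decision, `none` while it is undecided. -/
structure Node (n : ℕ) (M A B : Type u) where
  invoc : Option (M × A)
  hist : Option (List (Event n M A B))
  lin : Option (List (Fin n × Op M A B))
  decideNext : Option (NodeRef n)
  seq : ℕ
  next : Option (NodeRef n)

/-- The node returned by the constructor, and the memory content before it is called. -/
def Node.fresh (inv : Option (M × A)) : Node n M A B := ⟨inv, none, none, none, 0, none⟩

/-- The shared memory of the universal object. The identity generator and the history recorder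
are atomic objects with contents `idGen` and `recorder`. -/
structure UShared (n : ℕ) (M A B : Type u) where
  idGen : Fin n → ℕ
  recorder : List (Event n M A B)
  heap : NodeRef n → Node n M A B
  announce : Fin n → NodeRef n
  head : Fin n → NodeRef n

namespace UShared

/-- Initially, the list consists of `tail`, with sequence number `1`. -/
def initial (n : ℕ) (M A B : Type u) : UShared n M A B where
  idGen _ := 0
  recorder := []
  heap
    | none => { (Node.fresh none : Node n M A B) with seq := 1 }
    | some _ => Node.fresh none
  announce _ := none
  head _ := none

/-- Replace the content of the node `x`. -/
def setNode (s : UShared n M A B) (x : NodeRef n) (nd : Node n M A B) : UShared n M A B :=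
  { s with heap := Function.update s.heap x nd }

/-- `y` is reached from `x` along the `next` fields. -/
def Reach (s : UShared n M A B) (x y : NodeRef n) : Prop :=
  Relation.ReflTransGen (fun z w => (s.heap z).next = some w) x y

/-- `genLin()` may return `l` for the node `aft` to be appended to `bef`: `l` is a linearization
of the `hist` field of `aft`, it contains the operation of `aft`, and it contains the operation of
each node of the linked list, from `tail` up to `bef`, with the same return value as in the `lin`
field of that node. -/
def GenLin (Spec : Set (List (Op M A B))) (s : UShared n M A B) (bef aft : NodeRef n)
    (l : List (Fin n × Op M A B)) : Prop :=
  (∃ h, (s.heap aft).hist = some h ∧ IsLinearization Spec h l) ∧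
  (∀ o, aft = some o → ∃ b, retValue l o = some b) ∧
  ∀ o, s.Reach none (some o) → s.Reach (some o) bef →
    ∃ l' b, (s.heap (some o)).lin = some l' ∧ retValue l' o = some b ∧ retValue l o = some b

end UShared

/-- Local states of the universal object, named after the lines of
```
 1  method apply(m, a), executed by process pid
 2  oid := idGen.genID()
 3  recorder.storeCall(m, a, pid, oid)
 4  announce[pid] := new Node(m, a, oid)
 5  head[pid] := Node.max(head)
 6  while announce[pid].seq = 0 do
 7    before := head[pid]
 8    help := announce[(before.seq + 1) % n]
 9    if help.seq = 0 then
10      prefer := help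
11    else
12      prefer := announce[pid]
13    after := before.decideNext.decide(prefer)
14    h := recorder.read()
15    cas(after.hist, null, h)
16    l := genLin()
17    cas(after.lin, null, l)
18    before.next := after
19    after.seq := before.seq + 1
20    head[pid] := after
21  head[pid] := announce[pid]
22  b := getRetValue(oid)
23  recorder.storeReturn(m, b, pid, oid)
24  return b
```
Line 5 scans the array one entry at a time: `j` is the next index, and `best` is the node with the
largest sequence number found so far. -/
inductive ULoc (n : ℕ) (M A B : Type u) where
  | line2 (m : M) (a : A)
  | line3 (m : M) (a : A) (o : Oid n)
  | line4 (m : M) (a : A) (o : Oid n)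
  | line5 (m : M) (o : Oid n) (j : ℕ) (best : NodeRef n)
  | line6 (m : M) (o : Oid n)
  | line7 (m : M) (o : Oid n)
  | line8 (m : M) (o : Oid n) (bef : NodeRef n)
  | line9 (m : M) (o : Oid n) (bef help : NodeRef n)
  | line13 (m : M) (o : Oid n) (bef prefer : NodeRef n)
  | line14 (m : M) (o : Oid n) (bef aft : NodeRef n)
  | line15 (m : M) (o : Oid n) (bef aft : NodeRef n) (h : List (Event n M A B))
  | line16 (m : M) (o : Oid n) (bef aft : NodeRef n)
  | line17 (m : M) (o : Oid n) (bef aft : NodeRef n) (l : List (Fin n × Op M A B))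
  | line18 (m : M) (o : Oid n) (bef aft : NodeRef n)
  | line19 (m : M) (o : Oid n) (bef aft : NodeRef n)
  | line20 (m : M) (o : Oid n) (aft : NodeRef n)
  | line21 (m : M) (o : Oid n)
  | line22 (m : M) (o : Oid n)
  | line23 (m : M) (b : B)
  | line24 (b : B)

/-- The commands of the universal object. The nodes that are read by `genLin()` in line 16 and by
`getRetValue(oid)` in line 22 are no longer modified at that point, and both are one command. -/
inductive UStep (Spec : Set (List (Op M A B))) (i : Fin n) :
    ULoc n M A B → UShared n M A B → ULoc n M A B → UShared n M A B → Prop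
  | line2 (m a s) :
      UStep Spec i (.line2 m a) s (.line3 m a (i, s.idGen i))
        { s with idGen := Function.update s.idGen i (s.idGen i + 1) }
  | line3 (m a o s) :
      UStep Spec i (.line3 m a o) s (.line4 m a o)
        { s with recorder := s.recorder ++ [.call i m a] }
  | line4 (m a o s) :
      UStep Spec i (.line4 m a o) s (.line5 m o 0 none)
        { s.setNode (some o) (.fresh (some (m, a))) with
          announce := Function.update s.announce i (some o) }
  | line5_scan (m o j best s) (hj : j < n) :
      UStep Spec i (.line5 m o j best) s
        (.line5 m o (j + 1)
          (if (s.heap best).seq < (s.heap (s.head ⟨j, hj⟩)).seq then s.head ⟨j, hj⟩ else best)) s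
  | line5_write (m o j best s) : n ≤ j →
      UStep Spec i (.line5 m o j best) s (.line6 m o)
        { s with head := Function.update s.head i best }
  | line6_enter (m o s) : (s.heap (s.announce i)).seq = 0 →
      UStep Spec i (.line6 m o) s (.line7 m o) s
  | line6_exit (m o s) : (s.heap (s.announce i)).seq ≠ 0 →
      UStep Spec i (.line6 m o) s (.line21 m o) s
  | line7 (m o s) : UStep Spec i (.line7 m o) s (.line8 m o (s.head i)) s
  | line8 (m o bef s) :
      UStep Spec i (.line8 m o bef) s
        (.line9 m o bef (s.announce ⟨((s.heap bef).seq + 1) % n, Nat.mod_lt _ i.pos⟩)) s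
  | line9_help (m o bef help s) : (s.heap help).seq = 0 →
      UStep Spec i (.line9 m o bef help) s (.line13 m o bef help) s
  | line9_own (m o bef help s) : (s.heap help).seq ≠ 0 →
      UStep Spec i (.line9 m o bef help) s (.line13 m o bef (s.announce i)) s
  | line13_win (m o bef prefer s) : (s.heap bef).decideNext = none →
      UStep Spec i (.line13 m o bef prefer) s (.line14 m o bef prefer)
        (s.setNode bef { s.heap bef with decideNext := some prefer })
  | line13_lose (m o bef prefer aft s) : (s.heap bef).decideNext = some aft →
      UStep Spec i (.line13 m o bef prefer) s (.line14 m o bef aft) s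
  | line14 (m o bef aft s) :
      UStep Spec i (.line14 m o bef aft) s (.line15 m o bef aft s.recorder) s
  | line15_success (m o bef aft h s) : (s.heap aft).hist = none →
      UStep Spec i (.line15 m o bef aft h) s (.line16 m o bef aft)
        (s.setNode aft { s.heap aft with hist := some h })
  | line15_fail (m o bef aft h s) : (s.heap aft).hist ≠ none →
      UStep Spec i (.line15 m o bef aft h) s (.line16 m o bef aft) s
  | line16 (m o bef aft l s) : s.GenLin Spec bef aft l →
      UStep Spec i (.line16 m o bef aft) s (.line17 m o bef aft l) s
  | line17_success (m o bef aft l s) : (s.heap aft).lin = none →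
      UStep Spec i (.line17 m o bef aft l) s (.line18 m o bef aft)
        (s.setNode aft { s.heap aft with lin := some l })
  | line17_fail (m o bef aft l s) : (s.heap aft).lin ≠ none →
      UStep Spec i (.line17 m o bef aft l) s (.line18 m o bef aft) s
  | line18 (m o bef aft s) :
      UStep Spec i (.line18 m o bef aft) s (.line19 m o bef aft)
        (s.setNode bef { s.heap bef with next := some aft })
  | line19 (m o bef aft s) :
      UStep Spec i (.line19 m o bef aft) s (.line20 m o aft)
        (s.setNode aft { s.heap aft with seq := (s.heap bef).seq + 1 })
  | line20 (m o aft s) :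
      UStep Spec i (.line20 m o aft) s (.line6 m o)
        { s with head := Function.update s.head i aft }
  | line21 (m o s) :
      UStep Spec i (.line21 m o) s (.line22 m o)
        { s with head := Function.update s.head i (s.announce i) }
  | line22 (m o l b s) : s.Reach none (some o) → (s.heap (some o)).lin = some l →
      retValue l o = some b → UStep Spec i (.line22 m o) s (.line23 m b) s
  | line23 (m b s) :
      UStep Spec i (.line23 m b) s (.line24 b)
        { s with recorder := s.recorder ++ [.ret i m b] }

/-- The universal object of `Spec`; its call `apply(m, a)` is the call of `m` with argument
`a`. -/
def universalObject (n : ℕ) (Spec : Set (List (Op M A B))) : ConcObject n M A B where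
  Shared := UShared n M A B
  Loc := ULoc n M A B
  initial := UShared.initial n M A B
  start _ m a := .line2 m a
  step := UStep Spec
  result
    | .line24 b => some b
    | _ => none

end Universal

end LinLattice

namespace LinLattice

/-! ## Weak transitions -/

section Weak

variable {n : ℕ} {M A B : Type u}

/-! Mutual similarity is the equivalence of a preorder, and linearizability depends only on
histories, so it is inherited by everything that a linearizable object simulates
(`Linearizable.of_simulated`). The classes are therefore the equivalence classes of a preorder on
linearizable objects, and the theorem reduces to simulations between concrete objects.

Minimum: an object that never returns has no visible actions except calls, and every object can
perform these.

Greatest lower bound: `glbObject` projects onto each component. Conversely, if both components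
simulate `X`, their two answers to a step of `X` run side by side on disjoint memories. They meet at
the visible actions, where both components return the same value.

Least upper bound: `lubObject` simulates each component by fixing `choice` at the first call.
Conversely, let `O` simulate both components (`lubObject_simulated`). While `choice` is unset, both
simulations must remain available from one configuration of `O`. Hence `O` answers a call by the
bare call and postpones the internal steps that either simulation would add. This is possible
because internal steps commute with the call of an idle process (`Ahead.call`).

Maximum, upper bound (`simulated_universalObject`): the universal object records a call and then
waits before announcing it. When the simulated object returns, its history with this return has a
linearization. The waiting process runs alone to the end and uses that linearization at `genLin`.
The nodes already on the list belong to returned operations, on whose values all linearizations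
agree.

Maximum, membership (`linearizable_universalObject`): an invariant shows that the decided nodes form
one list without repetition and that each stored linearization agrees with the earlier ones on their
return values. The linearization stored at the last numbered node is then a linearization of the
whole recorded history. The recorded history differs from the actual one only by calls recorded late
and returns recorded early, which `IsLinearization.of_delayed` tolerates.

The least upper bound of linearizable objects is linearizable because the universal object is above
both of them, hence above it. -/

theorem history_append (x y : List (Label n M A B)) :
    history (x ++ y) = history x ++ history y := List.filterMap_append

theorem LTS.Path.append {L : Type v} {T : LTS.{u, v} L} {p q r : T.State} {x y : List L}
    (h₁ : T.Path p x q) (h₂ : T.Path q y r) : T.Path p (x ++ y) r := by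
  induction h₁ with
  | nil => exact h₂
  | cons ht _ ih => exact .cons ht (ih h₂)

theorem LTS.Path.single {L : Type v} {T : LTS.{u, v} L} {p q : T.State} {x : L}
    (h : T.tr p x q) : T.Path p [x] q := .cons h (.nil _)

/-- Reachability by internal transitions. -/
def LTS.Silent (T : LTS.{u, u} (Label n M A B)) : T.State → T.State → Prop :=
  Relation.ReflTransGen fun c d => ∃ i, T.tr c (.internal i) d

/-- Reachability by transitions with the same visible actions as one given label. -/
def LTS.Weak (T : LTS.{u, u} (Label n M A B)) (c : T.State) :
    Label n M A B → T.State → Prop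
  | .internal _, d => T.Silent c d
  | .vis e, d => ∃ c' d', T.Silent c c' ∧ T.tr c' (.vis e) d' ∧ T.Silent d' d

variable {T X Y Z : LTS.{u, u} (Label n M A B)}

theorem LTS.Silent.exists_path {c d : T.State} (h : T.Silent c d) :
    ∃ ls, T.Path c ls d ∧ history ls = [] := by
  induction h with
  | refl => exact ⟨[], .nil _, rfl⟩
  | tail _ ht ih =>
    obtain ⟨ls, hp, hh⟩ := ih
    obtain ⟨i, hi⟩ := ht
    exact ⟨ls ++ [.internal i], hp.append (.single hi), by rw [history_append, hh]; rfl⟩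

theorem LTS.Path.silent {c d : T.State} {ls : List (Label n M A B)} (h : T.Path c ls d)
    (hh : history ls = []) : T.Silent c d := by
  induction h with
  | nil => exact .refl
  | @cons q q' q'' l ls ht hp ih =>
    cases l with
    | vis e => simp [history] at hh
    | internal i => exact .head ⟨i, ht⟩ (ih hh)

theorem LTS.Path.weak {c d : T.State} {ls : List (Label n M A B)} (h : T.Path c ls d)
    {α : Label n M A B} (hh : history ls = history [α]) : T.Weak c α d := by
  cases α with
  | internal i => exact h.silent hh
  | vis e =>
    induction h with
    | nil => simp [history] at hh
    | @cons q q' q'' l ls ht hp ih =>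
      cases l with
      | vis e' =>
        have hh' : e' :: history ls = [e] := hh
        obtain ⟨rfl, hn⟩ := List.cons_eq_cons.1 hh'
        exact ⟨_, _, .refl, ht, hp.silent hn⟩
      | internal i =>
        obtain ⟨c', d', h₁, h₂, h₃⟩ := ih hh
        exact ⟨c', d', .head ⟨i, ht⟩ h₁, h₂, h₃⟩

theorem LTS.Weak.exists_path {c d : T.State} {α : Label n M A B} (h : T.Weak c α d) :
    ∃ ls, T.Path c ls d ∧ history ls = history [α] := by
  cases α with
  | internal i => exact LTS.Silent.exists_path h
  | vis e =>
    obtain ⟨c', d', h₁, h₂, h₃⟩ := h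
    obtain ⟨x, hx, hx'⟩ := h₁.exists_path
    obtain ⟨y, hy, hy'⟩ := h₃.exists_path
    refine ⟨x ++ .vis e :: y, hx.append (.cons h₂ hy), ?_⟩
    rw [history_append, hx']
    change e :: history y = [e]
    rw [hy']

theorem LTS.Weak.of_tr {c d : T.State} {α : Label n M A B} (h : T.tr c α d) : T.Weak c α d := by
  cases α with
  | internal i => exact .single ⟨i, h⟩
  | vis e => exact ⟨_, _, .refl, h, .refl⟩

theorem LTS.Silent.trans_weak {c d e : T.State} {α : Label n M A B} (h : T.Silent c d)
    (h' : T.Weak d α e) : T.Weak c α e := by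
  cases α with
  | internal i => exact Relation.ReflTransGen.trans h h'
  | vis e =>
    obtain ⟨c', d', h₁, h₂, h₃⟩ := h'
    exact ⟨c', d', h.trans h₁, h₂, h₃⟩

theorem LTS.Weak.trans_silent {c d e : T.State} {α : Label n M A B} (h : T.Weak c α d)
    (h' : T.Silent d e) : T.Weak c α e := by
  cases α with
  | internal i => exact Relation.ReflTransGen.trans h h'
  | vis e =>
    obtain ⟨c', d', h₁, h₂, h₃⟩ := h
    exact ⟨c', d', h₁, h₂, h₃.trans h'⟩

/-- `R` is a weak forward simulation. -/
def IsSimulation (X Y : LTS.{u, u} (Label n M A B)) (R : X.State → Y.State → Prop) : Prop :=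
  R X.initial Y.initial ∧
    ∀ c₁ c₂, R c₁ c₂ → ∀ α c₁', X.tr c₁ α c₁' → ∃ c₂', Y.Weak c₂ α c₂' ∧ R c₁' c₂'

/-- An answer with at most one visible action splits into silent steps around that action. In this
form simulations are easier to build and to compose. -/
theorem simulated_iff : Simulated X Y ↔ ∃ R, IsSimulation X Y R := by
  constructor
  · rintro ⟨R, h0, hR⟩
    refine ⟨R, h0, fun c₁ c₂ h α c₁' ht => ?_⟩
    obtain ⟨ls, c₂', hp, hh, hr⟩ := hR c₁ c₂ h α c₁' ht
    exact ⟨c₂', hp.weak hh, hr⟩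
  · rintro ⟨R, h0, hR⟩
    refine ⟨R, h0, fun c₁ c₂ h α c₁' ht => ?_⟩
    obtain ⟨c₂', hw, hr⟩ := hR c₁ c₂ h α c₁' ht
    obtain ⟨ls, hp, hh⟩ := hw.exists_path
    exact ⟨ls, c₂', hp, hh, hr⟩

namespace IsSimulation

variable {R : X.State → Y.State → Prop}

theorem silent (hR : IsSimulation X Y R) {c₁ c₁' : X.State} {c₂ : Y.State} (h : R c₁ c₂)
    (hs : X.Silent c₁ c₁') : ∃ c₂', Y.Silent c₂ c₂' ∧ R c₁' c₂' := by
  induction hs with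
  | refl => exact ⟨c₂, .refl, h⟩
  | tail _ ht ih =>
    obtain ⟨d, hd, hr⟩ := ih
    obtain ⟨i, hi⟩ := ht
    obtain ⟨d', hd', hr'⟩ := hR.2 _ _ hr _ _ hi
    exact ⟨d', Relation.ReflTransGen.trans hd hd', hr'⟩

theorem weak (hR : IsSimulation X Y R) {c₁ c₁' : X.State} {c₂ : Y.State} (h : R c₁ c₂)
    {α : Label n M A B} (hs : X.Weak c₁ α c₁') : ∃ c₂', Y.Weak c₂ α c₂' ∧ R c₁' c₂' := by
  cases α with
  | internal i => exact hR.silent h hs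
  | vis e =>
    obtain ⟨c, d, h₁, h₂, h₃⟩ := hs
    obtain ⟨c', hc, hr⟩ := hR.silent h h₁
    obtain ⟨d', hd, hr⟩ := hR.2 _ _ hr _ _ h₂
    obtain ⟨e', he, hr⟩ := hR.silent hr h₃
    exact ⟨e', (hc.trans_weak hd).trans_silent he, hr⟩

theorem path (hR : IsSimulation X Y R) {c₁ c₁' : X.State} {c₂ : Y.State} (h : R c₁ c₂)
    {ls : List (Label n M A B)} (hs : X.Path c₁ ls c₁') :
    ∃ ls' c₂', Y.Path c₂ ls' c₂' ∧ history ls' = history ls := by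
  induction hs generalizing c₂ with
  | nil => exact ⟨[], c₂, .nil _, rfl⟩
  | @cons q q' q'' l ls ht hp ih =>
    obtain ⟨d, hd, hr⟩ := hR.2 _ _ h _ _ ht
    obtain ⟨x, hx, hxh⟩ := hd.exists_path
    obtain ⟨y, e, hy, hyh⟩ := ih hr
    refine ⟨x ++ y, e, hx.append hy, ?_⟩
    rw [history_append, hxh, hyh, ← history_append, List.singleton_append]

end IsSimulation

theorem Simulated.refl (X : LTS.{u, u} (Label n M A B)) : Simulated X X :=
  simulated_iff.2 ⟨Eq, rfl, by rintro c _ rfl α c' h; exact ⟨c', .of_tr h, rfl⟩⟩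

theorem Simulated.trans (h₁ : Simulated X Y) (h₂ : Simulated Y Z) : Simulated X Z := by
  obtain ⟨R, hR⟩ := simulated_iff.1 h₁
  obtain ⟨Q, hQ⟩ := simulated_iff.1 h₂
  refine simulated_iff.2 ⟨fun a c => ∃ b, R a b ∧ Q b c, ⟨_, hR.1, hQ.1⟩, ?_⟩
  rintro a c ⟨b, hab, hbc⟩ α a' ht
  obtain ⟨b', hb, hr⟩ := hR.2 _ _ hab _ _ ht
  obtain ⟨c', hc, hq⟩ := hQ.weak hbc hb
  exact ⟨c', hc, b', hr, hq⟩

/-- A simulation carries every history of the smaller system to the larger one, and linearizability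
is a condition on histories alone. -/
theorem Linearizable.of_simulated {Spec : Set (List (Op M A B))} {O O' : ConcObject n M A B}
    (h : Linearizable Spec O') (hs : Simulated (sem O) (sem O')) : Linearizable Spec O := by
  obtain ⟨R, hR⟩ := simulated_iff.1 hs
  rintro e ⟨q, hq⟩
  obtain ⟨ls, c, hp, hh⟩ := hR.path hR.1 hq
  rw [← hh]
  exact h ls ⟨c, hp⟩

end Weak

/-! ## The order on the classes of mutually similar systems -/

namespace SimClass

variable {n : ℕ} {M A B : Type u} {Spec : Set (List (Op M A B))}

theorem ext_carrier {S T : SimClass n Spec} (h : S.carrier = T.carrier) : S = T := by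
  cases S; cases T; cases h; rfl

/-- The order on the classes. -/
abbrev le (n : ℕ) (Spec : Set (List (Op M A B))) : LE (SimClass n Spec) :=
  ⟨fun S T => ∃ X ∈ S.carrier, ∃ Y ∈ T.carrier, Simulated X Y⟩

attribute [local instance] SimClass.le

/-- The order asks for some pair of representatives; as the members of a class simulate each other,
any pair serves. -/
theorem le_iff {S T : SimClass n Spec} {X Y : LTS.{u, u} (Label n M A B)} (hX : X ∈ S.carrier)
    (hY : Y ∈ T.carrier) : S ≤ T ↔ Simulated X Y :=
  ⟨fun ⟨X', hX', Y', hY', h⟩ =>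
    ((S.similar X hX X' hX').1.trans h).trans (T.similar Y' hY' Y hY).1,
    fun h => ⟨X, hX, Y, hY, h⟩⟩

/-- This is where the closure condition of a class enters: it turns mutual similarity of classes
into equality of sets. -/
theorem carrier_subset {S T : SimClass n Spec} (h : S ≤ T) (h' : T ≤ S) :
    S.carrier ⊆ T.carrier := by
  intro X hX
  obtain ⟨Y, hY⟩ := T.nonempty
  obtain ⟨O, hO, rfl⟩ := S.linearizable X hX
  exact T.closed O hO Y hY ((le_iff hX hY).1 h) ((le_iff hY hX).1 h')

/-- Mutual similarity of the classes is equality. -/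
abbrev partialOrder (n : ℕ) (Spec : Set (List (Op M A B))) : PartialOrder (SimClass n Spec) where
  le_refl S := by
    obtain ⟨X, hX⟩ := S.nonempty
    exact ⟨X, hX, X, hX, .refl X⟩
  le_trans S T U h h' := by
    obtain ⟨X, hX⟩ := S.nonempty
    obtain ⟨Y, hY⟩ := T.nonempty
    obtain ⟨Z, hZ⟩ := U.nonempty
    exact (le_iff hX hZ).2 (((le_iff hX hY).1 h).trans ((le_iff hY hZ).1 h'))
  le_antisymm S T h h' :=
    ext_carrier (Set.Subset.antisymm (carrier_subset h h') (carrier_subset h' h))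

attribute [local instance] SimClass.partialOrder

/-- The class of a linearizable object. -/
def of (O : ConcObject n M A B) (hO : Linearizable Spec O) : SimClass n Spec where
  carrier := {X | (∃ O' : ConcObject n M A B, Linearizable Spec O' ∧ X = sem O') ∧
    Simulated X (sem O) ∧ Simulated (sem O) X}
  nonempty := ⟨sem O, ⟨O, hO, rfl⟩, .refl _, .refl _⟩
  linearizable _ h := h.1
  similar _ hX _ hY := ⟨hX.2.1.trans hY.2.2, hY.2.1.trans hX.2.2⟩
  closed O' hO' _ hX h h' := ⟨⟨O', hO', rfl⟩, h.trans hX.2.1, hX.2.2.trans h'⟩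

theorem mem_of (O : ConcObject n M A B) (hO : Linearizable Spec O) : sem O ∈ (of O hO).carrier :=
  ⟨⟨O, hO, rfl⟩, .refl _, .refl _⟩

theorem eq_of_mem {S T : SimClass n Spec} {X : LTS.{u, u} (Label n M A B)} (hS : X ∈ S.carrier)
    (hT : X ∈ T.carrier) : S = T :=
  le_antisymm ((le_iff hS hT).2 (.refl X)) ((le_iff hT hS).2 (.refl X))

theorem exists_object (S : SimClass n Spec) :
    ∃ O : ConcObject n M A B, Linearizable Spec O ∧ sem O ∈ S.carrier := by
  obtain ⟨X, hX⟩ := S.nonempty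
  obtain ⟨O, hO, rfl⟩ := S.linearizable X hX
  exact ⟨O, hO, hX⟩

/-- Membership only provides some linearizable object with the same transition system, so
linearizability is transported along the identity simulation. -/
theorem linearizable_of_mem {S : SimClass n Spec} {O : ConcObject n M A B}
    (h : sem O ∈ S.carrier) : Linearizable Spec O := by
  obtain ⟨O', hO', h'⟩ := S.linearizable _ h
  exact hO'.of_simulated (h' ▸ .refl _)

end SimClass

/-! ### Simulations for the minimum and for the greatest lower bound. -/

section Lattice

variable {n : ℕ} {M A B : Type u}

/-! ## Runs of a single process -/

/-- A sequence of commands of process `i`. -/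
def ConcObject.Run (O : ConcObject n M A B) (i : Fin n) (x y : O.Loc × O.Shared) : Prop :=
  Relation.ReflTransGen (fun x y => O.step i x.1 x.2 y.1 y.2) x y

theorem ConcObject.Run.step {O : ConcObject n M A B} {i : Fin n} {l l' : O.Loc} {s s' : O.Shared}
    (h : O.step i l s l' s') : O.Run i (l, s) (l', s') :=
  Relation.ReflTransGen.single (r := fun x y : O.Loc × O.Shared => O.step i x.1 x.2 y.1 y.2)
    (a := (l, s)) (b := (l', s')) h

theorem ConcObject.Run.trans {O : ConcObject n M A B} {i : Fin n} {x y z : O.Loc × O.Shared}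
    (h : O.Run i x y) (h' : O.Run i y z) : O.Run i x z :=
  Relation.ReflTransGen.trans h h'

theorem ConcObject.Run.cons {O : ConcObject n M A B} {i : Fin n} {l l' : O.Loc} {s s' : O.Shared}
    {y : O.Loc × O.Shared} (h : O.step i l s l' s') (h' : O.Run i (l', s') y) :
    O.Run i (l, s) y :=
  (ConcObject.Run.step h).trans h'

theorem ConcObject.Run.silent {O : ConcObject n M A B} {i : Fin n} {m : M}
    {f : Fin n → Option (M × O.Loc)} {l l' : O.Loc} {s s' : O.Shared} (hf : f i = some (m, l))
    (h : O.Run i (l, s) (l', s')) :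
    (sem O).Silent ⟨s, f⟩ ⟨s', Function.update f i (some (m, l'))⟩ := by
  suffices H : ∀ y, O.Run i (l, s) y →
      (sem O).Silent ⟨s, f⟩ ⟨y.2, Function.update f i (some (m, y.1))⟩ from H _ h
  intro y hy
  induction hy with
  | refl =>
    change (sem O).Silent ⟨s, f⟩ ⟨s, Function.update f i (some (m, l))⟩
    rw [← hf, Function.update_eq_self]
    exact .refl
  | tail _ hs ih =>
    refine ih.tail ⟨i, ?_⟩
    have := Trans.internal (O := O) ⟨_, Function.update f i _⟩ i m _ _ _
      (Function.update_self ..) hs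
    rwa [Function.update_idem] at this

/-! ## Related control states -/

/-- The same processes execute the same methods, in related local states. -/
def CtrlRel {L L' : Type u} (P : Fin n → L → L' → Prop) (f : Fin n → Option (M × L))
    (g : Fin n → Option (M × L')) : Prop :=
  ∀ i, (f i = none ∧ g i = none) ∨ ∃ m l l', f i = some (m, l) ∧ g i = some (m, l') ∧ P i l l'

namespace CtrlRel

variable {L L' : Type u} {P : Fin n → L → L' → Prop} {f : Fin n → Option (M × L)}
  {g : Fin n → Option (M × L')}

theorem update_some (h : CtrlRel P f g) (i : Fin n) (m : M) {l : L} {l' : L'} (hp : P i l l') :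
    CtrlRel P (Function.update f i (some (m, l))) (Function.update g i (some (m, l'))) := by
  intro j
  by_cases hj : j = i
  · subst hj; exact .inr ⟨m, l, l', by simp, by simp, hp⟩
  · simpa [hj] using h j

theorem update_none (h : CtrlRel P f g) (i : Fin n) :
    CtrlRel P (Function.update f i none) (Function.update g i none) := by
  intro j
  by_cases hj : j = i
  · subst hj; exact .inl ⟨by simp, by simp⟩
  · simpa [hj] using h j

theorem update_update_none (h : CtrlRel P f g) (i : Fin n) (x : Option (M × L')) :
    CtrlRel P (Function.update f i none) (Function.update (Function.update g i x) i none) := by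
  rw [Function.update_idem]
  exact h.update_none i

/-- For stuttering: the left process moves while the right one stays in place. -/
theorem update_left (h : CtrlRel P f g) {i : Fin n} {m : M} {l : L} {l' : L'}
    (hg : g i = some (m, l')) (hp : P i l l') :
    CtrlRel P (Function.update f i (some (m, l))) g := by
  have := h.update_some i m hp
  rwa [← hg, Function.update_eq_self] at this

theorem right_none (h : CtrlRel P f g) {i : Fin n} (hf : f i = none) : g i = none := by
  rcases h i with h | ⟨m, l, l', h₁, h₂, h₃⟩
  · exact h.2
  · simp [hf] at h₁

theorem right_some (h : CtrlRel P f g) {i : Fin n} {m : M} {l : L} (hf : f i = some (m, l)) :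
    ∃ l', g i = some (m, l') ∧ P i l l' := by
  rcases h i with h | ⟨m', l', l'', h₁, h₂, h₃⟩
  · simp [hf] at h
  · rw [hf] at h₁
    cases h₁
    exact ⟨_, h₂, h₃⟩

end CtrlRel

/-! ## The object that never returns -/

/-- Only calls have to be matched: internal steps are answered by no step at all, and returns do not
occur. -/
theorem neverObject_simulated (O : ConcObject n M A B) :
    Simulated (sem (neverObject n M A B)) (sem O) := by
  refine simulated_iff.2 ⟨fun c d => CtrlRel (fun _ _ _ => True) c.ctrl d.ctrl,
    fun i => .inl ⟨rfl, rfl⟩, ?_⟩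
  intro c d h α c' ht
  cases ht with
  | call i m a hc =>
    exact ⟨_, .of_tr (Trans.call d i m a (h.right_none hc)), h.update_some i m trivial⟩
  | internal i m l l' s' hc _ =>
    obtain ⟨x, hx, _⟩ := h.right_some hc
    exact ⟨d, .refl, h.update_left hx trivial⟩
  | ret i m l b hc hr => cases hr

/-! ## The greatest lower bound -/

/-- The local state of the first component of a call of the greatest lower bound object. -/
def GLBLoc.Fst {O₁ O₂ : ConcObject n M A B} (i : Fin n) : GLBLoc O₁ O₂ → O₁.Loc → Prop
  | .line1 m a, l => l = O₁.start i m a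
  | .line2 _ _ l₁, l => l = l₁
  -- Once the component has delivered its value, the matching call in `O₁` rests in a final state
  -- until the whole call returns. If the two values differ, the call never returns and nothing has
  -- to be remembered.
  | .loop (.inl l₁) _, l => l = l₁
  | .loop (.inr b) _, l => O₁.result l = some b
  | .line6 b, l => O₁.result l = some b
  | .line8, _ => True

/-- The local state of the second component of a call of the greatest lower bound object. -/
def GLBLoc.Snd {O₁ O₂ : ConcObject n M A B} (i : Fin n) : GLBLoc O₁ O₂ → O₂.Loc → Prop
  | .line1 m a, l => l = O₂.start i m a
  | .line2 m a _, l => l = O₂.start i m a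
  | .loop _ (.inl l₂), l => l = l₂
  | .loop _ (.inr b), l => O₂.result l = some b
  | .line6 b, l => O₂.result l = some b
  | .line8, _ => True

/-- Projection to the first component. Steps of the second component and of the control flow are
invisible here, and a return is matched by the final state in which the first component is waiting.
-/
theorem glbObject_simulated_left (O₁ O₂ : ConcObject n M A B) :
    Simulated (sem (glbObject O₁ O₂)) (sem O₁) := by
  refine simulated_iff.2 ⟨fun c d => c.shared.1 = d.shared ∧ CtrlRel GLBLoc.Fst c.ctrl d.ctrl,
    ⟨rfl, fun i => .inl ⟨rfl, rfl⟩⟩, ?_⟩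
  rintro c ⟨ds, df⟩ ⟨rfl, h⟩ α c' ht
  cases ht with
  | call i m a hc =>
    exact ⟨_, .of_tr (Trans.call ⟨c.shared.1, df⟩ i m a (h.right_none hc)), rfl,
      h.update_some i m rfl⟩
  | ret i m l b hc hr =>
    obtain ⟨x, hx, hP⟩ := h.right_some hc
    cases l <;> cases hr
    exact ⟨_, .of_tr (Trans.ret ⟨c.shared.1, df⟩ i m x b hx hP), rfl, h.update_none i⟩
  | internal i m l l' s' hc hs =>
    obtain ⟨x, hx, hP⟩ := h.right_some hc
    obtain ⟨cs, cf⟩ := c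
    cases hs with
    | step₁ l x₂ s₁ s₂ l' s₁' hs =>
      cases hP
      exact ⟨_, .of_tr (Trans.internal ⟨s₁, df⟩ i m _ l' s₁' hx hs), rfl,
        h.update_some i m rfl⟩
    | done₁ l x₂ s b hr => cases hP; exact ⟨_, .refl, rfl, h.update_left hx hr⟩
    | step₂ x₁ => cases x₁ <;> exact ⟨_, .refl, rfl, h.update_left hx hP⟩
    | done₂ x₁ _ => cases x₁ <;> exact ⟨_, .refl, rfl, h.update_left hx hP⟩
    | _ => first
      | exact ⟨_, .refl, rfl, h.update_left hx hP⟩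
      | exact ⟨_, .refl, rfl, h.update_left hx trivial⟩

theorem glbObject_simulated_right (O₁ O₂ : ConcObject n M A B) :
    Simulated (sem (glbObject O₁ O₂)) (sem O₂) := by
  refine simulated_iff.2 ⟨fun c d => c.shared.2 = d.shared ∧ CtrlRel GLBLoc.Snd c.ctrl d.ctrl,
    ⟨rfl, fun i => .inl ⟨rfl, rfl⟩⟩, ?_⟩
  rintro c ⟨ds, df⟩ ⟨rfl, h⟩ α c' ht
  cases ht with
  | call i m a hc =>
    exact ⟨_, .of_tr (Trans.call ⟨c.shared.2, df⟩ i m a (h.right_none hc)), rfl,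
      h.update_some i m rfl⟩
  | ret i m l b hc hr =>
    obtain ⟨x, hx, hP⟩ := h.right_some hc
    cases l <;> cases hr
    exact ⟨_, .of_tr (Trans.ret ⟨c.shared.2, df⟩ i m x b hx hP), rfl, h.update_none i⟩
  | internal i m l l' s' hc hs =>
    obtain ⟨x, hx, hP⟩ := h.right_some hc
    obtain ⟨cs, cf⟩ := c
    cases hs with
    | step₂ x₁ l s₁ s₂ l' s₂' hs =>
      cases hP
      exact ⟨_, .of_tr (Trans.internal ⟨s₂, df⟩ i m _ l' s₂' hx hs), rfl,
        h.update_some i m rfl⟩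
    | done₂ x₁ l s b hr => cases hP; exact ⟨_, .refl, rfl, h.update_left hx hr⟩
    | step₁ l x₂ => cases x₂ <;> exact ⟨_, .refl, rfl, h.update_left hx hP⟩
    | done₁ _ x₂ => cases x₂ <;> exact ⟨_, .refl, rfl, h.update_left hx hP⟩
    | _ => first
      | exact ⟨_, .refl, rfl, h.update_left hx hP⟩
      | exact ⟨_, .refl, rfl, h.update_left hx trivial⟩

/-- The configuration of the greatest lower bound object in which all running calls are in the
loop, with the given configurations of its two components. -/
def GLBPair {O₁ O₂ : ConcObject n M A B} (c₁ : Config O₁) (c₂ : Config O₂)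
    (g : Config (glbObject O₁ O₂)) : Prop :=
  g.shared = (c₁.shared, c₂.shared) ∧
    ∀ i, (c₁.ctrl i = none ∧ c₂.ctrl i = none ∧ g.ctrl i = none) ∨
      ∃ m l₁ l₂, c₁.ctrl i = some (m, l₁) ∧ c₂.ctrl i = some (m, l₂) ∧
        g.ctrl i = some (m, .loop (.inl l₁) (.inl l₂))

namespace GLBPair

variable {O₁ O₂ : ConcObject n M A B}

theorem of_some {c₁ : Config O₁} {c₂ : Config O₂} {g : Config (glbObject O₁ O₂)}
    (h : GLBPair c₁ c₂ g) {i : Fin n} {m : M} {l : O₁.Loc} (hc : c₁.ctrl i = some (m, l)) :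
    ∃ l₂, c₂.ctrl i = some (m, l₂) ∧ g.ctrl i = some (m, .loop (.inl l) (.inl l₂)) := by
  rcases h.2 i with h | ⟨m', l₁, l₂, h₁, h₂, h₃⟩
  · simp [hc] at h
  · rw [hc] at h₁
    cases h₁
    exact ⟨l₂, h₂, h₃⟩

theorem of_some_right {c₁ : Config O₁} {c₂ : Config O₂} {g : Config (glbObject O₁ O₂)}
    (h : GLBPair c₁ c₂ g) {i : Fin n} {m : M} {l : O₂.Loc} (hc : c₂.ctrl i = some (m, l)) :
    ∃ l₁, c₁.ctrl i = some (m, l₁) ∧ g.ctrl i = some (m, .loop (.inl l₁) (.inl l)) := by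
  rcases h.2 i with h | ⟨m', l₁, l₂, h₁, h₂, h₃⟩
  · simp [hc] at h
  · rw [hc] at h₂
    cases h₂
    exact ⟨l₁, h₁, h₃⟩

theorem of_none {c₁ : Config O₁} {c₂ : Config O₂} {g : Config (glbObject O₁ O₂)}
    (h : GLBPair c₁ c₂ g) {i : Fin n} (hc : c₁.ctrl i = none) : g.ctrl i = none := by
  rcases h.2 i with h | ⟨m', l₁, l₂, h₁, h₂, h₃⟩
  · exact h.2.2
  · simp [hc] at h₁

theorem update_some {s₁ s₁' : O₁.Shared} {s₂ s₂' : O₂.Shared} {f₁ : Fin n → Option (M × O₁.Loc)}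
    {f₂ : Fin n → Option (M × O₂.Loc)} {s : (glbObject O₁ O₂).Shared}
    {f : Fin n → Option (M × (glbObject O₁ O₂).Loc)}
    (h : GLBPair ⟨s₁, f₁⟩ ⟨s₂, f₂⟩ ⟨s, f⟩) (i : Fin n) (m : M) (l₁ : O₁.Loc) (l₂ : O₂.Loc) :
    GLBPair ⟨s₁', Function.update f₁ i (some (m, l₁))⟩ ⟨s₂', Function.update f₂ i (some (m, l₂))⟩
      ⟨(s₁', s₂'), Function.update f i (some (m, .loop (.inl l₁) (.inl l₂)))⟩ := by
  refine ⟨rfl, fun j => ?_⟩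
  by_cases hj : j = i
  · subst hj; exact .inr ⟨m, l₁, l₂, by simp, by simp, by simp⟩
  · simpa [hj] using h.2 j

theorem silent_left {c₁ c₁' : Config O₁} {c₂ : Config O₂} {g : Config (glbObject O₁ O₂)}
    (h : GLBPair c₁ c₂ g) (hs : (sem O₁).Silent c₁ c₁') :
    ∃ g', (sem (glbObject O₁ O₂)).Silent g g' ∧ GLBPair c₁' c₂ g' := by
  induction hs with
  | refl => exact ⟨g, .refl, h⟩
  | @tail d d' _ ht ih =>
    obtain ⟨⟨s, f⟩, hg, hp⟩ := ih
    obtain ⟨i, hi⟩ := ht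
    cases hi with
    | internal _ m l l' s' hc hs =>
      obtain ⟨l₂, h₂, h₃⟩ := hp.of_some hc
      have hsh : s = _ := hp.1
      subst hsh
      refine ⟨_, hg.tail ⟨i, Trans.internal _ i m _ _ _ h₃ (.step₁ _ _ _ _ _ _ hs)⟩, ?_⟩
      have := update_some (s₁' := s') (s₂' := c₂.shared) hp i m l' l₂
      rwa [← h₂, Function.update_eq_self] at this

theorem silent_right {c₁ : Config O₁} {c₂ c₂' : Config O₂} {g : Config (glbObject O₁ O₂)}
    (h : GLBPair c₁ c₂ g) (hs : (sem O₂).Silent c₂ c₂') :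
    ∃ g', (sem (glbObject O₁ O₂)).Silent g g' ∧ GLBPair c₁ c₂' g' := by
  induction hs with
  | refl => exact ⟨g, .refl, h⟩
  | @tail d d' _ ht ih =>
    obtain ⟨⟨s, f⟩, hg, hp⟩ := ih
    obtain ⟨i, hi⟩ := ht
    cases hi with
    | internal _ m l l' s' hc hs =>
      obtain ⟨l₁, h₁, h₃⟩ := hp.of_some_right hc
      have hsh : s = _ := hp.1
      subst hsh
      refine ⟨_, hg.tail ⟨i, Trans.internal _ i m _ _ _ h₃ (.step₂ _ _ _ _ _ _ hs)⟩, ?_⟩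
      have := update_some (s₁' := c₁.shared) (s₂' := s') hp i m l₁ l'
      rwa [← h₁, Function.update_eq_self] at this

/-- A call is followed at once by the two commands that enter the loop. Before a return both
components finish; as they return the same `b`, the comparison succeeds. -/
theorem visible {c₁ c₁' : Config O₁} {c₂ c₂' : Config O₂} {g : Config (glbObject O₁ O₂)}
    (h : GLBPair c₁ c₂ g) {e : Event n M A B} (h₁ : Trans O₁ c₁ (.vis e) c₁')
    (h₂ : Trans O₂ c₂ (.vis e) c₂') :
    ∃ g', (sem (glbObject O₁ O₂)).Weak g (.vis e) g' ∧ GLBPair c₁' c₂' g' := by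
  obtain ⟨s, f⟩ := g
  obtain rfl : s = _ := h.1
  cases h₁ with
  | call i m a hc =>
    cases h₂ with
    | call _ _ _ hc' =>
      refine ⟨_, ⟨_, _, .refl, Trans.call _ i m a (h.of_none hc), ?_⟩,
        update_some h i m (O₁.start i m a) (O₂.start i m a)⟩
      have := ConcObject.Run.silent (O := glbObject O₁ O₂) (i := i) (m := m)
        (f := Function.update f i (some (m, .line1 m a))) (Function.update_self ..)
        (.cons (.line1 m a (c₁.shared, c₂.shared)) (.step (.line2 m a _ _)))
      rwa [Function.update_idem] at this
  | ret i m l b hc hr =>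
    cases h₂ with
    | ret _ _ l' _ hc' hr' =>
      obtain ⟨l₂, hc₂, hg⟩ := h.of_some hc
      rw [hc'] at hc₂
      cases hc₂
      refine ⟨_, ⟨_, _, ConcObject.Run.silent hg
        (.cons (.done₁ _ _ _ _ hr) (.cons (.done₂ _ _ _ _ hr') (.step (.line5_same b _)))),
        Trans.ret _ i m (GLBLoc.line6 b) b (Function.update_self ..) rfl, .refl⟩, rfl, fun j => ?_⟩
      by_cases hj : j = i
      · subst hj; exact .inl ⟨by simp, by simp, by simp⟩
      · simpa [hj] using h.2 j

theorem weak {c₁ c₁' : Config O₁} {c₂ c₂' : Config O₂} {g : Config (glbObject O₁ O₂)}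
    (h : GLBPair c₁ c₂ g) {α : Label n M A B} (h₁ : (sem O₁).Weak c₁ α c₁')
    (h₂ : (sem O₂).Weak c₂ α c₂') :
    ∃ g', (sem (glbObject O₁ O₂)).Weak g α g' ∧ GLBPair c₁' c₂' g' := by
  have silent {c₁ c₁' : Config O₁} {c₂ c₂' : Config O₂} {g : Config (glbObject O₁ O₂)}
      (h : GLBPair c₁ c₂ g) (h₁ : (sem O₁).Silent c₁ c₁') (h₂ : (sem O₂).Silent c₂ c₂') :
      ∃ g', (sem (glbObject O₁ O₂)).Silent g g' ∧ GLBPair c₁' c₂' g' := by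
    obtain ⟨g₁, hg₁, h⟩ := h.silent_left h₁
    obtain ⟨g₂, hg₂, h⟩ := h.silent_right h₂
    exact ⟨g₂, Relation.ReflTransGen.trans hg₁ hg₂, h⟩
  cases α with
  | internal i => exact silent h h₁ h₂
  | vis e =>
    obtain ⟨x₁, y₁, hx₁, ht₁, hy₁⟩ := h₁
    obtain ⟨x₂, y₂, hx₂, ht₂, hy₂⟩ := h₂
    obtain ⟨g₁, hg₁, h⟩ := silent h hx₁ hx₂
    obtain ⟨g₂, hg₂, h⟩ := h.visible ht₁ ht₂
    obtain ⟨g₃, hg₃, h⟩ := silent h hy₁ hy₂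
    exact ⟨g₃, (hg₁.trans_weak hg₂).trans_silent hg₃, h⟩

end GLBPair

/-- The answers of the two given simulations have the same visible action and act on disjoint
memories, so they can be interleaved and synchronised at that action. -/
theorem simulated_glbObject {X : LTS.{u, u} (Label n M A B)} {O₁ O₂ : ConcObject n M A B}
    (h₁ : Simulated X (sem O₁)) (h₂ : Simulated X (sem O₂)) :
    Simulated X (sem (glbObject O₁ O₂)) := by
  obtain ⟨R₁, hR₁⟩ := simulated_iff.1 h₁
  obtain ⟨R₂, hR₂⟩ := simulated_iff.1 h₂
  refine simulated_iff.2 ⟨fun x g => ∃ c₁ c₂, R₁ x c₁ ∧ R₂ x c₂ ∧ GLBPair c₁ c₂ g,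
    ⟨_, _, hR₁.1, hR₂.1, rfl, fun i => .inl ⟨rfl, rfl, rfl⟩⟩, ?_⟩
  rintro x g ⟨c₁, c₂, hx₁, hx₂, hg⟩ α x' ht
  obtain ⟨c₁', hw₁, hr₁⟩ := hR₁.2 _ _ hx₁ _ _ ht
  obtain ⟨c₂', hw₂, hr₂⟩ := hR₂.2 _ _ hx₂ _ _ ht
  obtain ⟨g', hw, hp⟩ := hg.weak hw₁ hw₂
  exact ⟨g', hw, c₁', c₂', hr₁, hr₂, hp⟩

end Lattice

section LeastUpperBound

variable {n : ℕ} {M A B : Type u}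

/-! ## The least upper bound -/

/-- The lines that set and test `choice` run directly after each call, and the first call sets
`choice` to `1`. So all calls run in `o₁`, and `choice` is never `0`. -/
theorem simulated_lubObject_left (O₁ O₂ : ConcObject n M A B) :
    Simulated (sem O₁) (sem (lubObject O₁ O₂)) := by
  refine simulated_iff.2 ⟨fun c d =>
    CtrlRel (fun _ l x => x = LUBLoc.line6 l) c.ctrl d.ctrl ∧ d.shared.fst = c.shared ∧
      (d.shared.choice = some 1 ∨ d.shared.choice = none),
    ⟨fun i => .inl ⟨rfl, rfl⟩, rfl, .inr rfl⟩, ?_⟩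
  rintro ⟨_, cf⟩ ⟨⟨s₁, s₂, x⟩, df⟩ ⟨h, rfl, hx⟩ α c' ht
  cases ht with
  | call i m a hc =>
    refine ⟨⟨⟨s₁, s₂, some 1⟩, Function.update df i (some (m, .line6 (O₁.start i m a)))⟩,
      ⟨_, _, .refl, Trans.call _ i m a (h.right_none hc), ?_⟩, h.update_some i m rfl, rfl,
      .inl rfl⟩
    have run : (lubObject O₁ O₂).Run i (.line1 m a, ⟨s₁, s₂, x⟩)
        (.line6 (O₁.start i m a), ⟨s₁, s₂, some 1⟩) := by
      rcases hx with rfl | rfl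
      · exact .cons (.line1_set m a _ nofun) (.step (.line3_nonzero m a _ (by simp)))
      · exact .cons (.line1_bot m a _ rfl) (.cons (.cas_success m a _ 1 rfl)
          (.step (.line3_nonzero m a _ (by simp))))
    have := run.silent (m := m) (Function.update_self i (some (m, .line1 m a)) df)
    rwa [Function.update_idem] at this
  | ret i m l b hc hr =>
    obtain ⟨_, hd, rfl⟩ := h.right_some hc
    refine ⟨_, ⟨_, _, ConcObject.Run.silent (O := lubObject O₁ O₂) hd
      (.step (.line6_done l _ b hr)),
      Trans.ret _ i m (LUBLoc.line7 b) b (Function.update_self ..) rfl, .refl⟩,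
      h.update_update_none i _, rfl, hx⟩
  | internal i m l l' s' hc hs =>
    obtain ⟨_, hd, rfl⟩ := h.right_some hc
    exact ⟨_, .of_tr (Trans.internal (O := lubObject O₁ O₂) _ i m _ _ _ hd
      (.line6_step l _ l' s' hs)), h.update_some i m rfl, rfl, hx⟩

theorem simulated_lubObject_right (O₁ O₂ : ConcObject n M A B) :
    Simulated (sem O₂) (sem (lubObject O₁ O₂)) := by
  refine simulated_iff.2 ⟨fun c d =>
    CtrlRel (fun _ l x => x = LUBLoc.line4 l) c.ctrl d.ctrl ∧ d.shared.snd = c.shared ∧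
      (d.shared.choice = some 0 ∨ d.shared.choice = none),
    ⟨fun i => .inl ⟨rfl, rfl⟩, rfl, .inr rfl⟩, ?_⟩
  rintro ⟨_, cf⟩ ⟨⟨s₁, s₂, x⟩, df⟩ ⟨h, rfl, hx⟩ α c' ht
  cases ht with
  | call i m a hc =>
    refine ⟨⟨⟨s₁, s₂, some 0⟩, Function.update df i (some (m, .line4 (O₂.start i m a)))⟩,
      ⟨_, _, .refl, Trans.call _ i m a (h.right_none hc), ?_⟩, h.update_some i m rfl, rfl,
      .inl rfl⟩
    have run : (lubObject O₁ O₂).Run i (.line1 m a, ⟨s₁, s₂, x⟩)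
        (.line4 (O₂.start i m a), ⟨s₁, s₂, some 0⟩) := by
      rcases hx with rfl | rfl
      · exact .cons (.line1_set m a _ nofun) (.step (.line3_zero m a _ rfl))
      · exact .cons (.line1_bot m a _ rfl) (.cons (.cas_success m a _ 0 rfl)
          (.step (.line3_zero m a _ rfl)))
    have := run.silent (m := m) (Function.update_self i (some (m, .line1 m a)) df)
    rwa [Function.update_idem] at this
  | ret i m l b hc hr =>
    obtain ⟨_, hd, rfl⟩ := h.right_some hc
    refine ⟨_, ⟨_, _, ConcObject.Run.silent (O := lubObject O₁ O₂) hd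
      (.step (.line4_done l _ b hr)),
      Trans.ret _ i m (LUBLoc.line7 b) b (Function.update_self ..) rfl, .refl⟩,
      h.update_update_none i _, rfl, hx⟩
  | internal i m l l' s' hc hs =>
    obtain ⟨_, hd, rfl⟩ := h.right_some hc
    exact ⟨_, .of_tr (Trans.internal (O := lubObject O₁ O₂) _ i m _ _ _ hd
      (.line4_step l _ l' s' hs)), h.update_some i m rfl, rfl, hx⟩

theorem idle_iff_of_silent {O : ConcObject n M A B} {c d : Config O} (h : (sem O).Silent c d)
    (i : Fin n) : d.ctrl i = none ↔ c.ctrl i = none := by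
  induction h with
  | refl => rfl
  | tail _ ht ih =>
    obtain ⟨j, hj⟩ := ht
    cases hj with
    | internal _ m l l' s' hc hs =>
      rw [← ih]
      by_cases hij : i = j
      · subst hij; simp [hc]
      · simp [hij]

/-- Internal transitions commute with a later call of a process that is idle. -/
theorem LTS.Silent.update_idle {O : ConcObject n M A B} {c d : Config O}
    (h : (sem O).Silent c d) {i : Fin n} (hc : c.ctrl i = none) (x : Option (M × O.Loc)) :
    (sem O).Silent ⟨c.shared, Function.update c.ctrl i x⟩
      ⟨d.shared, Function.update d.ctrl i x⟩ := by
  induction h with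
  | refl => exact .refl
  | @tail d d' h ht ih =>
    obtain ⟨j, hj⟩ := ht
    have hi := (idle_iff_of_silent h i).2 hc
    refine ih.tail ⟨j, ?_⟩
    cases hj with
    | internal _ m l l' s' hd hs =>
      have hij : j ≠ i := by rintro rfl; simp [hi] at hd
      have := Trans.internal (O := O) ⟨d.shared, Function.update d.ctrl i x⟩ j m l l' s'
        (by simpa [hij] using hd) hs
      dsimp only at this ⊢
      rwa [Function.update_comm hij.symm] at this

/-- `R` relates `c` to a configuration reachable from `d` by internal transitions. -/
def Ahead {X Y : LTS.{u, u} (Label n M A B)} (R : X.State → Y.State → Prop) (c : X.State)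
    (d : Y.State) : Prop :=
  ∃ d', R c d' ∧ Y.Silent d d'

theorem Ahead.tr {X Y : LTS.{u, u} (Label n M A B)} {R : X.State → Y.State → Prop}
    (hR : IsSimulation X Y R) {c c' : X.State} {d : Y.State} (h : Ahead R c d)
    {α : Label n M A B} (ht : X.tr c α c') : ∃ d', Y.Weak d α d' ∧ Ahead R c' d' := by
  obtain ⟨e, he, hs⟩ := h
  obtain ⟨d', hw, hr⟩ := hR.2 _ _ he _ _ ht
  exact ⟨d', hs.trans_weak hw, d', hr, .refl⟩

/-- The answer of the simulation to the call may contain silent steps before and after it. Those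
before it commute with the call because process `i` is idle, so all of them can be postponed. The
bare call then serves every simulation `R` at the same time. -/
theorem Ahead.call {O₁ O : ConcObject n M A B} {R : (sem O₁).State → (sem O).State → Prop}
    (hR : IsSimulation (sem O₁) (sem O) R) {c : Config O₁} {d : Config O} (h : Ahead R c d)
    {i : Fin n} (m : M) (a : A) (hc : c.ctrl i = none) :
    d.ctrl i = none ∧
      Ahead R (⟨c.shared, Function.update c.ctrl i (some (m, O₁.start i m a))⟩ : Config O₁)
        (⟨d.shared, Function.update d.ctrl i (some (m, O.start i m a))⟩ : Config O) := by
  obtain ⟨d', ⟨e, e', h₁, h₂, h₃⟩, f, hf, h₄⟩ := Ahead.tr hR h (Trans.call c i m a hc)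
  cases h₂ with
  | call _ _ _ he =>
    have hd := (idle_iff_of_silent h₁ i).1 he
    exact ⟨hd, f, hf, ((h₁.update_idle hd _).trans h₃).trans h₄⟩

/-- The local state of `o₁` in a call of the least upper bound object that has chosen, or may
still choose, `o₁`. -/
def LUBLoc.Fst {O₁ O₂ : ConcObject n M A B} (i : Fin n) : LUBLoc O₁ O₂ → O₁.Loc → Prop
  | .line1 m a, l => l = O₁.start i m a
  | .line2 m a, l => l = O₁.start i m a
  | .line3 m a, l => l = O₁.start i m a
  | .line4 _, _ => False
  | .line6 l', l => l = l'
  | .line7 b, l => O₁.result l = some b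

/-- The local state of `o₂` in a call of the least upper bound object that has chosen, or may
still choose, `o₂`. -/
def LUBLoc.Snd {O₁ O₂ : ConcObject n M A B} (i : Fin n) : LUBLoc O₁ O₂ → O₂.Loc → Prop
  | .line1 m a, l => l = O₂.start i m a
  | .line2 m a, l => l = O₂.start i m a
  | .line3 m a, l => l = O₂.start i m a
  | .line4 l', l => l = l'
  | .line6 _, _ => False
  | .line7 b, l => O₂.result l = some b

/-- The local states that occur before `choice` is set. -/
def LUBLoc.Early {O₁ O₂ : ConcObject n M A B} : LUBLoc O₁ O₂ → Prop
  | .line1 _ _ => True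
  | .line2 _ _ => True
  | _ => False

/-- As long as `choice` is unset, the relation keeps a configuration of `O₁` and one of `O₂`, both
up to `Ahead` with the same `d`. Only calls are visible in this phase, and they leave both
alternatives open. After the choice only one alternative is needed, and the next component step or
return lets `O` catch up. -/
theorem lubObject_simulated {O₁ O₂ O : ConcObject n M A B}
    (h₁ : Simulated (sem O₁) (sem O)) (h₂ : Simulated (sem O₂) (sem O)) :
    Simulated (sem (lubObject O₁ O₂)) (sem O) := by
  obtain ⟨R₁, hR₁⟩ := simulated_iff.1 h₁
  obtain ⟨R₂, hR₂⟩ := simulated_iff.1 h₂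
  refine simulated_iff.2 ⟨fun g d =>
    (g.shared.choice ≠ some 0 → ∃ c : Config O₁,
      g.shared.fst = c.shared ∧ CtrlRel LUBLoc.Fst g.ctrl c.ctrl ∧ Ahead R₁ c d) ∧
    (g.shared.choice ≠ some 1 → ∃ c : Config O₂,
      g.shared.snd = c.shared ∧ CtrlRel LUBLoc.Snd g.ctrl c.ctrl ∧ Ahead R₂ c d) ∧
    (g.shared.choice = none → ∀ i m x, g.ctrl i = some (m, x) → LUBLoc.Early x),
    ⟨fun _ => ⟨_, rfl, fun i => .inl ⟨rfl, rfl⟩, _, hR₁.1, .refl⟩,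
      fun _ => ⟨_, rfl, fun i => .inl ⟨rfl, rfl⟩, _, hR₂.1, .refl⟩, fun _ i m x h => by cases h⟩,
    ?_⟩
  rintro ⟨⟨s₁, s₂, x⟩, f⟩ d ⟨hf, hs, he⟩ α g' ht
  have early {i : Fin n} {y : Option (M × LUBLoc O₁ O₂)}
      (hy : x = none → ∀ m z, y = some (m, z) → z.Early) :
      x = none → ∀ j m z, Function.update f i y j = some (m, z) → z.Early := by
    intro hx j m z hz
    by_cases hj : j = i
    · subst hj; exact hy hx m z ((Function.update_self j y f).symm.trans hz)
    · exact he hx j m z ((Function.update_of_ne hj y f).symm.trans hz)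
  -- Commands that change neither the components nor `choice`: `O` does not move, and only the local
  -- state has to be related anew.
  have stutter {i : Fin n} {m : M} {l l' : LUBLoc O₁ O₂} (hc : f i = some (m, l))
      (e₁ : x ≠ some 0 → ∀ z, l.Fst i z → l'.Fst i z)
      (e₂ : x ≠ some 1 → ∀ z, l.Snd i z → l'.Snd i z) (e₃ : x = none → l'.Early) :
      (x ≠ some 0 → ∃ c : Config O₁, s₁ = c.shared ∧
        CtrlRel LUBLoc.Fst (Function.update f i (some (m, l'))) c.ctrl ∧ Ahead R₁ c d) ∧
      (x ≠ some 1 → ∃ c : Config O₂, s₂ = c.shared ∧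
        CtrlRel LUBLoc.Snd (Function.update f i (some (m, l'))) c.ctrl ∧ Ahead R₂ c d) ∧
      (x = none → ∀ j m' z, Function.update f i (some (m, l')) j = some (m', z) → z.Early) := by
    refine ⟨fun h => ?_, fun h => ?_, early ?_⟩
    · obtain ⟨c, h₁, h₂, h₃⟩ := hf h
      obtain ⟨z, hz, hP⟩ := h₂.right_some hc
      exact ⟨c, h₁, h₂.update_left hz (e₁ h _ hP), h₃⟩
    · obtain ⟨c, h₁, h₂, h₃⟩ := hs h
      obtain ⟨z, hz, hP⟩ := h₂.right_some hc
      exact ⟨c, h₁, h₂.update_left hz (e₂ h _ hP), h₃⟩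
    · rintro h _ _ ⟨⟩; exact e₃ h
  cases ht with
  | call i m a hc =>
    refine ⟨⟨d.shared, Function.update d.ctrl i (some (m, O.start i m a))⟩,
      .of_tr (Trans.call d i m a ?_),
      fun h => ?_, fun h => ?_, early ?_⟩
    · by_cases h : x = some 0
      · obtain ⟨c, h₁, h₂, h₃⟩ := hs (by simp [h])
        exact (h₃.call hR₂ m a (h₂.right_none hc)).1
      · obtain ⟨c, h₁, h₂, h₃⟩ := hf h
        exact (h₃.call hR₁ m a (h₂.right_none hc)).1
    · obtain ⟨c, h₁, h₂, h₃⟩ := hf h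
      exact ⟨⟨c.shared, Function.update c.ctrl i (some (m, O₁.start i m a))⟩, h₁,
        h₂.update_some i m rfl, (h₃.call hR₁ m a (h₂.right_none hc)).2⟩
    · obtain ⟨c, h₁, h₂, h₃⟩ := hs h
      exact ⟨⟨c.shared, Function.update c.ctrl i (some (m, O₂.start i m a))⟩, h₁,
        h₂.update_some i m rfl, (h₃.call hR₂ m a (h₂.right_none hc)).2⟩
    · rintro _ _ _ ⟨⟩; trivial
  | ret i m l b hc hr =>
    cases l <;> cases hr
    by_cases h : x = some 0
    · obtain ⟨c, h₁, h₂, h₃⟩ := hs (by simp [h])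
      obtain ⟨z, hz, hP⟩ := h₂.right_some hc
      obtain ⟨d', hd, ha⟩ := h₃.tr hR₂ (Trans.ret c i m z b hz hP)
      exact ⟨d', hd, fun h' => absurd h h',
        fun _ => ⟨⟨c.shared, Function.update c.ctrl i none⟩, h₁, h₂.update_none i, ha⟩,
        early nofun⟩
    · obtain ⟨c, h₁, h₂, h₃⟩ := hf h
      obtain ⟨z, hz, hP⟩ := h₂.right_some hc
      obtain ⟨d', hd, ha⟩ := h₃.tr hR₁ (Trans.ret c i m z b hz hP)
      refine ⟨d', hd,
        fun _ => ⟨⟨c.shared, Function.update c.ctrl i none⟩, h₁, h₂.update_none i, ha⟩,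
        fun h' => ?_, early nofun⟩
      -- With both values excluded, `choice` is unset; but then no call can have reached `line7`.
      have hx : x = none := by
        rcases x with _ | k
        · rfl
        · change some k ≠ some 1 at h'; simp at h h'; omega
      exact (he hx _ _ _ hc).elim
  | internal i m l l' s' hc hst =>
    cases hst with
    | line1_bot m' a _ hx =>
      exact ⟨d, .refl, stutter hc (fun _ _ h => h) (fun _ _ h => h) fun _ => trivial⟩
    | line1_set m' a _ hx =>
      exact ⟨d, .refl, stutter hc (fun _ _ h => h) (fun _ _ h => h) fun h => absurd h hx⟩
    | cas_fail m' a _ hx =>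
      exact ⟨d, .refl, stutter hc (fun _ _ h => h) (fun _ _ h => h) fun h => absurd h hx⟩
    | cas_success m' a _ y hx =>
      obtain rfl : x = none := hx
      obtain ⟨c₁, h₁, h₂, h₃⟩ := hf nofun
      obtain ⟨c₂, k₁, k₂, k₃⟩ := hs nofun
      obtain ⟨z₁, hz₁, hP₁⟩ := h₂.right_some hc
      obtain ⟨z₂, hz₂, hP₂⟩ := k₂.right_some hc
      exact ⟨d, .refl, fun _ => ⟨c₁, h₁, h₂.update_left hz₁ hP₁, h₃⟩,
        fun _ => ⟨c₂, k₁, k₂.update_left hz₂ hP₂, k₃⟩, nofun⟩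
    | line3_zero m' a _ hx =>
      obtain rfl : x = some 0 := hx
      exact ⟨d, .refl, stutter hc (fun h => absurd rfl h) (fun _ _ h => h) nofun⟩
    | line3_nonzero m' a _ hx =>
      -- A call reaches `line3` only after `choice` has been set.
      have hn : x ≠ none := fun h => he h _ _ _ hc
      refine ⟨d, .refl, stutter hc (fun _ _ h => h) (fun h => ?_) fun h => absurd h hn⟩
      change x ≠ some 0 at hx
      rcases x with _ | k
      · exact absurd rfl hn
      · simp at h hx; omega
    | line4_done l _ b hr =>
      exact ⟨d, .refl, stutter hc (fun _ _ h => h.elim) (fun _ _ h => by cases h; exact hr)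
        fun h => (he h _ _ _ hc).elim⟩
    | line6_done l _ b hr =>
      exact ⟨d, .refl, stutter hc (fun _ _ h => by cases h; exact hr) (fun _ _ h => h.elim)
        fun h => (he h _ _ _ hc).elim⟩
    | line4_step l _ l' t' hst =>
      -- A call at `line4` corresponds to no local state of `O₁`, so the alternative for `O₁` must
      -- already be closed.
      have hx : x = some 0 := by
        by_contra h
        obtain ⟨c, h₁, h₂, h₃⟩ := hf h
        obtain ⟨z, hz, hP⟩ := h₂.right_some hc
        exact hP
      obtain ⟨c, h₁, h₂, h₃⟩ := hs (by simp [hx])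
      obtain ⟨z, hz, rfl⟩ := h₂.right_some hc
      obtain rfl : s₂ = _ := h₁
      obtain ⟨d', hd, ha⟩ := h₃.tr hR₂ (Trans.internal c i m z l' t' hz hst)
      exact ⟨d', hd, fun h => absurd hx h,
        fun _ => ⟨⟨t', Function.update c.ctrl i (some (m, l'))⟩, rfl, h₂.update_some i m rfl, ha⟩,
        fun h => by simp [hx] at h⟩
    | line6_step l _ l' t' hst =>
      have hx : x = some 1 := by
        by_contra h
        obtain ⟨c, h₁, h₂, h₃⟩ := hs h
        obtain ⟨z, hz, hP⟩ := h₂.right_some hc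
        exact hP
      obtain ⟨c, h₁, h₂, h₃⟩ := hf (by simp [hx])
      obtain ⟨z, hz, rfl⟩ := h₂.right_some hc
      obtain rfl : s₁ = _ := h₁
      obtain ⟨d', hd, ha⟩ := h₃.tr hR₁ (Trans.internal c i m z l' t' hz hst)
      exact ⟨d', hd, fun _ => ⟨⟨t', Function.update c.ctrl i (some (m, l'))⟩, rfl,
        h₂.update_some i m rfl, ha⟩, fun h => absurd hx h,
        fun h => by simp [hx] at h⟩

end LeastUpperBound

/-! ### Histories process by process, and a characterisation of linearizations. -/

section HistoryLemmas

variable {n : ℕ} {M A B : Type u}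

/-! ## Histories of a single process -/

namespace Event

@[simp] theorem pid_call (i : Fin n) (m : M) (a : A) : (call i m a : Event n M A B).pid = i := rfl

@[simp] theorem pid_ret (i : Fin n) (m : M) (b : B) : (ret i m b : Event n M A B).pid = i := rfl

@[simp] theorem isCall_call (i : Fin n) (m : M) (a : A) :
    (call i m a : Event n M A B).isCall = true := rfl

@[simp] theorem isCall_ret (i : Fin n) (m : M) (b : B) :
    (ret i m b : Event n M A B).isCall = false := rfl

@[simp] theorem isRet_call (i : Fin n) (m : M) (a : A) :
    (call i m a : Event n M A B).isRet = false := rfl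

@[simp] theorem isRet_ret (i : Fin n) (m : M) (b : B) :
    (ret i m b : Event n M A B).isRet = true := rfl

end Event

/-- The operations of process `i` in `l`. -/
def procOps (l : List (Fin n × Op M A B)) (i : Fin n) : List (Fin n × Op M A B) :=
  l.filter fun x => decide (x.1 = i)

theorem retValue_eq (l : List (Fin n × Op M A B)) (o : Oid n) :
    retValue l o = ((procOps l o.1)[o.2]?).map fun x => x.2.val := rfl

/-- The call action of a pending call of process `i`. -/
def pendingCall (B : Type u) (i : Fin n) : Option (M × A) → List (Event n M A B)
  | none => []
  | some (m, a) => [.call i m a]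

/-- The history of process `i` with the completed operations `x` and the pending call `p`. -/
def procHistory (i : Fin n) (x : List (Fin n × Op M A B)) (p : Option (M × A)) :
    List (Event n M A B) :=
  seqHistory x ++ pendingCall B i p

theorem seqHistory_append (x y : List (Fin n × Op M A B)) :
    seqHistory (x ++ y) = seqHistory x ++ seqHistory y := by
  induction x with
  | nil => rfl
  | cons a x ih => simp [seqHistory, ih]

theorem subhistory_append (x y : List (Event n M A B)) (i : Fin n) :
    subhistory (x ++ y) i = subhistory x i ++ subhistory y i := List.filter_append ..

theorem subhistory_singleton_self (e : Event n M A B) : subhistory [e] e.pid = [e] := by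
  simp [subhistory]

theorem subhistory_singleton_of_ne {e : Event n M A B} {i : Fin n} (h : e.pid ≠ i) :
    subhistory [e] i = [] := by
  simp [subhistory, h]

theorem mem_subhistory {h : List (Event n M A B)} {i : Fin n} {e : Event n M A B} :
    e ∈ subhistory h i ↔ e ∈ h ∧ e.pid = i := by
  simp [subhistory]

theorem subhistory_seqHistory (l : List (Fin n × Op M A B)) (i : Fin n) :
    subhistory (seqHistory l) i = seqHistory (procOps l i) := by
  induction l with
  | nil => rfl
  | cons x l ih =>
    obtain ⟨j, o⟩ := x
    simp only [subhistory] at ih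
    by_cases h : j = i <;> simp [subhistory, procOps, seqHistory, h, ih]

theorem mem_procOps {l : List (Fin n × Op M A B)} {i : Fin n} {x : Fin n × Op M A B} :
    x ∈ procOps l i ↔ x ∈ l ∧ x.1 = i := by
  simp [procOps]

/-- Whether a call is pending depends only on later actions of its own process, and these survive
the restriction to that process. -/
theorem complete_subhistory (h : List (Event n M A B)) (i : Fin n) :
    subhistory (complete h) i = complete (subhistory h i) := by
  induction h with
  | nil => rfl
  | cons e t ih =>
    have any : ∀ j, j = i → ((t.filter fun e => decide (e.pid = i)).any
        fun e => e.isRet && decide (e.pid = j)) = t.any fun e => e.isRet && decide (e.pid = j) := by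
      rintro j rfl
      rw [List.any_filter]
      congr 1
      funext e
      by_cases h : e.pid = j <;> simp [h]
    simp only [subhistory] at ih
    cases e with
    | ret j m b =>
      by_cases h : j = i <;> simp [complete, subhistory, h, ih]
    | call j m a =>
      by_cases h : j = i
      · simp only [complete, subhistory, List.filter_cons, Event.pid_call, h, decide_true, if_true,
          any i rfl]
        split <;> simp [ih]
      · simp only [complete, subhistory, List.filter_cons, Event.pid_call, h, decide_false]
        split <;> simp [h, ih]

/-- An alternating sequence can be parsed in only one way. This identifies the completed operations
and pending calls that come from different hypotheses on the same history. -/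
theorem procHistory_injective {i : Fin n} {x y : List (Fin n × Op M A B)} {p q : Option (M × A)}
    (h : procHistory i x p = procHistory i y q) : x = y ∧ p = q := by
  induction x generalizing y with
  | nil =>
    rcases y with _ | ⟨⟨j, o⟩, y⟩ <;> rcases p with _ | ⟨m, a⟩ <;> rcases q with _ | ⟨m', a'⟩ <;>
      simp_all [procHistory, seqHistory, pendingCall]
  | cons x xs ih =>
    obtain ⟨k, o'⟩ := x
    rcases y with _ | ⟨⟨j, o⟩, y⟩
    · rcases p with _ | ⟨m, a⟩ <;> rcases q with _ | ⟨m', a'⟩ <;>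
        simp_all [procHistory, seqHistory, pendingCall]
    · obtain ⟨m, a, b⟩ := o
      obtain ⟨m', a', b'⟩ := o'
      simp only [procHistory, seqHistory, List.cons_append, List.cons.injEq,
        Event.call.injEq, Event.ret.injEq] at h
      obtain ⟨⟨rfl, rfl, rfl⟩, ⟨_, _, rfl⟩, h⟩ := h
      obtain ⟨rfl, rfl⟩ := ih h
      exact ⟨rfl, rfl⟩

theorem procHistory_none (i : Fin n) (x : List (Fin n × Op M A B)) :
    procHistory i x none = seqHistory x := by simp [procHistory, pendingCall]

theorem procHistory_none_call (i : Fin n) (x : List (Fin n × Op M A B)) (m : M) (a : A) :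
    procHistory i x none ++ [.call i m a] = procHistory i x (some (m, a)) := by
  simp [procHistory, pendingCall]

theorem procHistory_some_ret (i : Fin n) (x : List (Fin n × Op M A B)) (m : M) (a : A) (b : B) :
    procHistory i x (some (m, a)) ++ [.ret i m b] = procHistory i (x ++ [(i, ⟨m, a, b⟩)]) none := by
  simp [procHistory, pendingCall, seqHistory_append, seqHistory]

theorem alternating_procHistory (i : Fin n) (x : List (Fin n × Op M A B)) (p : Option (M × A)) :
    Alternating (procHistory i x p) := by
  induction x with
  | nil => rcases p with _ | ⟨m, a⟩ <;> simp [procHistory, pendingCall, seqHistory, Alternating]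
  | cons x xs ih => exact ⟨rfl, ih⟩

theorem Alternating.eq_procHistory {i : Fin n} : ∀ {y : List (Event n M A B)}, Alternating y →
    (∀ e ∈ y, e.pid = i) → ∃ x p, (∀ z ∈ x, z.1 = i) ∧ y = procHistory i x p
  | [], _, _ => ⟨[], none, by simp, rfl⟩
  | [.call j m a], _, hi => by
    obtain rfl : j = i := hi (.call j m a) (by simp)
    exact ⟨[], some (m, a), by simp, rfl⟩
  | .call j m a :: .ret j' m' b :: t, h, hi => by
    obtain ⟨rfl, h⟩ := h
    obtain rfl : j = i := hi (.call j m a) (by simp)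
    obtain rfl : j' = j := hi (.ret j' m b) (by simp)
    obtain ⟨x, p, hx, rfl⟩ := Alternating.eq_procHistory (i := j') h
      fun e he => hi e (by simp [he])
    exact ⟨(j', ⟨m, a, b⟩) :: x, p, by simpa using hx, rfl⟩
  | .ret _ _ _ :: _, h, _ => by simp [Alternating] at h
  | .call _ _ _ :: .call _ _ _ :: _, h, _ => by simp [Alternating] at h

/-- Normal form of a process: its completed operations and possibly a pending call. The arguments
below use this pair instead of sequences of actions. -/
theorem wellFormed_iff {h : List (Event n M A B)} :
    WellFormed h ↔ ∀ i, ∃ x p, (∀ z ∈ x, z.1 = i) ∧ subhistory h i = procHistory i x p := by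
  constructor
  · exact fun H i => (H i).eq_procHistory fun e he => (mem_subhistory.1 he).2
  · intro H i
    obtain ⟨x, p, _, hx⟩ := H i
    rw [hx]
    exact alternating_procHistory i x p

theorem complete_procHistory {i : Fin n} {x : List (Fin n × Op M A B)} (p : Option (M × A))
    (hx : ∀ z ∈ x, z.1 = i) : complete (procHistory i x p) = seqHistory x := by
  induction x with
  | nil => rcases p with _ | ⟨m, a⟩ <;> simp [procHistory, pendingCall, seqHistory, complete]
  | cons x xs ih =>
    have ih := ih fun z hz => hx z (by simp [hz])
    simp only [procHistory] at ih
    simp [procHistory, seqHistory, complete, ih]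

theorem numCalls_subhistory (h : List (Event n M A B)) (i : Fin n) :
    numCalls (subhistory h i) i = numCalls h i := by
  simp only [numCalls, subhistory, List.countP_filter]
  congr 1; funext e; by_cases h : e.pid = i <;> simp [h]

theorem numRets_subhistory (h : List (Event n M A B)) (i : Fin n) :
    numRets (subhistory h i) i = numRets h i := by
  simp only [numRets, subhistory, List.countP_filter]
  congr 1; funext e; by_cases h : e.pid = i <;> simp [h]

theorem numCalls_append (x y : List (Event n M A B)) (i : Fin n) :
    numCalls (x ++ y) i = numCalls x i + numCalls y i := List.countP_append ..

theorem numRets_append (x y : List (Event n M A B)) (i : Fin n) :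
    numRets (x ++ y) i = numRets x i + numRets y i := List.countP_append ..

theorem numCalls_procHistory {i : Fin n} {x : List (Fin n × Op M A B)} (p : Option (M × A))
    (hx : ∀ z ∈ x, z.1 = i) :
    numCalls (procHistory i x p) i = x.length + (pendingCall B i p).length := by
  induction x with
  | nil =>
    rcases p with _ | ⟨m, a⟩ <;>
      simp [procHistory, pendingCall, seqHistory, numCalls]
  | cons x xs ih =>
    have ih := ih fun z hz => hx z (by simp [hz])
    have := hx x (by simp)
    simp only [procHistory, numCalls] at ih
    simp [procHistory, seqHistory, numCalls, ih, this]
    omega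

theorem numRets_procHistory {i : Fin n} {x : List (Fin n × Op M A B)} (p : Option (M × A))
    (hx : ∀ z ∈ x, z.1 = i) : numRets (procHistory i x p) i = x.length := by
  induction x with
  | nil =>
    rcases p with _ | ⟨m, a⟩ <;>
      simp [procHistory, pendingCall, seqHistory, numRets]
  | cons x xs ih =>
    have ih := ih fun z hz => hx z (by simp [hz])
    have := hx x (by simp)
    simp only [procHistory, numRets] at ih
    simp [procHistory, seqHistory, numRets, ih, this]

/-! ## The happen-before relation -/

namespace HappensBefore

variable {h t : List (Event n M A B)} {o₁ o₂ : Fin n × ℕ}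

theorem lt_numRets (H : HappensBefore h o₁ o₂) : o₁.2 < numRets h o₁.1 := by
  obtain ⟨p, t, rfl, h₁, h₂, h₃⟩ := H
  rw [numRets_append]
  omega

theorem lt_numCalls (H : HappensBefore h o₁ o₂) : o₂.2 < numCalls h o₂.1 := by
  obtain ⟨p, t, rfl, h₁, h₂, h₃⟩ := H
  exact h₃

theorem append (H : HappensBefore h o₁ o₂) (t : List (Event n M A B)) :
    HappensBefore (h ++ t) o₁ o₂ := by
  obtain ⟨p, t', rfl, h₁, h₂, h₃⟩ := H
  refine ⟨p, t' ++ t, by simp, h₁, h₂, ?_⟩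
  rw [numCalls_append]
  omega

/-- The prefix that separates the two operations does not contain the call of `o₂`, which lies in
`h`; so it ends inside `h`. -/
theorem of_append (H : HappensBefore (h ++ t) o₁ o₂) (ho : o₂.2 < numCalls h o₂.1) :
    HappensBefore h o₁ o₂ := by
  obtain ⟨p, t', hp, h₁, h₂, h₃⟩ := H
  rcases List.append_eq_append_iff.1 hp with ⟨q, rfl, rfl⟩ | ⟨q, rfl, rfl⟩
  · rw [numCalls_append] at h₂
    omega
  · exact ⟨p, q, rfl, h₁, h₂, ho⟩

theorem of_append_ret {i : Fin n} {m : M} {b : B} (H : HappensBefore (h ++ [.ret i m b]) o₁ o₂) :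
    HappensBefore h o₁ o₂ := by
  refine H.of_append ?_
  have := H.lt_numCalls
  simpa [numCalls] using this

theorem append_call {i : Fin n} (m : M) (a : A) (ho : o₁.2 < numRets h o₁.1) :
    HappensBefore (h ++ [.call i m a]) o₁ (i, numCalls h i) :=
  ⟨h, _, rfl, ho, le_rfl, by simp [numCalls]⟩

end HappensBefore

/-! ## Linearizations -/

/-- `x` consists of the completed operations in the history `y` of process `i`, possibly followed
by the operation of a pending call. -/
def Completes (i : Fin n) (y : List (Event n M A B)) (x : List (Fin n × Op M A B)) : Prop :=
  ∃ ops p, (∀ z ∈ ops, z.1 = i) ∧ y = procHistory i ops p ∧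
    (x = ops ∨ ∃ m a b, p = some (m, a) ∧ x = ops ++ [(i, ⟨m, a, b⟩)])

theorem Completes.prefix {i : Fin n} {ops x : List (Fin n × Op M A B)} {p : Option (M × A)}
    (h : Completes i (procHistory i ops p) x) : ops <+: x := by
  obtain ⟨ops', p', _, h₂, h₃⟩ := h
  obtain ⟨rfl, rfl⟩ := procHistory_injective h₂
  rcases h₃ with rfl | ⟨m, a, b, _, rfl⟩
  · exact List.prefix_rfl
  · exact List.prefix_append ..

theorem Completes.length_le {i : Fin n} {y : List (Event n M A B)}
    {x : List (Fin n × Op M A B)} (h : Completes i y x) : x.length ≤ numCalls y i := by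
  obtain ⟨ops, p, hx, rfl, rfl | ⟨m, a, b, rfl, rfl⟩⟩ := h
  · rw [numCalls_procHistory _ hx]; omega
  · rw [numCalls_procHistory _ hx]; simp [pendingCall]

theorem subhistory_flatMap (f : Fin n → List (Event n M A B)) (hf : ∀ i, ∀ e ∈ f i, e.pid = i)
    (i : Fin n) : subhistory ((List.finRange n).flatMap f) i = f i := by
  have key : ∀ (l : List (Fin n)), l.Nodup →
      subhistory (l.flatMap f) i = if i ∈ l then f i else [] := by
    intro l hl
    induction l with
    | nil => rfl
    | cons j l ih =>
      rw [List.nodup_cons] at hl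
      rw [List.flatMap_cons, subhistory_append, ih hl.2]
      by_cases hj : j = i
      · subst hj
        have : subhistory (f j) j = f j :=
          List.filter_eq_self.2 fun e he => by simpa using hf j e he
        simp [this, hl.1]
      · have : subhistory (f j) i = [] :=
          List.filter_eq_nil_iff.2 fun e he => by simpa [hf j e he] using hj
        simp [this, Ne.symm hj]
  simpa using key _ (List.nodup_finRange n)

/-- For each process whose pending call is included in `l`, the missing return is appended. The
order among these returns is irrelevant, since only subhistories are compared. -/
theorem exists_extension {h : List (Event n M A B)} {l : List (Fin n × Op M A B)}
    (H : ∀ i, Completes i (subhistory h i) (procOps l i)) :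
    ∃ rs : List (Event n M A B), (∀ e ∈ rs, e.isRet = true) ∧ WellFormed (h ++ rs) ∧
      ∀ i, subhistory (complete (h ++ rs)) i = subhistory (seqHistory l) i := by
  have H' : ∀ i, ∃ r : List (Event n M A B), (∀ e ∈ r, e.isRet = true ∧ e.pid = i) ∧
      ∃ p, subhistory h i ++ r = procHistory i (procOps l i) p := by
    intro i
    obtain ⟨ops, p, hx, h₁, h₂ | ⟨m, a, b, rfl, h₂⟩⟩ := H i
    · exact ⟨[], by simp, p, by rw [h₁, h₂]; simp⟩
    · exact ⟨[.ret i m b], by simp, none,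
        by rw [h₁, h₂, procHistory_some_ret]⟩
  choose r hr p hp using H'
  have hsub : ∀ i, subhistory (h ++ (List.finRange n).flatMap r) i =
      procHistory i (procOps l i) (p i) := fun i => by
    rw [subhistory_append, subhistory_flatMap r fun i e he => (hr i e he).2, hp]
  have hops : ∀ i, ∀ z ∈ procOps l i, z.1 = i := fun i z hz => (mem_procOps.1 hz).2
  refine ⟨(List.finRange n).flatMap r, fun e he => ?_,
    wellFormed_iff.2 fun i => ⟨_, _, hops i, hsub i⟩, fun i => ?_⟩
  · obtain ⟨i, _, hi⟩ := List.mem_flatMap.1 he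
    exact (hr i e hi).1
  · rw [complete_subhistory, hsub, complete_procHistory _ (hops i), subhistory_seqHistory]

/-- Since a process alternates, an extension by returns gives it at most one return, namely the one
that answers its pending call. -/
theorem completes_of_extension {h rs : List (Event n M A B)} {l : List (Fin n × Op M A B)}
    (hrs : ∀ e ∈ rs, e.isRet = true) (hw : WellFormed (h ++ rs))
    (hc : ∀ i, subhistory (complete (h ++ rs)) i = subhistory (seqHistory l) i) (i : Fin n) :
    Completes i (subhistory h i) (procOps l i) := by
  obtain ⟨x, p, hx, hh⟩ := wellFormed_iff.1 hw i
  have hl : procOps l i = x := by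
    have := hc i
    rw [complete_subhistory, hh, complete_procHistory _ hx, subhistory_seqHistory,
      ← procHistory_none i, ← procHistory_none i] at this
    exact (procHistory_injective this).1.symm
  rw [subhistory_append] at hh
  have hrs' : ∀ e ∈ subhistory rs i, e.isRet = true := fun e he => hrs e (mem_subhistory.1 he).1
  generalize subhistory h i = y at hh
  generalize subhistory rs i = r at hh hrs'
  rw [hl]
  rcases List.eq_nil_or_concat r with rfl | ⟨r, e, rfl⟩
  · exact ⟨x, p, hx, by simpa using hh, .inl rfl⟩
  · rw [List.concat_eq_append, ← List.append_assoc] at hh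
    have he : e.isRet = true := hrs' e (by simp)
    have hp : p = none := by
      rcases p with _ | ⟨m, a⟩
      · rfl
      · rw [← procHistory_none_call] at hh
        have := (List.append_inj' hh rfl).2
        simp only [List.cons.injEq, and_true] at this
        simp [this] at he
    subst hp
    rcases List.eq_nil_or_concat x with rfl | ⟨x, ⟨j, m, a, b⟩, rfl⟩
    · simp [procHistory, seqHistory, pendingCall] at hh
    · rw [List.concat_eq_append] at hx hh ⊢
      obtain rfl : j = i := hx (j, ⟨m, a, b⟩) (by simp)
      rw [← procHistory_some_ret] at hh
      have hh := (List.append_inj' hh rfl).1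
      have hx' : ∀ z ∈ x, z.1 = j := fun z hz => hx z (by simp [hz])
      rcases List.eq_nil_or_concat r with rfl | ⟨r, e', rfl⟩
      · exact ⟨x, some (m, a), hx', by simpa using hh, .inr ⟨m, a, b, rfl, rfl⟩⟩
      · rw [List.concat_eq_append, ← List.append_assoc, ← procHistory_none_call] at hh
        have he' : e'.isRet = true := hrs' e' (by simp)
        have := (List.append_inj' hh rfl).2
        simp only [List.cons.injEq, and_true] at this
        simp [this] at he'

/-- The extension only decides which pending calls take part and with which values, and `l` itself
shows this. Hence the extension and `complete` can be eliminated. -/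
theorem isLinearization_iff {Spec : Set (List (Op M A B))} {h : List (Event n M A B)}
    {l : List (Fin n × Op M A B)} :
    IsLinearization Spec h l ↔ l.map Prod.snd ∈ Spec ∧
      (∀ i, Completes i (subhistory h i) (procOps l i)) ∧
      ∀ o₁ o₂ : Fin n × ℕ, o₁.2 < (procOps l o₁.1).length → o₂.2 < (procOps l o₂.1).length →
        HappensBefore h o₁ o₂ → HappensBefore (seqHistory l) o₁ o₂ := by
  have num : ∀ rs : List (Event n M A B),
      (∀ i, subhistory (complete (h ++ rs)) i = subhistory (seqHistory l) i) →
      ∀ i, numRets (complete (h ++ rs)) i = (procOps l i).length := fun rs hc i => by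
    rw [← numRets_subhistory, hc, subhistory_seqHistory, ← procHistory_none i,
      numRets_procHistory _ fun z hz => (mem_procOps.1 hz).2]
  constructor
  · rintro ⟨hS, rs, hrs, hw, hc, hb⟩
    refine ⟨hS, completes_of_extension hrs hw hc, fun o₁ o₂ h₁ h₂ => hb o₁ o₂ ?_ ?_⟩
    · rwa [num rs hc]
    · rwa [num rs hc]
  · rintro ⟨hS, hC, hb⟩
    obtain ⟨rs, hrs, hw, hc⟩ := exists_extension hC
    refine ⟨hS, rs, hrs, hw, hc, fun o₁ o₂ h₁ h₂ => hb o₁ o₂ ?_ ?_⟩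
    · rwa [num rs hc] at h₁
    · rwa [num rs hc] at h₂

/-- The history `y` of a process differs from the recorded history `z` at most by a call that is
not yet recorded, or a recorded return that has not yet been executed. -/
def Delayed (i : Fin n) (y z : List (Event n M A B)) : Prop :=
  ∃ ops, (∀ w ∈ ops, w.1 = i) ∧
    ((∃ p, y = procHistory i ops p ∧ z = procHistory i ops p) ∨
      (∃ m a, y = procHistory i ops (some (m, a)) ∧ z = procHistory i ops none) ∨
      ∃ m a b, y = procHistory i ops (some (m, a)) ∧
        z = procHistory i (ops ++ [(i, ⟨m, a, b⟩)]) none)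

/-- A call missing from `r` is pending in `h` and may be left out of the linearization. A return
that is in `r` but not in `h` is a legal completion of a pending call of `h`. -/
theorem IsLinearization.of_delayed {Spec : Set (List (Op M A B))} {h r : List (Event n M A B)}
    {l : List (Fin n × Op M A B)} (H : IsLinearization Spec r l)
    (hd : ∀ i, Delayed i (subhistory h i) (subhistory r i))
    (hb : ∀ o₁ o₂, HappensBefore h o₁ o₂ → o₂.2 < numCalls r o₂.1 → HappensBefore r o₁ o₂) :
    IsLinearization Spec h l := by
  rw [isLinearization_iff] at H ⊢
  obtain ⟨hS, hC, hb'⟩ := H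
  refine ⟨hS, fun i => ?_, fun o₁ o₂ h₁ h₂ h₃ => hb' o₁ o₂ h₁ h₂ (hb o₁ o₂ h₃ ?_)⟩
  · have hC := hC i
    obtain ⟨ops, hops, ⟨p, hy, hz⟩ | ⟨m, a, hy, hz⟩ | ⟨m, a, b, hy, hz⟩⟩ := hd i
    · rwa [hy, ← hz]
    · rw [hz] at hC
      obtain ⟨ops', p', h₁, h₂, h₃⟩ := hC
      obtain ⟨rfl, rfl⟩ := procHistory_injective h₂
      rcases h₃ with h₃ | ⟨m, a, b, h, _⟩
      · exact ⟨ops, _, hops, hy, .inl h₃⟩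
      · cases h
    · rw [hz] at hC
      obtain ⟨ops', p', h₁, h₂, h₃⟩ := hC
      obtain ⟨rfl, rfl⟩ := procHistory_injective h₂
      rcases h₃ with h₃ | ⟨m, a, b, h, _⟩
      · exact ⟨ops, _, hops, hy, .inr ⟨m, a, b, rfl, h₃⟩⟩
      · cases h
  -- Every operation of `l` has its call in `r`, so `hb` applies.
  · have := (hC o₂.1).length_le
    rw [numCalls_subhistory] at this
    omega

/-- The shorter history is a delayed version of the longer one. So a linearization found for the
history after the return can be used before it, and it already fixes the returned value. -/
theorem IsLinearization.of_append_ret {Spec : Set (List (Op M A B))} {h : List (Event n M A B)}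
    {l : List (Fin n × Op M A B)} {i : Fin n} {m : M} {b : B}
    (H : IsLinearization Spec (h ++ [.ret i m b]) l)
    (hw : ∀ j, ∃ ops p, (∀ w ∈ ops, w.1 = j) ∧ subhistory h j = procHistory j ops p)
    {ops : List (Fin n × Op M A B)} {a : A} (hops : ∀ w ∈ ops, w.1 = i)
    (hi : subhistory h i = procHistory i ops (some (m, a))) :
    IsLinearization Spec h l ∧ procOps l i = ops ++ [(i, ⟨m, a, b⟩)] := by
  have hr : subhistory (h ++ [.ret i m b]) i = procHistory i (ops ++ [(i, ⟨m, a, b⟩)]) none := by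
    rw [subhistory_append, hi, ← procHistory_some_ret]
    congr 1
    exact subhistory_singleton_self (.ret i m b)
  refine ⟨H.of_delayed (fun j => ?_) fun o₁ o₂ h₁ _ => h₁.append _, ?_⟩
  · by_cases hj : i = j
    · subst hj
      exact ⟨ops, hops, .inr (.inr ⟨m, a, b, hi, hr⟩)⟩
    · obtain ⟨ops', p, h₁, h₂⟩ := hw j
      refine ⟨ops', h₁, .inl ⟨p, h₂, ?_⟩⟩
      rw [subhistory_append, subhistory_singleton_of_ne (by exact hj), List.append_nil, h₂]
  · obtain ⟨ops', p', h₁, h₂, h₃⟩ := (isLinearization_iff.1 H).2.1 i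
    rw [hr] at h₂
    obtain ⟨rfl, rfl⟩ := procHistory_injective h₂
    rcases h₃ with h₃ | ⟨m, a, b, h, _⟩
    · exact h₃
    · cases h

end HistoryLemmas

section UniversalSimulation

variable {n : ℕ} {M A B : Type u}

/-! ## The universal object simulates every linearizable object -/

/-- The nodes `C 0, …, C L` form the linked list. -/
theorem UShared.Reach.exists_index {s : UShared n M A B} {C : ℕ → NodeRef n} {L : ℕ}
    (hnext : ∀ k ≤ L, ∀ y, (s.heap (C k)).next = some y → k < L ∧ y = C (k + 1))
    {j : ℕ} (hj : j ≤ L) {x : NodeRef n} (h : s.Reach (C j) x) : ∃ k, j ≤ k ∧ k ≤ L ∧ x = C k := by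
  induction h with
  | refl => exact ⟨j, le_rfl, hj, rfl⟩
  | tail _ hn ih =>
    obtain ⟨k, hjk, hk, rfl⟩ := ih
    obtain ⟨hk', rfl⟩ := hnext k hk _ hn
    exact ⟨k + 1, by omega, hk', rfl⟩

theorem UShared.reach_of_next {s : UShared n M A B} {C : ℕ → NodeRef n} {k : ℕ}
    (hnext : ∀ j < k, (s.heap (C j)).next = some (C (j + 1))) : s.Reach (C 0) (C k) := by
  induction k with
  | zero => exact .refl
  | succ k ih => exact (ih fun j hj => hnext j (by omega)).tail (hnext k (by omega))

/-- The history `h` contains the call and the return of the operation `o`, with return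
value `b`. -/
def Returned (h : List (Event n M A B)) (o : Oid n) (b : B) : Prop :=
  ∃ ops, seqHistory ops <+: subhistory h o.1 ∧ (ops[o.2]?).map (fun x => x.2.val) = some b

theorem Returned.append {h : List (Event n M A B)} {o : Oid n} {b : B} (H : Returned h o b)
    (t : List (Event n M A B)) : Returned (h ++ t) o b := by
  obtain ⟨ops, h₁, h₂⟩ := H
  refine ⟨ops, h₁.trans ?_, h₂⟩
  rw [subhistory_append]
  exact List.prefix_append ..

theorem seqHistory_prefix {i : Fin n} {x y : List (Fin n × Op M A B)} {p : Option (M × A)}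
    (h : seqHistory x <+: procHistory i y p) : x <+: y := by
  induction x generalizing y with
  | nil => exact List.nil_prefix
  | cons x xs ih =>
    obtain ⟨k, m, a, b⟩ := x
    rcases y with _ | ⟨⟨j, m', a', b'⟩, y⟩
    · rcases p with _ | ⟨m', a'⟩ <;> simp [procHistory, seqHistory, pendingCall] at h
    · simp only [procHistory, seqHistory, List.cons_append, List.cons_prefix_cons,
        Event.call.injEq, Event.ret.injEq] at h
      obtain ⟨⟨rfl, rfl, rfl⟩, ⟨_, _, rfl⟩, h⟩ := h
      simpa using ih h

theorem Returned.getElem? {h : List (Event n M A B)} {o : Oid n} {b : B} (H : Returned h o b)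
    {ops : List (Fin n × Op M A B)} {p : Option (M × A)}
    (hh : subhistory h o.1 = procHistory o.1 ops p) :
    (ops[o.2]?).map (fun x => x.2.val) = some b := by
  obtain ⟨x, h₁, h₂⟩ := H
  rw [hh] at h₁
  obtain ⟨t, rfl⟩ := seqHistory_prefix h₁
  rw [Option.map_eq_some_iff] at h₂ ⊢
  obtain ⟨z, hz, hb⟩ := h₂
  refine ⟨z, ?_, hb⟩
  rw [List.getElem?_append_left, hz]
  exact (List.getElem?_eq_some_iff.1 hz).1

/-- Completed operations are part of every linearization with their actual values. Hence
linearizations chosen at different times agree on the operations that had returned. -/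
theorem IsLinearization.retValue_of_returned {Spec : Set (List (Op M A B))}
    {h : List (Event n M A B)} {l : List (Fin n × Op M A B)} (H : IsLinearization Spec h l)
    {o : Oid n} {b : B} (hr : Returned h o b) : retValue l o = some b := by
  have hC := (isLinearization_iff.1 H).2.1 o.1
  have hC' := hC
  obtain ⟨ops, p, _, hh, _⟩ := hC'
  rw [hh] at hC
  obtain ⟨t, ht⟩ := hC.prefix
  have := hr.getElem? hh
  rw [retValue_eq, ← ht]
  rw [Option.map_eq_some_iff] at this ⊢
  obtain ⟨z, hz, hb⟩ := this
  refine ⟨z, ?_, hb⟩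
  rw [List.getElem?_append_left, hz]
  exact (List.getElem?_eq_some_iff.1 hz).1

/-- The linked list is `C 0, …, C L`, it consists of the operations that have returned in `h`, and
no further operation has been announced. -/
structure QuietList (s : UShared n M A B) (h : List (Event n M A B)) (C : ℕ → NodeRef n)
    (L : ℕ) : Prop where
  zero : C 0 = none
  seq : ∀ k ≤ L, (s.heap (C k)).seq = k + 1
  next : ∀ k < L, (s.heap (C k)).next = some (C (k + 1))
  next_last : (s.heap (C L)).next = none
  undecided : (s.heap (C L)).decideNext = none
  lin : ∀ k < L, ∀ o, C (k + 1) = some o →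
    ∃ l b, (s.heap (some o)).lin = some l ∧ retValue l o = some b ∧ Returned h o b
  announce : ∀ j, ∃ k ≤ L, s.announce j = C k
  head : ∀ j, ∃ k ≤ L, s.head j = C k
  last : L = 0 ∨ ∃ j, s.head j = C L

namespace QuietList

variable {s : UShared n M A B} {h : List (Event n M A B)} {C : ℕ → NodeRef n} {L : ℕ}

theorem injective (H : QuietList s h C L) {j k : ℕ} (hj : j ≤ L) (hk : k ≤ L) (e : C j = C k) :
    j = k := by
  have h₁ := H.seq j hj
  rw [e, H.seq k hk] at h₁
  omega

theorem append (H : QuietList s h C L) (t : List (Event n M A B)) :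
    QuietList s (h ++ t) C L := by
  refine { H with lin := fun k hk o ho => ?_ }
  obtain ⟨l, b, h₁, h₂, h₃⟩ := H.lin k hk o ho
  exact ⟨l, b, h₁, h₂, h₃.append t⟩

theorem congr (H : QuietList s h C L) {s' : UShared n M A B} (h₁ : s'.heap = s.heap)
    (h₂ : s'.announce = s.announce) (h₃ : s'.head = s.head) : QuietList s' h C L := by
  obtain ⟨a, b, c, d, e, f, g, i, j⟩ := H
  constructor <;> simpa only [h₁, h₂, h₃]

end QuietList

/-- Line 5 finds the last node of the list. -/
theorem scan_run (Spec : Set (List (Op M A B))) {s : UShared n M A B} {C : ℕ → NodeRef n} {L : ℕ}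
    (zero : C 0 = none) (seq : ∀ k ≤ L, (s.heap (C k)).seq = k + 1)
    (head : ∀ j, ∃ k ≤ L, s.head j = C k) (last : L = 0 ∨ ∃ j, s.head j = C L)
    (i : Fin n) (m : M) (o : Oid n) :
    (universalObject n Spec).Run i (.line5 m o 0 none, s) (.line5 m o n (C L), s) := by
  -- Loop invariant: after `j` entries, `best` is a list node at least as far along as all entries
  -- read so far. The scan starts at `tail`, which is `C 0`.
  have key : ∀ j ≤ n, ∃ k ≤ L,
      (universalObject n Spec).Run i (.line5 m o 0 none, s) (.line5 m o j (C k), s) ∧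
      ∀ j' : Fin n, j'.1 < j → ∀ k' ≤ L, s.head j' = C k' → k' ≤ k := by
    intro j hj
    induction j with
    | zero => exact ⟨0, Nat.zero_le _, by rw [zero]; exact .refl, by simp⟩
    | succ j ih =>
      obtain ⟨k, hk, hrun, hmax⟩ := ih (by omega)
      obtain ⟨k₁, hk₁, hh⟩ := head ⟨j, hj⟩
      have hst := UStep.line5_scan (Spec := Spec) (i := i) m o j (C k) s hj
      rw [hh, seq k hk, seq k₁ hk₁] at hst
      have inj : ∀ k' ≤ L, C k₁ = C k' → k' = k₁ := by
        intro k' hk' e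
        have h₁ := seq k₁ hk₁
        rw [e, seq k' hk'] at h₁
        omega
      by_cases hlt : k + 1 < k₁ + 1
      · rw [if_pos hlt] at hst
        refine ⟨k₁, hk₁, hrun.trans (ConcObject.Run.step hst), fun j' hj' k' hk' he => ?_⟩
        by_cases hjj : j'.1 < j
        · have := hmax j' hjj k' hk' he
          omega
        · obtain rfl : j' = ⟨j, hj⟩ := Fin.ext (by simp; omega)
          exact (inj k' hk' (hh.symm.trans he)).le
      · rw [if_neg hlt] at hst
        refine ⟨k, hk, hrun.trans (ConcObject.Run.step hst), fun j' hj' k' hk' he => ?_⟩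
        by_cases hjj : j'.1 < j
        · exact hmax j' hjj k' hk' he
        · obtain rfl : j' = ⟨j, hj⟩ := Fin.ext (by simp; omega)
          have := inj k' hk' (hh.symm.trans he)
          omega
  obtain ⟨k, hk, hrun, hmax⟩ := key n le_rfl
  -- Unless the list is only `tail`, some entry of `head` is its last node, and the scan cannot miss
  -- it.
  have : k = L := by
    rcases last with rfl | ⟨j, hj⟩
    · omega
    · have := hmax j j.2 L le_rfl hj
      omega
  rwa [this] at hrun

/-- When no other operation is pending in the list, a call that has been recorded can append its
own node with any suitable linearization, and return. -/
theorem append_run (Spec : Set (List (Op M A B))) {s : UShared n M A B}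
    {C : ℕ → NodeRef n} {L : ℕ} (H : QuietList s s.recorder C L) {i : Fin n} (m : M) (a : A)
    {o : Oid n} (ho : ∀ k ≤ L, C k ≠ some o) {l : List (Fin n × Op M A B)} {b : B}
    (hl : IsLinearization Spec s.recorder l) (hb : retValue l o = some b)
    (hr : Returned (s.recorder ++ [.ret i m b]) o b) :
    ∃ s' C', (universalObject n Spec).Run i (.line4 m a o, s) (.line24 b, s') ∧
      s'.recorder = s.recorder ++ [.ret i m b] ∧ s'.idGen = s.idGen ∧
      QuietList s' s'.recorder C' (L + 1) := by
  obtain ⟨g, r, heap, ann, hd⟩ := s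
  dsimp only at hl hr H ⊢
  set bef := C L with hbef
  have hne : bef ≠ some o := ho L le_rfl
  -- During the run only the last node and the new node change, so every intermediate heap has the
  -- form `W X Y`.
  let W (X Y : Node n M A B) : NodeRef n → Node n M A B :=
    Function.update (Function.update heap bef X) (some o) Y
  have W_o : ∀ X Y, W X Y (some o) = Y := fun X Y => Function.update_self ..
  have W_bef : ∀ X Y, W X Y bef = X := fun X Y => by simp [W, hne]
  have W_ne : ∀ X Y x, x ≠ bef → x ≠ some o → W X Y x = heap x := fun X Y x h₁ h₂ => by
    simp [W, h₁, h₂]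
  have W_set_o : ∀ X Y Z, Function.update (W X Y) (some o) Z = W X Z := fun X Y Z => by
    simp [W]
  have W_set_bef : ∀ X Y Z, Function.update (W X Y) bef Z = W Z Y := fun X Y Z => by
    simp only [W]
    rw [Function.update_comm hne.symm, Function.update_idem]
  have W_C : ∀ X Y k, k < L → W X Y (C k) = heap (C k) := fun X Y k hk =>
    W_ne X Y _ (fun e => by have := H.injective hk.le le_rfl e; omega) (ho k hk.le)
  let X₀ := heap bef
  let X₁ : Node n M A B := { X₀ with decideNext := some (some o) }
  let X₂ : Node n M A B := { X₁ with next := some (some o) }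
  let Y₀ : Node n M A B := .fresh (some (m, a))
  let Y₁ : Node n M A B := { Y₀ with hist := some r }
  let Y₂ : Node n M A B := { Y₁ with lin := some l }
  -- Since `tail` has number `1`, the node `C L` has number `L + 1` and its successor gets `L + 2`.
  let Y₃ : Node n M A B := { Y₂ with seq := L + 2 }
  have hX₀ : X₀.seq = L + 1 := H.seq L le_rfl
  let ann' := Function.update ann i (some o)
  have hann : ann' i = some o := Function.update_self ..
  let hd₁ := Function.update hd i bef
  let hd₂ := Function.update hd i (some o)
  let O := universalObject n Spec
  have seq₀ : ∀ k ≤ L, (W X₀ Y₀ (C k)).seq = k + 1 := fun k hk => by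
    rcases hk.lt_or_eq with hk' | rfl
    · rw [W_C _ _ _ hk']; exact H.seq k hk
    · rw [← hbef, W_bef]; exact hX₀
  have r4 : O.Run i (.line4 m a o, ⟨g, r, heap, ann, hd⟩)
      (.line5 m o 0 none, ⟨g, r, W X₀ Y₀, ann', hd⟩) := by
    have := UStep.line4 (Spec := Spec) (i := i) m a o ⟨g, r, heap, ann, hd⟩
    have e : W X₀ Y₀ = Function.update heap (some o) Y₀ := by simp [W, X₀]
    rw [e]
    exact .step this
  have r5 : O.Run i (.line5 m o 0 none, ⟨g, r, W X₀ Y₀, ann', hd⟩)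
      (.line5 m o n bef, ⟨g, r, W X₀ Y₀, ann', hd⟩) :=
    scan_run Spec (s := ⟨g, r, W X₀ Y₀, ann', hd⟩) H.zero seq₀ H.head H.last i m o
  have r9 : O.Run i (.line5 m o n bef, ⟨g, r, W X₀ Y₀, ann', hd⟩)
      (.line9 m o bef (ann' ⟨(X₀.seq + 1) % n, Nat.mod_lt _ i.pos⟩),
        ⟨g, r, W X₀ Y₀, ann', hd₁⟩) := by
    refine .cons (.line5_write m o n bef _ le_rfl) (.cons (.line6_enter m o _ ?_)
      (.cons (.line7 m o _) (.step ?_)))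
    · change (W X₀ Y₀ (ann' i)).seq = 0
      rw [hann, W_o]; rfl
    · have := UStep.line8 (Spec := Spec) (i := i) m o bef ⟨g, r, W X₀ Y₀, ann', hd₁⟩
      simp only [W_bef] at this
      change UStep Spec i (.line8 m o (hd₁ i)) _ _ _
      rw [show hd₁ i = bef from Function.update_self ..]
      exact this
  have r13 : O.Run i (.line9 m o bef (ann' ⟨(X₀.seq + 1) % n, Nat.mod_lt _ i.pos⟩),
        ⟨g, r, W X₀ Y₀, ann', hd₁⟩)
      (.line13 m o bef (some o), ⟨g, r, W X₀ Y₀, ann', hd₁⟩) := by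
    -- Whichever process is offered help, the own node is preferred: either it is process `i`
    -- itself, or its announced node is on the list and already numbered.
    generalize (⟨(X₀.seq + 1) % n, Nat.mod_lt _ i.pos⟩ : Fin n) = j
    by_cases hj : j = i
    · subst hj
      have := UStep.line9_help (Spec := Spec) (i := j) m o bef (ann' j)
        ⟨g, r, W X₀ Y₀, ann', hd₁⟩ (by rw [hann]; simp only [W_o]; rfl)
      rw [hann] at this ⊢
      exact .step this
    · have := UStep.line9_own (Spec := Spec) (i := i) m o bef (ann' j)
        ⟨g, r, W X₀ Y₀, ann', hd₁⟩ (by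
          obtain ⟨k, hk, e⟩ := H.announce j
          have : ann' j = C k := by simp only [ann']; rw [Function.update_of_ne hj]; exact e
          rw [this]
          simp only [seq₀ k hk]
          omega)
      simp only [hann] at this
      exact .step this
  have r16 : O.Run i (.line13 m o bef (some o), ⟨g, r, W X₀ Y₀, ann', hd₁⟩)
      (.line16 m o bef (some o), ⟨g, r, W X₁ Y₁, ann', hd₁⟩) := by
    have s13 := UStep.line13_win (Spec := Spec) (i := i) m o bef (some o)
      ⟨g, r, W X₀ Y₀, ann', hd₁⟩ (by simp only [W_bef]; exact H.undecided)
    simp only [UShared.setNode, W_bef, W_set_bef] at s13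
    have s15 := UStep.line15_success (Spec := Spec) (i := i) m o bef (some o) r
      ⟨g, r, W X₁ Y₀, ann', hd₁⟩ (by simp only [W_o]; rfl)
    simp only [UShared.setNode, W_o, W_set_o] at s15
    exact .cons s13 (.cons (.line14 m o bef (some o) _) (.step s15))
  -- The successor of `bef` is decided but not yet linked, so the nodes reachable from `tail` are
  -- still the old ones.
  have next₁ : ∀ k ≤ L, ∀ y, (W X₁ Y₁ (C k)).next = some y → k < L ∧ y = C (k + 1) := by
    intro k hk y hy
    rcases hk.lt_or_eq with hk' | rfl
    · rw [W_C _ _ _ hk', H.next k hk'] at hy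
      cases hy
      exact ⟨hk', rfl⟩
    · rw [← hbef, W_bef] at hy
      have := H.next_last
      change X₀.next = _ at this
      rw [show X₁.next = X₀.next from rfl, this] at hy
      cases hy
  -- The new node stores the current recorder content, of which `l` is a linearization. The older
  -- nodes belong to returned operations, whose values `l` must reproduce.
  have gen : UShared.GenLin Spec ⟨g, r, W X₁ Y₁, ann', hd₁⟩ bef (some o) l := by
    refine ⟨⟨r, by simp only [W_o]; rfl, hl⟩, fun o' ho' => ?_, fun o' h₁ h₂ => ?_⟩
    · cases ho'; exact ⟨b, hb⟩
    · rw [← H.zero] at h₁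
      obtain ⟨k, -, hk, e⟩ := h₁.exists_index next₁ (Nat.zero_le L)
      rcases k with _ | k
      · rw [H.zero] at e; cases e
      · obtain ⟨l', b', g₁, g₂, g₃⟩ := H.lin k hk o' e.symm
        refine ⟨l', b', ?_, g₂, hl.retValue_of_returned g₃⟩
        rcases hk.lt_or_eq with hk' | rfl
        · simp only [e, W_C _ _ _ hk']; rw [← e]; exact g₁
        · simp only [e]; rw [← hbef, W_bef]
          rw [e, ← hbef] at g₁; exact g₁
  have r21 : O.Run i (.line16 m o bef (some o), ⟨g, r, W X₁ Y₁, ann', hd₁⟩)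
      (.line6 m o, ⟨g, r, W X₂ Y₃, ann', hd₂⟩) := by
    have s17 := UStep.line17_success (Spec := Spec) (i := i) m o bef (some o) l
      ⟨g, r, W X₁ Y₁, ann', hd₁⟩ (by simp only [W_o]; rfl)
    simp only [UShared.setNode, W_o, W_set_o] at s17
    have s18 := UStep.line18 (Spec := Spec) (i := i) m o bef (some o)
      ⟨g, r, W X₁ Y₂, ann', hd₁⟩
    simp only [UShared.setNode, W_bef, W_set_bef] at s18
    have s19 := UStep.line19 (Spec := Spec) (i := i) m o bef (some o)
      ⟨g, r, W X₂ Y₂, ann', hd₁⟩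
    simp only [UShared.setNode, W_bef, W_o, W_set_o, show X₂.seq = L + 1 from hX₀] at s19
    have s20 := UStep.line20 (Spec := Spec) (i := i) m o (some o)
      ⟨g, r, W X₂ Y₃, ann', hd₁⟩
    simp only [hd₁, Function.update_idem] at s20
    exact .cons (.line16 m o bef (some o) l _ gen) (.cons s17 (.cons s18 (.cons s19 (.step s20))))
  have next₂ : ∀ k < L, (W X₂ Y₃ (C k)).next = some (C (k + 1)) := fun k hk => by
    rw [W_C _ _ _ hk]; exact H.next k hk
  have r24 : O.Run i (.line6 m o, ⟨g, r, W X₂ Y₃, ann', hd₂⟩)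
      (.line24 b, ⟨g, r ++ [.ret i m b], W X₂ Y₃, ann', hd₂⟩) := by
    have s21 := UStep.line21 (Spec := Spec) (i := i) m o ⟨g, r, W X₂ Y₃, ann', hd₂⟩
    simp only [hann, hd₂, Function.update_idem] at s21
    refine .cons (.line6_exit m o _ ?_) (.cons s21
      (.cons (.line22 m o l b _ ?_ ?_ hb) (.step (.line23 m b _))))
    · change (W X₂ Y₃ (ann' i)).seq ≠ 0
      rw [hann, W_o]; simp [Y₃]
    · have := UShared.reach_of_next (s := ⟨g, r, W X₂ Y₃, ann', hd₂⟩) next₂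
      rw [H.zero] at this
      refine this.tail ?_
      change (W X₂ Y₃ bef).next = _
      rw [W_bef]
    · change (W X₂ Y₃ (some o)).lin = _
      rw [W_o]
  -- The new list has the own node at position `L + 1`; the values of the function beyond that
  -- position play no role.
  refine ⟨⟨g, r ++ [.ret i m b], W X₂ Y₃, ann', hd₂⟩, fun k => if k ≤ L then C k else some o,
    ((((((r4.trans r5).trans r9).trans r13).trans r16).trans r21).trans r24), rfl, rfl, ?_⟩
  have C' : ∀ k, k ≤ L → (if k ≤ L then C k else some o) = C k := fun k hk => if_pos hk
  have C'L : (if L + 1 ≤ L then C (L + 1) else some o) = some o := if_neg (by omega)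
  refine ⟨?_, fun k hk => ?_, fun k hk => ?_, ?_, ?_, fun k hk o' ho' => ?_, fun j => ?_,
    fun j => ?_, .inr ⟨i, ?_⟩⟩
  · rw [C' 0 (Nat.zero_le _), H.zero]
  · dsimp only
    rcases hk.lt_or_eq with hk' | rfl
    · rw [C' k (by omega)]
      rcases (Nat.lt_succ_iff.1 hk').lt_or_eq with hk'' | rfl
      · rw [W_C _ _ _ hk'']; exact H.seq k hk''.le
      · rw [← hbef, W_bef]; exact hX₀
    · rw [C'L, W_o]
  · dsimp only
    rw [C' k (by omega)]
    rcases (Nat.lt_succ_iff.1 hk).lt_or_eq with hk'' | rfl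
    · rw [C' (k + 1) hk'', next₂ k hk'']
    · rw [C'L, ← hbef, W_bef]
  · dsimp only; rw [C'L, W_o]; rfl
  · dsimp only; rw [C'L, W_o]; rfl
  · dsimp only
    rcases (Nat.lt_succ_iff.1 hk).lt_or_eq with hk'' | rfl
    · rw [C' (k + 1) hk''] at ho'
      obtain ⟨l', b', h₁, h₂, h₃⟩ := H.lin k hk'' o' ho'
      refine ⟨l', b', ?_, h₂, h₃.append _⟩
      rw [← ho'] at h₁ ⊢
      rcases (Nat.succ_le_of_lt hk'').lt_or_eq with h | h
      · rw [W_C _ _ _ h]; exact h₁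
      · have h : k + 1 = L := h
        rw [h, ← hbef] at h₁ ⊢
        rw [W_bef]; exact h₁
    · rw [C'L] at ho'
      cases ho'
      exact ⟨l, b, by rw [W_o], hb, hr⟩
  · by_cases hj : j = i
    · subst hj; exact ⟨L + 1, le_rfl, by rw [C'L]; exact hann⟩
    · obtain ⟨k, hk, e⟩ := H.announce j
      exact ⟨k, by omega, by rw [C' k hk]; exact (Function.update_of_ne hj ..).trans e⟩
  · by_cases hj : j = i
    · subst hj; exact ⟨L + 1, le_rfl, by rw [C'L]; exact Function.update_self ..⟩
    · obtain ⟨k, hk, e⟩ := H.head j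
      exact ⟨k, by omega, by rw [C' k hk]; exact (Function.update_of_ne hj ..).trans e⟩
  · rw [C'L]; exact Function.update_self ..

theorem Returned.lt_length {h : List (Event n M A B)} {o : Oid n} {b : B} (H : Returned h o b)
    {ops : List (Fin n × Op M A B)} {p : Option (M × A)}
    (hh : subhistory h o.1 = procHistory o.1 ops p) : o.2 < ops.length := by
  obtain ⟨z, hz, _⟩ := Option.map_eq_some_iff.1 (H.getElem? hh)
  exact (List.getElem?_eq_some_iff.1 hz).1

/-- A call is answered by the call and its recording, after which the process waits at `line4`;
internal steps are not answered. Each return is answered by a complete solo run from `line4` to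
`line24`. Hence, between matched steps, the recorder equals the actual history and no unfinished
operation is announced. The relation also keeps the path that led to `c`, so that linearizability
can be applied to its extension by the return. -/
theorem simulated_universalObject {Spec : Set (List (Op M A B))} {O : ConcObject n M A B}
    (hO : Linearizable Spec O) : Simulated (sem O) (sem (universalObject n Spec)) := by
  refine simulated_iff.2 ⟨fun (c : Config O) (d : Config (universalObject n Spec)) =>
    ∃ ls, (sem O).Path (sem O).initial ls c ∧ UShared.recorder d.shared = history ls ∧
      (∃ C L, QuietList d.shared (history ls) C L) ∧
      ∀ i, ∃ ops p, (∀ z ∈ ops, z.1 = i) ∧ subhistory (history ls) i = procHistory i ops p ∧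
        ((c.ctrl i = none ∧ d.ctrl i = none ∧ p = none ∧
            UShared.idGen d.shared i = ops.length) ∨
          ∃ m a l, p = some (m, a) ∧ c.ctrl i = some (m, l) ∧
            d.ctrl i = some (m, ULoc.line4 m a (i, ops.length)) ∧
            UShared.idGen d.shared i = ops.length + 1), ?_, ?_⟩
  · refine ⟨[], .nil _, rfl, ⟨fun _ => none, 0, ?_⟩,
      fun i => ⟨[], none, by simp, rfl, .inl ⟨rfl, rfl, rfl, rfl⟩⟩⟩
    exact ⟨rfl, fun k hk => by obtain rfl := Nat.le_zero.1 hk; rfl, nofun, rfl, rfl, nofun,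
      fun j => ⟨0, le_rfl, rfl⟩, fun j => ⟨0, le_rfl, rfl⟩, .inl rfl⟩
  · rintro c ⟨⟨g, r, heap, ann, hd⟩, f⟩ ⟨ls, hp, hrec, ⟨C, L, hq⟩, hi⟩ α c' ht
    dsimp only at hrec hi
    subst hrec
    have hp' := hp.append (.single ht)
    have hist : history (ls ++ [α]) = history ls ++ history [α] := history_append ..
    cases ht with
    | internal i m l l' s' hc hs =>
      refine ⟨_, .refl, _, hp', by rw [hist]; exact (List.append_nil _).symm,
        ⟨C, L, by rw [hist]; exact hq.append _⟩, fun j => ?_⟩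
      obtain ⟨ops, p, h₁, h₂, h₃⟩ := hi j
      refine ⟨ops, p, h₁, ?_, ?_⟩
      · rw [hist, ← h₂]
        exact congrArg (fun x => subhistory x j) (List.append_nil _)
      · by_cases hj : j = i
        · subst hj
          rw [hc] at h₃
          rcases h₃ with ⟨h₃, _⟩ | ⟨m', a, l₀, h₃, h₄, h₅⟩
          · cases h₃
          · cases h₄
            exact .inr ⟨m, a, l', h₃, Function.update_self .., h₅⟩
        · simpa only [Function.update_of_ne hj] using h₃
    | call i m a hc =>
      have hist : history (ls ++ [.vis (.call i m a)]) = history ls ++ [.call i m a] := hist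
      obtain ⟨ops, p, h₁, h₂, h₃⟩ := hi i
      rw [hc] at h₃
      obtain ⟨-, hf, rfl, hg⟩ : _ ∧ _ ∧ _ ∧ _ :=
        h₃.resolve_right (by rintro ⟨_, _, _, _, h, _⟩; cases h)
      let s₂ : UShared n M A B :=
        ⟨Function.update g i (g i + 1), history ls ++ [.call i m a], heap, ann, hd⟩
      have run : (universalObject n Spec).Run i (.line2 m a, ⟨g, history ls, heap, ann, hd⟩)
          (.line4 m a (i, g i), s₂) :=
        .cons (.line2 m a _) (.step (.line3 m a (i, g i) _))
      have run := run.silent (m := m) (Function.update_self i (some (m, .line2 m a)) f)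
      rw [Function.update_idem] at run
      refine ⟨_, ⟨_, _, .refl, Trans.call _ i m a hf, run⟩, _, hp', hist.symm,
        ⟨C, L, by rw [hist]; exact (hq.append _).congr rfl rfl rfl⟩, fun j => ?_⟩
      rw [hist, subhistory_append]
      by_cases hj : j = i
      · subst hj
        refine ⟨ops, some (m, a), h₁, ?_, .inr ⟨m, a, _, rfl, Function.update_self .., ?_, ?_⟩⟩
        · rw [h₂, ← procHistory_none_call]
          congr 1
          exact subhistory_singleton_self (.call j m a)
        · rw [← hg]; exact Function.update_self ..
        · rw [← hg]; exact Function.update_self ..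
      · obtain ⟨ops, p, h₁, h₂, h₃⟩ := hi j
        refine ⟨ops, p, h₁, ?_, ?_⟩
        · rw [h₂, subhistory_singleton_of_ne (by exact Ne.symm hj), List.append_nil]
        · simp only [s₂, Function.update_of_ne hj]
          exact h₃
    | ret i m l₀ b hc hres =>
      have hist : history (ls ++ [.vis (.ret i m b)]) = history ls ++ [.ret i m b] := hist
      obtain ⟨ops, p, h₁, h₂, h₃⟩ := hi i
      rw [hc] at h₃
      obtain ⟨m', a, l', rfl, hm, hf, hg⟩ := h₃.resolve_left (by rintro ⟨h, _⟩; cases h)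
      cases hm
      -- The linearization is taken for the history that includes the return about to happen, which
      -- forces the value `b` on this operation.
      obtain ⟨l, hl⟩ := hO _ ⟨_, hp'⟩
      rw [hist] at hl
      obtain ⟨hl', hli⟩ := hl.of_append_ret
        (fun j => by obtain ⟨ops, p, h₁, h₂, _⟩ := hi j; exact ⟨ops, p, h₁, h₂⟩) h₁ h₂
      have hsub : subhistory (history ls ++ [.ret i m b]) i =
          procHistory i (ops ++ [(i, ⟨m, a, b⟩)]) none := by
        rw [subhistory_append, h₂, ← procHistory_some_ret]
        congr 1
        exact subhistory_singleton_self (.ret i m b)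
      -- The node is new: listed operations of process `i` have returned, so their indices are below
      -- `ops.length`, the index of the pending one.
      obtain ⟨s', C', run, hr', hg', hq'⟩ := append_run Spec (i := i) hq m a
        (o := (i, ops.length)) (fun k hk e => by
          rcases k with _ | k
          · rw [hq.zero] at e; cases e
          · obtain ⟨_, _, _, _, hR⟩ := hq.lin k hk _ e
            exact lt_irrefl _ (hR.lt_length h₂)) hl' (b := b)
        (by rw [retValue_eq]; simp [hli])
        ⟨_, by rw [hsub, procHistory_none], by simp⟩
      have run := run.silent (m := m) hf
      refine ⟨_, ⟨_, _, run, Trans.ret _ i m (ULoc.line24 b) b (Function.update_self ..) rfl,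
        .refl⟩, _, hp', hr'.trans hist.symm,
        ⟨C', L + 1, by rw [hist, ← hr']; exact hq'⟩, fun j => ?_⟩
      simp only [hg']
      by_cases hj : j = i
      · subst hj
        refine ⟨_, none, ?_, by rw [hist, hsub],
          .inl ⟨Function.update_self .., Function.update_self .., rfl, ?_⟩⟩
        · intro z hz
          rcases List.mem_append.1 hz with hz | hz
          · exact h₁ z hz
          · rw [List.mem_singleton] at hz; rw [hz]
        · simpa using hg
      · obtain ⟨ops, p, h₁, h₂, h₃⟩ := hi j
        refine ⟨ops, p, h₁, ?_, ?_⟩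
        · rw [hist, subhistory_append, h₂, subhistory_singleton_of_ne (by exact Ne.symm hj),
            List.append_nil]
        · simp only [Function.update_of_ne hj]
          exact h₃

end UniversalSimulation

/-! ### Stability of linearizations, and the invariant of the shared memory. -/

section UniversalInvariant

variable {n : ℕ} {M A B : Type u}

/-! ## Linearizations of extended histories -/

/-- `x` exceeds the completed operations of `y` by at most the pending one, and it has an entry for
each operation of `ops`. So at most one operation was completed after `y`. It is the pending one,
and `hv` says that `x` gave it the right value. -/
theorem Completes.of_prefix {i : Fin n} {y : List (Event n M A B)}
    {x ops : List (Fin n × Op M A B)} {p : Option (M × A)} (H : Completes i y x)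
    (hy : y <+: procHistory i ops p) (hops : ∀ z ∈ ops, z.1 = i)
    (hv : ∀ (q : ℕ) (b : B), (ops[q]?).map (fun z : Fin n × Op M A B => z.2.val) = some b →
      (x[q]?).map (fun z : Fin n × Op M A B => z.2.val) = some b) :
    Completes i (procHistory i ops p) x := by
  obtain ⟨ops₀, p₀, h₀, rfl, hx⟩ := H
  obtain ⟨t, rfl⟩ := seqHistory_prefix ((List.prefix_append ..).trans hy)
  have hlt : ∀ q, q < (ops₀ ++ t).length → q < x.length := fun q hq => by
    obtain ⟨w, hw, _⟩ := Option.map_eq_some_iff.1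
      (hv q (ops₀ ++ t)[q].2.val (by rw [List.getElem?_eq_getElem hq]; rfl))
    exact (List.getElem?_eq_some_iff.1 hw).1
  rcases hx with rfl | ⟨m, a, b, rfl, rfl⟩
  · rcases t with _ | ⟨z, t⟩
    · exact ⟨_, p, h₀, by simp, .inl rfl⟩
    · exact absurd (hlt x.length (by simp)) (lt_irrefl _)
  · rcases t with _ | ⟨z, _ | ⟨w, t⟩⟩
    · refine ⟨ops₀, p, h₀, by simp, .inr ⟨m, a, b, ?_, rfl⟩⟩
      rw [List.append_nil] at hy
      have := (List.prefix_append_right_inj _).1 hy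
      rcases p with _ | ⟨m', a'⟩ <;> simp_all [pendingCall]
    · obtain ⟨j, m', a', b'⟩ := z
      obtain rfl : j = i := hops (j, ⟨m', a', b'⟩) (by simp)
      have hb := hv ops₀.length b' (by simp)
      have hy : seqHistory ops₀ ++ pendingCall B j (some (m, a)) <+:
        seqHistory (ops₀ ++ [(j, ⟨m', a', b'⟩)]) ++ pendingCall B j p := hy
      rw [seqHistory_append, List.append_assoc] at hy
      have := (List.prefix_append_right_inj _).1 hy
      simp only [pendingCall, seqHistory, List.cons_append, List.cons_prefix_cons,
        Event.call.injEq] at this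
      obtain ⟨⟨-, rfl, rfl⟩, -⟩ := this
      simp only [List.getElem?_concat_length, Option.map_some, Option.some.injEq] at hb
      subst hb
      exact ⟨_, p, hops, rfl, .inl rfl⟩
    · have := hlt (ops₀.length + 1) (by simp)
      simp at this

/-- Operations called after `r` are not needed as long as they are pending in `r'`. Longer histories
add no order between operations whose calls are in `r`. What remains to be checked is the agreement
with the values returned meanwhile. -/
theorem IsLinearization.extend {Spec : Set (List (Op M A B))} {r r' : List (Event n M A B)}
    {l : List (Fin n × Op M A B)} (H : IsLinearization Spec r l) (hr : r <+: r')
    (hw : ∀ i, ∃ ops p, (∀ z ∈ ops, z.1 = i) ∧ subhistory r' i = procHistory i ops p ∧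
      ∀ q b, (ops[q]?).map (fun z : Fin n × Op M A B => z.2.val) = some b →
        retValue l (i, q) = some b) :
    IsLinearization Spec r' l := by
  rw [isLinearization_iff] at H ⊢
  obtain ⟨hS, hC, hb⟩ := H
  obtain ⟨t, rfl⟩ := hr
  refine ⟨hS, fun i => ?_, fun o₁ o₂ h₁ h₂ h₃ => hb o₁ o₂ h₁ h₂ (h₃.of_append ?_)⟩
  · obtain ⟨ops, p, hops, hi, hv⟩ := hw i
    rw [hi]
    refine (hC i).of_prefix ?_ hops hv
    rw [← hi, subhistory_append]
    exact List.prefix_append ..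
  · have := (hC o₂.1).length_le
    rw [numCalls_subhistory] at this
    omega

/-! ## The invariant of the shared memory

The nodes that have been decided to be on the linked list are `C 0, …, C L`. -/

/-- The node `x` has been created. -/
def Allocated (s : UShared n M A B) (x : NodeRef n) : Prop :=
  x ≠ none → (s.heap x).invoc ≠ none

/-- The node `x` is on the list, and its sequence number is set. -/
def OnList (s : UShared n M A B) (C : ℕ → NodeRef n) (L : ℕ) (x : NodeRef n) : Prop :=
  ∃ k ≤ L, x = C k ∧ (s.heap x).seq ≠ 0

/-- The node `x` is on the list, and `y` is not on the list up to `x`. -/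
def NotUpTo (s : UShared n M A B) (C : ℕ → NodeRef n) (L : ℕ) (x y : NodeRef n) : Prop :=
  ∃ k ≤ L, x = C k ∧ (s.heap x).seq ≠ 0 ∧ ∀ j ≤ k, y ≠ C j

/-- The node `y` is decided to be the successor of `x = C k`. -/
def Decided (s : UShared n M A B) (C : ℕ → NodeRef n) (L : ℕ) (x y : NodeRef n) (k : ℕ) : Prop :=
  k < L ∧ x = C k ∧ (s.heap x).seq ≠ 0 ∧ y = C (k + 1)

/-- The operation `o` is on the list with return value `b`. -/
def Listed (s : UShared n M A B) (C : ℕ → NodeRef n) (L : ℕ) (o : Oid n) (b : B) : Prop :=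
  OnList s C L (some o) ∧ ∃ l, (s.heap (some o)).lin = some l ∧ retValue l o = some b

/-- `l` is a linearization for the node `C (k + 1)` that agrees with those of the nodes
before it. -/
structure LinFor (Spec : Set (List (Op M A B))) (s : UShared n M A B) (C : ℕ → NodeRef n)
    (k : ℕ) (l : List (Fin n × Op M A B)) : Prop where
  hist : ∃ h, (s.heap (C (k + 1))).hist = some h ∧ IsLinearization Spec h l
  agree : ∀ j < k, ∀ o, C (j + 1) = some o →
    ∃ l' b, (s.heap (some o)).lin = some l' ∧ retValue l' o = some b ∧ retValue l o = some b

/-- The invariant of the shared memory. -/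
structure ListInv (Spec : Set (List (Op M A B))) (s : UShared n M A B) (C : ℕ → NodeRef n)
    (L : ℕ) : Prop where
  zero : C 0 = none
  inj : ∀ j ≤ L, ∀ k ≤ L, C j = C k → j = k
  alloc : ∀ k ≤ L, Allocated s (C k)
  fresh : ∀ x, (∀ k ≤ L, x ≠ C k) → s.heap x = Node.fresh (s.heap x).invoc
  decided : ∀ k < L, (s.heap (C k)).decideNext = some (C (k + 1))
  undecided : (s.heap (C L)).decideNext = none
  seq_eq : ∀ k ≤ L, (s.heap (C k)).seq ≠ 0 → (s.heap (C k)).seq = k + 1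
  -- Only the last node may still be without a number, because a successor is decided only for a
  -- numbered node.
  seq_ne : ∀ k ≤ L, k = 0 ∨ k < L → (s.heap (C k)).seq ≠ 0
  next : ∀ k ≤ L, ∀ y, (s.heap (C k)).next = some y → k < L ∧ y = C (k + 1)
  -- The order in which `lin`, `next` and `seq` are written: a numbered node is linked, and a linked
  -- node has its linearization.
  seq_next : ∀ k < L, (s.heap (C (k + 1))).seq ≠ 0 → (s.heap (C k)).next ≠ none
  next_lin : ∀ k < L, (s.heap (C k)).next ≠ none → (s.heap (C (k + 1))).lin ≠ none
  lin : ∀ k < L, ∀ l, (s.heap (C (k + 1))).lin = some l → LinFor Spec s C k l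
  hist : ∀ x h, (s.heap x).hist = some h → h <+: s.recorder
  announce : ∀ j, Allocated s (s.announce j)
  head : ∀ j, OnList s C L (s.head j)
  idGen : ∀ o : Oid n, s.idGen o.1 ≤ o.2 → (s.heap (some o)).invoc = none

/-- The shared memory `s'` is obtained from `s` by steps of the object. -/
structure Extends (s : UShared n M A B) (C : ℕ → NodeRef n) (L : ℕ) (s' : UShared n M A B)
    (C' : ℕ → NodeRef n) (L' : ℕ) : Prop where
  le : L ≤ L'
  eq : ∀ k ≤ L, C' k = C k
  seq : ∀ x, (s.heap x).seq ≠ 0 → (s'.heap x).seq ≠ 0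
  hist : ∀ x h, (s.heap x).hist = some h → (s'.heap x).hist = some h
  lin : ∀ x l, (s.heap x).lin = some l → (s'.heap x).lin = some l
  next : ∀ x, (s.heap x).next ≠ none → (s'.heap x).next ≠ none
  recorder : s.recorder <+: s'.recorder
  invoc : ∀ x, (s.heap x).invoc ≠ none → (s'.heap x).invoc ≠ none

section Extends

variable {Spec : Set (List (Op M A B))} {s s' : UShared n M A B} {C C' : ℕ → NodeRef n}
  {L L' : ℕ}

theorem Extends.refl_of_heap (h : s'.heap = s.heap) (hr : s.recorder <+: s'.recorder) :
    Extends s C L s' C L := by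
  refine ⟨le_rfl, fun _ _ => rfl, ?_, ?_, ?_, ?_, hr, ?_⟩ <;> rw [h] <;> intros <;> assumption

theorem Allocated.extends {x : NodeRef n} (h : Allocated s x) (e : Extends s C L s' C' L') :
    Allocated s' x := fun hx => e.invoc x (h hx)

theorem OnList.extends {x : NodeRef n} (h : OnList s C L x) (e : Extends s C L s' C' L') :
    OnList s' C' L' x := by
  obtain ⟨k, hk, hx, hs⟩ := h
  exact ⟨k, hk.trans e.le, by rw [e.eq k hk, hx], e.seq x hs⟩

theorem NotUpTo.extends {x y : NodeRef n} (h : NotUpTo s C L x y) (e : Extends s C L s' C' L') :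
    NotUpTo s' C' L' x y := by
  obtain ⟨k, hk, hx, hs, hy⟩ := h
  exact ⟨k, hk.trans e.le, by rw [e.eq k hk, hx], e.seq x hs,
    fun j hj => by rw [e.eq j (hj.trans hk)]; exact hy j hj⟩

theorem Decided.extends {x y : NodeRef n} {k : ℕ} (h : Decided s C L x y k)
    (e : Extends s C L s' C' L') : Decided s' C' L' x y k := by
  obtain ⟨hk, hx, hs, hy⟩ := h
  exact ⟨hk.trans_le e.le, by rw [e.eq k hk.le, hx], e.seq x hs, by rw [e.eq (k + 1) hk, hy]⟩

theorem Listed.extends {o : Oid n} {b : B} (h : Listed s C L o b)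
    (e : Extends s C L s' C' L') : Listed s' C' L' o b := by
  obtain ⟨h, l, hl, hb⟩ := h
  exact ⟨h.extends e, l, e.lin _ l hl, hb⟩

/-- The fields `hist` and `lin` are written at most once, so the conditions at the nodes up to `C (k
+ 1)` cannot change. -/
theorem LinFor.extends {k : ℕ} {l : List (Fin n × Op M A B)} (h : LinFor Spec s C k l)
    (hk : k < L) (e : Extends s C L s' C' L') : LinFor Spec s' C' k l := by
  obtain ⟨⟨g, hg, hl⟩, h₃⟩ := h
  rw [← e.eq (k + 1) hk] at hg
  refine ⟨⟨g, e.hist _ g hg, hl⟩, fun j hj o ho => ?_⟩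
  rw [e.eq (j + 1) (by omega)] at ho
  obtain ⟨l', b, h₁, h₂, h₃⟩ := h₃ j hj o ho
  exact ⟨l', b, e.lin _ _ h₁, h₂, h₃⟩

end Extends

theorem UShared.setNode_field {α : Type*} (f : Node n M A B → α) (s : UShared n M A B)
    (x : NodeRef n) {nd : Node n M A B} (h : f nd = f (s.heap x)) (y : NodeRef n) :
    f ((s.setNode x nd).heap y) = f (s.heap y) := by
  simp only [setNode]
  by_cases hy : y = x
  · subst hy; rw [Function.update_self, h]
  · rw [Function.update_of_ne hy]

theorem UShared.setNode_self (s : UShared n M A B) (x : NodeRef n) (nd : Node n M A B) :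
    (s.setNode x nd).heap x = nd := Function.update_self ..

theorem UShared.setNode_of_ne (s : UShared n M A B) {x y : NodeRef n} (nd : Node n M A B)
    (h : y ≠ x) : (s.setNode x nd).heap y = s.heap y := Function.update_of_ne h ..

namespace ListInv

variable {Spec : Set (List (Op M A B))} {s : UShared n M A B} {C : ℕ → NodeRef n} {L : ℕ}

theorem ne_of_not_alloc (H : ListInv Spec s C L) {o : Oid n}
    (ho : (s.heap (some o)).invoc = none) : ∀ k ≤ L, some o ≠ C k := fun k hk e => by
  have := H.alloc k hk
  rw [← e] at this
  exact this nofun ho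

/-- Nodes off the list are as freshly created, with number `0`. -/
theorem onList_of_seq (H : ListInv Spec s C L) {x : NodeRef n} (hx : (s.heap x).seq ≠ 0) :
    OnList s C L x := by
  by_contra h
  refine hx ?_
  rw [H.fresh x fun k hk e => h ⟨k, hk, e, hx⟩]
  rfl

/-- A node without sequence number is not on the list up to a node with a sequence number. -/
theorem notUpTo (H : ListInv Spec s C L) {x y : NodeRef n} (hx : OnList s C L x)
    (hy : (s.heap y).seq = 0) : NotUpTo s C L x y := by
  obtain ⟨k, hk, rfl, hs⟩ := hx
  refine ⟨k, hk, rfl, hs, ?_⟩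
  rintro j hj rfl
  rcases hj.lt_or_eq with hj | rfl
  · exact H.seq_ne j (hj.le.trans hk) (.inr (hj.trans_le hk)) hy
  · exact hs hy

theorem setHead (H : ListInv Spec s C L) (i : Fin n) {x : NodeRef n} (hx : OnList s C L x) :
    ListInv Spec { s with head := Function.update s.head i x } C L :=
  { H with
    lin := fun k hk l hl => (H.lin k hk l hl).extends hk (.refl_of_heap rfl List.prefix_rfl)
    head := fun j => by
      change OnList s C L (Function.update s.head i x j)
      by_cases hj : j = i
      · subst hj; simpa using hx
      · simpa [hj] using H.head j }

theorem setRecorder (H : ListInv Spec s C L) (t : List (Event n M A B)) :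
    ListInv Spec { s with recorder := s.recorder ++ t } C L :=
  { H with
    lin := fun k hk l hl => (H.lin k hk l hl).extends hk
      (.refl_of_heap rfl (List.prefix_append ..))
    hist := fun x h hh => (H.hist x h hh).trans (List.prefix_append ..) }

theorem setIdGen (H : ListInv Spec s C L) (i : Fin n) :
    ListInv Spec { s with idGen := Function.update s.idGen i (s.idGen i + 1) } C L :=
  { H with
    lin := fun k hk l hl => (H.lin k hk l hl).extends hk (.refl_of_heap rfl List.prefix_rfl)
    idGen := fun o ho => H.idGen o (le_trans (by
      by_cases hj : o.1 = i
      · simp [hj]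
      · simp [hj]) ho) }

end ListInv

end UniversalInvariant

section UniversalSteps

variable {n : ℕ} {M A B : Type u}

/-! ## Steps that change a node -/

namespace ListInv

variable {Spec : Set (List (Op M A B))} {s : UShared n M A B} {C : ℕ → NodeRef n} {L : ℕ}

/-- The node is not yet created, so its other fields have their default values and the write changes
only `invoc`. The bound `hid` keeps identities that are not yet issued free of nodes. -/
theorem announceNode (H : ListInv Spec s C L) (i : Fin n) {o : Oid n}
    (ho : (s.heap (some o)).invoc = none) (hid : o.2 < s.idGen o.1) (inv : M × A) :
    ListInv Spec { s.setNode (some o) (.fresh (some inv)) with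
        announce := Function.update s.announce i (some o) } C L ∧
      Extends s C L { s.setNode (some o) (.fresh (some inv)) with
        announce := Function.update s.announce i (some o) } C L := by
  have hfresh := H.fresh (some o) (H.ne_of_not_alloc ho)
  have hseq := UShared.setNode_field Node.seq s (some o) (nd := .fresh (some inv))
    (by rw [hfresh]; rfl)
  have hhist := UShared.setNode_field Node.hist s (some o) (nd := .fresh (some inv))
    (by rw [hfresh]; rfl)
  have hlin := UShared.setNode_field Node.lin s (some o) (nd := .fresh (some inv))
    (by rw [hfresh]; rfl)
  have hnext := UShared.setNode_field Node.next s (some o) (nd := .fresh (some inv))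
    (by rw [hfresh]; rfl)
  have hdec := UShared.setNode_field Node.decideNext s (some o) (nd := .fresh (some inv))
    (by rw [hfresh]; rfl)
  have hinv : ∀ x, (s.heap x).invoc ≠ none →
      ((s.setNode (some o) (.fresh (some inv))).heap x).invoc ≠ none := fun x hx => by
    by_cases h : x = some o
    · subst h; exact absurd ho hx
    · rwa [UShared.setNode_of_ne _ _ h]
  have e : Extends s C L { s.setNode (some o) (.fresh (some inv)) with
        announce := Function.update s.announce i (some o) } C L :=
    ⟨le_rfl, fun _ _ => rfl, fun x h => by rwa [hseq], fun x h hh => by rwa [hhist],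
      fun x l hl => by rwa [hlin], fun x hx => by rwa [hnext], List.prefix_rfl, hinv⟩
  refine ⟨?_, e⟩
  constructor
  · exact H.zero
  · exact H.inj
  · exact fun k hk => (H.alloc k hk).extends e
  · intro x hx
    dsimp only
    by_cases h : x = some o
    · subst h; rw [UShared.setNode_self]; rfl
    · rw [UShared.setNode_of_ne _ _ h]; exact H.fresh x hx
  · simpa only [hdec] using H.decided
  · simpa only [hdec] using H.undecided
  · simpa only [hseq] using H.seq_eq
  · simpa only [hseq] using H.seq_ne
  · simpa only [hnext] using H.next
  · simpa only [hnext, hseq] using H.seq_next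
  · simpa only [hnext, hlin] using H.next_lin
  · intro k hk l hl
    dsimp only at hl
    rw [hlin] at hl
    exact (H.lin k hk l hl).extends hk e
  · intro x h hh
    dsimp only at hh
    rw [hhist] at hh
    exact H.hist x h hh
  · intro j
    by_cases hj : j = i
    · subst hj
      intro _
      dsimp only
      rw [Function.update_self, UShared.setNode_self]
      nofun
    · have := (H.announce j).extends e
      dsimp only
      rwa [Function.update_of_ne hj]
  · exact fun j => (H.head j).extends e
  · intro o' ho'
    have hne : some o' ≠ some o := by
      rintro ⟨⟩
      exact absurd hid (not_lt.2 ho')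
    dsimp only
    rw [UShared.setNode_of_ne _ _ hne]
    exact H.idGen o' ho'

/-- The only step that lengthens the list. Because `y` is not on the list up to `x`, and `x` turns
out to be the last node, nothing is appended twice. -/
theorem decide (H : ListInv Spec s C L) {x y : NodeRef n} (hxy : NotUpTo s C L x y)
    (hx : (s.heap x).decideNext = none) (hy : Allocated s y) :
    ListInv Spec (s.setNode x { s.heap x with decideNext := some y })
        (Function.update C (L + 1) y) (L + 1) ∧
      Extends s C L (s.setNode x { s.heap x with decideNext := some y })
        (Function.update C (L + 1) y) (L + 1) ∧
      Decided (s.setNode x { s.heap x with decideNext := some y })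
        (Function.update C (L + 1) y) (L + 1) x y L := by
  obtain ⟨k, hk, rfl, hs, hy'⟩ := hxy
  -- All nodes before the last one are decided.
  obtain rfl : k = L := by
    rcases hk.lt_or_eq with h | h
    · rw [H.decided k h] at hx; cases hx
    · exact h
  set nd := { s.heap (C k) with decideNext := some y }
  have hseq := UShared.setNode_field Node.seq s (C k) (nd := nd) rfl
  have hhist := UShared.setNode_field Node.hist s (C k) (nd := nd) rfl
  have hlin := UShared.setNode_field Node.lin s (C k) (nd := nd) rfl
  have hnext := UShared.setNode_field Node.next s (C k) (nd := nd) rfl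
  have hinv := UShared.setNode_field Node.invoc s (C k) (nd := nd) rfl
  have hC : ∀ j ≤ k, Function.update C (k + 1) y j = C j := fun j hj =>
    Function.update_of_ne (by omega) ..
  have hC' : Function.update C (k + 1) y (k + 1) = y := Function.update_self ..
  have e : Extends s C k (s.setNode (C k) nd) (Function.update C (k + 1) y) (k + 1) :=
    ⟨by omega, hC, fun x h => by rwa [hseq], fun x h hh => by rwa [hhist],
      fun x l hl => by rwa [hlin], fun x hx => by rwa [hnext], List.prefix_rfl,
      fun x hx => by rwa [hinv]⟩
  -- Being off the list, `y` has no field set, so the conditions on the new last node hold by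
  -- default.
  have hfy : s.heap y = Node.fresh (s.heap y).invoc := H.fresh y hy'
  have hyk : y ≠ C k := hy' k le_rfl
  refine ⟨?_, e, by omega, (hC k le_rfl).symm, by rwa [hseq], hC'.symm⟩
  constructor
  · rw [hC 0 (Nat.zero_le _), H.zero]
  · intro j hj j' hj' hjj
    rcases hj.lt_or_eq with hj | rfl <;> rcases hj'.lt_or_eq with hj' | rfl
    · rw [hC j (by omega), hC j' (by omega)] at hjj
      exact H.inj j (by omega) j' (by omega) hjj
    · rw [hC j (by omega), hC'] at hjj
      exact absurd hjj.symm (hy' j (by omega))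
    · rw [hC j' (by omega), hC'] at hjj
      exact absurd hjj (hy' j' (by omega))
    · rfl
  · intro j hj
    rcases hj.lt_or_eq with hj | rfl
    · rw [hC j (by omega)]; exact (H.alloc j (by omega)).extends e
    · rw [hC']; exact hy.extends e
  · intro x hx
    have hx' : ∀ j ≤ k, x ≠ C j := fun j hj => by rw [← hC j hj]; exact hx j (by omega)
    rw [UShared.setNode_of_ne _ _ (hx' k le_rfl)]
    exact H.fresh x hx'
  · intro j hj
    rw [hC j (by omega)]
    rcases (Nat.lt_succ_iff.1 hj).lt_or_eq with hj | rfl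
    · rw [hC (j + 1) (by omega), UShared.setNode_of_ne _ _ fun h =>
        hj.ne (H.inj j hj.le k le_rfl h)]
      exact H.decided j hj
    · rw [hC', UShared.setNode_self]
  · rw [hC', UShared.setNode_of_ne _ _ hyk, hfy]; rfl
  · intro j hj
    rw [hseq]
    rcases hj.lt_or_eq with hj | rfl
    · rw [hC j (by omega)]; exact H.seq_eq j (by omega)
    · rw [hC', hfy]; exact fun h => absurd rfl h
  · intro j hj hj'
    rcases hj.lt_or_eq with hj | rfl
    · rw [hseq, hC j (by omega)]
      rcases (Nat.lt_succ_iff.1 hj).lt_or_eq with hj | rfl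
      · exact H.seq_ne j hj.le (.inr hj)
      · exact hs
    · omega
  · intro j hj z hz
    rw [hnext] at hz
    rcases hj.lt_or_eq with hj | rfl
    · rw [hC j (by omega)] at hz
      obtain ⟨h, rfl⟩ := H.next j (by omega) z hz
      exact ⟨by omega, (hC _ h).symm⟩
    · rw [hC', hfy] at hz; cases hz
  · intro j hj
    rw [hseq, hnext, hC j (by omega)]
    rcases (Nat.lt_succ_iff.1 hj).lt_or_eq with hj | rfl
    · rw [hC (j + 1) (by omega)]; exact H.seq_next j hj
    · rw [hC', hfy]; exact fun h => absurd rfl h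
  · intro j hj
    rw [hnext, hlin, hC j (by omega)]
    rcases (Nat.lt_succ_iff.1 hj).lt_or_eq with hj | rfl
    · rw [hC (j + 1) (by omega)]; exact H.next_lin j hj
    · intro h
      obtain ⟨z, hz⟩ := Option.ne_none_iff_exists'.1 h
      exact absurd (H.next j le_rfl z hz).1 (lt_irrefl _)
  · intro j hj l hl
    rw [hlin] at hl
    rcases (Nat.lt_succ_iff.1 hj).lt_or_eq with hj | rfl
    · rw [hC (j + 1) (by omega)] at hl
      exact (H.lin j hj l hl).extends hj e
    · rw [hC', hfy] at hl; cases hl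
  · intro x h hh
    rw [hhist] at hh
    exact H.hist x h hh
  · exact fun j => (H.announce j).extends e
  · exact fun j => (H.head j).extends e
  · intro o ho
    rw [hinv]
    exact H.idGen o ho

/-- A change of the fields `hist`, `lin`, `next` and `seq` of a node on the list. -/
theorem setNode (H : ListInv Spec s C L) {j : ℕ} (hj : j ≤ L) {nd : Node n M A B}
    (e : Extends s C L (s.setNode (C j) nd) C L)
    (hinv : nd.invoc = (s.heap (C j)).invoc) (hdec : nd.decideNext = (s.heap (C j)).decideNext)
    (hseq : nd.seq ≠ 0 → nd.seq = j + 1)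
    (hnext : ∀ y, nd.next = some y → j < L ∧ y = C (j + 1))
    (seq_next : ∀ k < L, k + 1 = j → nd.seq ≠ 0 → (s.heap (C k)).next ≠ none)
    (next_lin : j < L → nd.next ≠ none → (s.heap (C (j + 1))).lin ≠ none)
    (lin : ∀ k < L, k + 1 = j → ∀ l, nd.lin = some l → LinFor Spec (s.setNode (C j) nd) C k l)
    (hist : ∀ h, nd.hist = some h → h <+: s.recorder) :
    ListInv Spec (s.setNode (C j) nd) C L := by
  have hdec := UShared.setNode_field Node.decideNext s (C j) hdec
  have hinv := UShared.setNode_field Node.invoc s (C j) hinv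
  have self := s.setNode_self (C j) nd
  have ne : ∀ k ≤ L, k ≠ j → (s.setNode (C j) nd).heap (C k) = s.heap (C k) := fun k hk h =>
    UShared.setNode_of_ne _ _ fun h' => h (H.inj k hk j hj h')
  constructor
  · exact H.zero
  · exact H.inj
  · exact fun k hk => (H.alloc k hk).extends e
  · intro x hx
    rw [UShared.setNode_of_ne _ _ (hx j hj)]
    exact H.fresh x hx
  · simpa only [hdec] using H.decided
  · simpa only [hdec] using H.undecided
  · intro k hk
    by_cases h : k = j
    · subst h; rw [self]; exact hseq
    · rw [ne k hk h]; exact H.seq_eq k hk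
  · exact fun k hk h => e.seq _ (H.seq_ne k hk h)
  · intro k hk
    by_cases h : k = j
    · subst h; rw [self]; exact hnext
    · rw [ne k hk h]; exact H.next k hk
  · intro k hk h₁
    apply e.next
    by_cases h : k + 1 = j
    · rw [h, self] at h₁; exact seq_next k hk h h₁
    · rw [ne (k + 1) hk h] at h₁; exact H.seq_next k hk h₁
  · intro k hk h₁
    have : (s.heap (C (k + 1))).lin ≠ none := by
      by_cases h : k = j
      · subst h; rw [self] at h₁; exact next_lin hk h₁
      · rw [ne k hk.le h] at h₁; exact H.next_lin k hk h₁
    obtain ⟨l, hl⟩ := Option.ne_none_iff_exists'.1 this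
    rw [e.lin _ l hl]
    nofun
  · intro k hk l hl
    by_cases h : k + 1 = j
    · rw [h, self] at hl; exact lin k hk h l hl
    · rw [ne (k + 1) hk h] at hl; exact (H.lin k hk l hl).extends hk e
  · intro x h hh
    by_cases hx : x = C j
    · rw [hx, self] at hh; exact hist h hh
    · rw [UShared.setNode_of_ne _ _ hx] at hh; exact H.hist x h hh
  · exact fun k => (H.announce k).extends e
  · exact fun k => (H.head k).extends e
  · intro o ho
    rw [hinv]
    exact H.idGen o ho

/-- A change of a single node after which the fields are still set as before. -/
theorem extends_setNode {x : NodeRef n} {nd : Node n M A B}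
    (hseq : (s.heap x).seq ≠ 0 → nd.seq ≠ 0)
    (hhist : ∀ h, (s.heap x).hist = some h → nd.hist = some h)
    (hlin : ∀ l, (s.heap x).lin = some l → nd.lin = some l)
    (hnext : (s.heap x).next ≠ none → nd.next ≠ none)
    (hinv : (s.heap x).invoc ≠ none → nd.invoc ≠ none) :
    Extends s C L (s.setNode x nd) C L := by
  have key : ∀ (P : Node n M A B → Node n M A B → Prop), (∀ y, P y y) → P (s.heap x) nd →
      ∀ y, P (s.heap y) ((s.setNode x nd).heap y) := fun P h₁ h₂ y => by
    by_cases h : y = x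
    · subst h; rwa [UShared.setNode_self]
    · rw [UShared.setNode_of_ne _ _ h]; exact h₁ _
  exact ⟨le_rfl, fun _ _ => rfl, key (fun p q => p.seq ≠ 0 → q.seq ≠ 0) (fun _ h => h) hseq,
    key (fun p q => ∀ h, p.hist = some h → q.hist = some h) (fun _ _ h => h) hhist,
    key (fun p q => ∀ l, p.lin = some l → q.lin = some l) (fun _ _ h => h) hlin,
    key (fun p q => p.next ≠ none → q.next ≠ none) (fun _ h => h) hnext, List.prefix_rfl,
    key (fun p q => p.invoc ≠ none → q.invoc ≠ none) (fun _ h => h) hinv⟩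

theorem setHist (H : ListInv Spec s C L) {x y : NodeRef n} {k : ℕ} (hd : Decided s C L x y k)
    (hy : (s.heap y).hist = none) {h : List (Event n M A B)} (hh : h <+: s.recorder) :
    ListInv Spec (s.setNode y { s.heap y with hist := some h }) C L ∧
      Extends s C L (s.setNode y { s.heap y with hist := some h }) C L := by
  obtain ⟨hk, rfl, hs, rfl⟩ := hd
  have e : Extends s C L (s.setNode (C (k + 1)) { s.heap (C (k + 1)) with hist := some h }) C L :=
    extends_setNode id (fun g hg => by rw [hy] at hg; cases hg) (fun _ => id) id id
  refine ⟨H.setNode hk e rfl rfl (H.seq_eq _ hk) (H.next _ hk) ?_ (fun hk => H.next_lin _ hk) ?_ ?_,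
    e⟩
  · rintro k' hk' hkk
    obtain rfl : k' = k := by omega
    exact H.seq_next _ hk
  · rintro k' hk' hkk l hl
    obtain rfl : k' = k := by omega
    exact (H.lin _ hk l hl).extends hk e
  · rintro g ⟨⟩; exact hh

theorem setLin (H : ListInv Spec s C L) {x y : NodeRef n} {k : ℕ} (hd : Decided s C L x y k)
    (hy : (s.heap y).lin = none) {l : List (Fin n × Op M A B)} (hl : LinFor Spec s C k l) :
    ListInv Spec (s.setNode y { s.heap y with lin := some l }) C L ∧
      Extends s C L (s.setNode y { s.heap y with lin := some l }) C L := by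
  obtain ⟨hk, rfl, hs, rfl⟩ := hd
  have e : Extends s C L (s.setNode (C (k + 1)) { s.heap (C (k + 1)) with lin := some l }) C L :=
    extends_setNode id (fun _ => id) (fun g hg => by rw [hy] at hg; cases hg) id id
  refine ⟨H.setNode hk e rfl rfl (H.seq_eq _ hk) (H.next _ hk) ?_ (fun hk => H.next_lin _ hk) ?_
    (H.hist _), e⟩
  · rintro k' hk' hkk
    obtain rfl : k' = k := by omega
    exact H.seq_next _ hk
  · rintro k' hk' hkk _ ⟨⟩
    obtain rfl : k' = k := by omega
    exact hl.extends hk e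

theorem setNext (H : ListInv Spec s C L) {x y : NodeRef n} {k : ℕ} (hd : Decided s C L x y k)
    (hy : (s.heap y).lin ≠ none) :
    ListInv Spec (s.setNode x { s.heap x with next := some y }) C L ∧
      Extends s C L (s.setNode x { s.heap x with next := some y }) C L := by
  obtain ⟨hk, rfl, hs, rfl⟩ := hd
  have e : Extends s C L (s.setNode (C k) { s.heap (C k) with next := some (C (k + 1)) }) C L :=
    extends_setNode id (fun _ => id) (fun _ => id) (fun _ => nofun) id
  refine ⟨H.setNode hk.le e rfl rfl (H.seq_eq _ hk.le) ?_ ?_ (fun _ _ => hy) ?_ (H.hist _), e⟩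
  · rintro _ ⟨⟩; exact ⟨hk, rfl⟩
  · rintro k' hk' rfl; exact H.seq_next _ hk'
  · rintro k' hk' rfl l hl; exact (H.lin _ hk' l hl).extends hk' e

/-- Several helpers may perform this write, but the numbered node `C k` has number `k + 1`, so all
of them write `k + 2`. -/
theorem setSeq (H : ListInv Spec s C L) {x y : NodeRef n} {k : ℕ} (hd : Decided s C L x y k)
    (hx : (s.heap x).next ≠ none) :
    ListInv Spec (s.setNode y { s.heap y with seq := (s.heap x).seq + 1 }) C L ∧
      Extends s C L (s.setNode y { s.heap y with seq := (s.heap x).seq + 1 }) C L := by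
  obtain ⟨hk, rfl, hs, rfl⟩ := hd
  have e : Extends s C L
      (s.setNode (C (k + 1)) { s.heap (C (k + 1)) with seq := (s.heap (C k)).seq + 1 }) C L :=
    extends_setNode (fun _ => Nat.succ_ne_zero _) (fun _ => id) (fun _ => id) id id
  refine ⟨H.setNode hk e rfl rfl (fun _ => ?_) (H.next _ hk) ?_ (fun hk => H.next_lin _ hk) ?_
    (H.hist _), e⟩
  · exact congrArg (· + 1) (H.seq_eq k hk.le hs)
  · rintro k' hk' hkk _
    obtain rfl : k' = k := by omega
    exact hx
  · rintro k' hk' hkk l hl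
    obtain rfl : k' = k := by omega
    exact (H.lin _ hk l hl).extends hk e

end ListInv

end UniversalSteps

section UniversalLocal

variable {n : ℕ} {M A B : Type u}

/-! ## The invariant of the local states -/

/-- The invariant of the local state of process `i`. -/
def LocInv (Spec : Set (List (Op M A B))) (s : UShared n M A B) (C : ℕ → NodeRef n) (L : ℕ)
    (i : Fin n) : ULoc n M A B → Prop
  | .line2 _ _ => True
  | .line3 _ _ o => o.1 = i ∧ o.2 < s.idGen i ∧ (s.heap (some o)).invoc = none
  | .line4 _ _ o => o.1 = i ∧ o.2 < s.idGen i ∧ (s.heap (some o)).invoc = none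
  | .line5 _ o _ best => s.announce i = some o ∧ OnList s C L best
  | .line6 _ o => s.announce i = some o
  | .line7 _ o => s.announce i = some o ∧ NotUpTo s C L (s.head i) (s.announce i)
  | .line8 _ o bef => s.announce i = some o ∧ NotUpTo s C L bef (s.announce i)
  | .line9 _ o bef help =>
      s.announce i = some o ∧ NotUpTo s C L bef (s.announce i) ∧ Allocated s help
  -- If the consensus at `bef` is still open, `bef` is the last node, and then `prefer` is not on
  -- the list at all.
  | .line13 _ o bef prefer => s.announce i = some o ∧ NotUpTo s C L bef prefer ∧ Allocated s prefer
  | .line14 _ o bef aft => s.announce i = some o ∧ ∃ k, Decided s C L bef aft k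
  | .line15 _ o bef aft h =>
      s.announce i = some o ∧ (∃ k, Decided s C L bef aft k) ∧ h <+: s.recorder
  | .line16 _ o bef aft =>
      s.announce i = some o ∧ (∃ k, Decided s C L bef aft k) ∧ (s.heap aft).hist ≠ none
  | .line17 _ o bef aft l =>
      s.announce i = some o ∧ ∃ k, Decided s C L bef aft k ∧ LinFor Spec s C k l
  | .line18 _ o bef aft =>
      s.announce i = some o ∧ (∃ k, Decided s C L bef aft k) ∧ (s.heap aft).lin ≠ none
  | .line19 _ o bef aft =>
      s.announce i = some o ∧ (∃ k, Decided s C L bef aft k) ∧ (s.heap bef).next ≠ none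
  | .line20 _ o aft => s.announce i = some o ∧ OnList s C L aft
  | .line21 _ o => s.announce i = some o ∧ (s.heap (some o)).seq ≠ 0
  | .line22 _ o => s.announce i = some o ∧ (s.heap (some o)).seq ≠ 0
  | .line23 _ _ => True
  | .line24 _ => True

/-- The parts of the shared memory that belong to process `j` are the same. -/
structure SameFor (j : Fin n) (s s' : UShared n M A B) : Prop where
  idGen : s'.idGen j = s.idGen j
  announce : s'.announce j = s.announce j
  head : s'.head j = s.head j
  recorder : subhistory s'.recorder j = subhistory s.recorder j
  invoc : ∀ o : Oid n, o.1 = j → (s.heap (some o)).invoc = none → (s'.heap (some o)).invoc = none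

variable {Spec : Set (List (Op M A B))} {s s' : UShared n M A B} {C C' : ℕ → NodeRef n}
  {L L' : ℕ} {i : Fin n}

theorem Extends.hist_ne (e : Extends s C L s' C' L') {x : NodeRef n}
    (h : (s.heap x).hist ≠ none) : (s'.heap x).hist ≠ none := by
  obtain ⟨g, hg⟩ := Option.ne_none_iff_exists'.1 h
  rw [e.hist x g hg]
  nofun

theorem Extends.lin_ne (e : Extends s C L s' C' L') {x : NodeRef n}
    (h : (s.heap x).lin ≠ none) : (s'.heap x).lin ≠ none := by
  obtain ⟨g, hg⟩ := Option.ne_none_iff_exists'.1 h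
  rw [e.lin x g hg]
  nofun

/-- Stability under steps of other processes: each clause either persists along `Extends` or
concerns memory that belongs to process `i`. -/
theorem LocInv.extends {l : ULoc n M A B} (h : LocInv Spec s C L i l)
    (e : Extends s C L s' C' L') (f : SameFor i s s') : LocInv Spec s' C' L' i l := by
  cases l <;> simp only [LocInv, f.idGen, f.announce, f.head] at h ⊢
  case line3 | line4 => exact ⟨h.1, h.2.1, f.invoc _ h.1 h.2.2⟩
  case line5 | line20 => exact ⟨h.1, h.2.extends e⟩
  case line6 => exact h
  case line7 | line8 => exact ⟨h.1, h.2.extends e⟩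
  case line9 | line13 => exact ⟨h.1, h.2.1.extends e, h.2.2.extends e⟩
  case line14 => exact ⟨h.1, h.2.imp fun _ h => h.extends e⟩
  case line15 => exact ⟨h.1, h.2.1.imp fun _ h => h.extends e, h.2.2.trans e.recorder⟩
  case line16 => exact ⟨h.1, h.2.1.imp fun _ h => h.extends e, e.hist_ne h.2.2⟩
  case line17 => exact ⟨h.1, h.2.imp fun _ h => ⟨h.1.extends e, h.2.extends h.1.1 e⟩⟩
  case line18 => exact ⟨h.1, h.2.1.imp fun _ h => h.extends e, e.lin_ne h.2.2⟩
  case line19 => exact ⟨h.1, h.2.1.imp fun _ h => h.extends e, e.next _ h.2.2⟩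
  case line21 | line22 => exact ⟨h.1, e.seq _ h.2⟩

theorem UStep.sameFor {l l' : ULoc n M A B} (h : UStep Spec i l s l' s')
    (hl : LocInv Spec s C L i l) {j : Fin n} (hj : j ≠ i) : SameFor j s s' := by
  have node {x : NodeRef n} {nd : Node n M A B} (h : nd.invoc = (s.heap x).invoc) :
      SameFor j s (s.setNode x nd) :=
    ⟨rfl, rfl, rfl, rfl, fun o _ ho => by
      rw [UShared.setNode_field Node.invoc s x h]; exact ho⟩
  have recorder_eq (e : Event n M A B) (he : e.pid = i) :
      subhistory (s.recorder ++ [e]) j = subhistory s.recorder j := by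
    rw [subhistory_append, subhistory_singleton_of_ne (by rw [he]; exact hj.symm), List.append_nil]
  cases h with
  | line2 => exact ⟨Function.update_of_ne hj .., rfl, rfl, rfl, fun _ _ h => h⟩
  | line3 => exact ⟨rfl, rfl, rfl, recorder_eq _ rfl, fun _ _ h => h⟩
  | line23 => exact ⟨rfl, rfl, rfl, recorder_eq _ rfl, fun _ _ h => h⟩
  | line4 m a o =>
    refine ⟨rfl, Function.update_of_ne hj .., rfl, rfl, fun o' h₁ h₂ => ?_⟩
    -- The created node carries the identity of process `i`, so it is not a node of process `j`.
    have : some o' ≠ some o := by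
      rintro ⟨⟩; exact hj (h₁.symm.trans hl.1)
    dsimp only
    rwa [UShared.setNode_of_ne _ _ this]
  | line5_write => exact ⟨rfl, rfl, Function.update_of_ne hj .., rfl, fun _ _ h => h⟩
  | line20 => exact ⟨rfl, rfl, Function.update_of_ne hj .., rfl, fun _ _ h => h⟩
  | line21 => exact ⟨rfl, rfl, Function.update_of_ne hj .., rfl, fun _ _ h => h⟩
  | line13_win => exact node rfl
  | line15_success => exact node rfl
  | line17_success => exact node rfl
  | line18 => exact node rfl
  | line19 => exact node rfl
  | _ => exact ⟨rfl, rfl, rfl, rfl, fun _ _ h => h⟩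

/-- A node is numbered only after it has been linked, so all links up to a numbered node are in
place. -/
theorem ListInv.reach (H : ListInv Spec s C L) {j k : ℕ} (hjk : j ≤ k) (hk : k ≤ L)
    (hs : (s.heap (C k)).seq ≠ 0) : s.Reach (C j) (C k) := by
  obtain ⟨d, rfl⟩ := Nat.exists_eq_add_of_le hjk
  refine UShared.reach_of_next (C := fun t => C (j + t)) fun t ht => ?_
  have hs' : (s.heap (C (j + t + 1))).seq ≠ 0 := by
    by_cases h : t + 1 = d
    · subst h; exact hs
    · exact H.seq_ne _ (by omega) (.inr (by omega))
  obtain ⟨y, hy⟩ := Option.ne_none_iff_exists'.1 (H.seq_next (j + t) (by omega) hs')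
  rw [hy, (H.next (j + t) (by omega) y hy).2]
  rfl

/-- `genLin` inspects the nodes that are reachable in memory. By `ListInv.reach` these include all
decided nodes from `tail` to the numbered node `C k`. -/
theorem ListInv.linFor (H : ListInv Spec s C L) {x y : NodeRef n} {k : ℕ}
    (hd : Decided s C L x y k) {l : List (Fin n × Op M A B)} (hl : s.GenLin Spec x y l) :
    LinFor Spec s C k l := by
  obtain ⟨hk, rfl, hs, rfl⟩ := hd
  refine ⟨hl.1, fun j hj o ho => hl.2.2 o ?_ ?_⟩
  · have := H.reach (Nat.zero_le (j + 1)) (by omega) (H.seq_ne _ (by omega) (.inr (by omega)))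
    rwa [H.zero, ho] at this
  · rw [← ho]
    exact H.reach hj hk.le hs

theorem UStep.listInv {l l' : ULoc n M A B} (h : UStep Spec i l s l' s')
    (H : ListInv Spec s C L) (hl : LocInv Spec s C L i l) :
    ∃ C' L', ListInv Spec s' C' L' ∧ Extends s C L s' C' L' ∧ LocInv Spec s' C' L' i l' := by
  have stay {l' : ULoc n M A B} (h : LocInv Spec s C L i l') :
      ∃ C' L', ListInv Spec s C' L' ∧ Extends s C L s C' L' ∧ LocInv Spec s C' L' i l' :=
    ⟨C, L, H, .refl_of_heap rfl List.prefix_rfl, h⟩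
  cases h with
  | line2 m a =>
    exact ⟨C, L, H.setIdGen i, .refl_of_heap rfl List.prefix_rfl, rfl, by simp,
      H.idGen (i, s.idGen i) le_rfl⟩
  | line3 m a o => exact ⟨C, L, H.setRecorder _, .refl_of_heap rfl (List.prefix_append ..), hl⟩
  | line4 m a o =>
    obtain ⟨h₁, h₂, h₃⟩ := hl
    obtain ⟨H', e⟩ := H.announceNode i h₃ (by rwa [h₁]) (m, a)
    refine ⟨C, L, H', e, Function.update_self .., ?_⟩
    refine ⟨0, Nat.zero_le _, H.zero.symm, e.seq _ ?_⟩
    rw [← H.zero]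
    exact H.seq_ne 0 (Nat.zero_le _) (.inl rfl)
  | line5_scan m o j best _ hj =>
    refine stay ⟨hl.1, ?_⟩
    split
    · exact H.head _
    · exact hl.2
  | line5_write m o j best _ hj =>
    exact ⟨C, L, H.setHead i hl.2, .refl_of_heap rfl List.prefix_rfl, hl.1⟩
  | line6_enter m o _ h => exact stay ⟨hl, H.notUpTo (H.head i) h⟩
  | line6_exit m o _ h =>
    have hl : s.announce i = some o := hl
    exact stay ⟨hl, by rwa [hl] at h⟩
  | line7 => exact stay hl
  | line8 => exact stay ⟨hl.1, hl.2, H.announce _⟩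
  -- After this test `help` may still be put on the list by others, but only behind `bef`; hence the
  -- recorded fact concerns the list up to `bef` only.
  | line9_help m o bef help _ h =>
    obtain ⟨k, hk, hx, hs, _⟩ := hl.2.1
    exact stay ⟨hl.1, H.notUpTo ⟨k, hk, hx, hs⟩ h, hl.2.2⟩
  | line9_own => exact stay ⟨hl.1, hl.2.1, H.announce i⟩
  | line13_win m o bef prefer _ h =>
    obtain ⟨H', e, hd⟩ := H.decide hl.2.1 h hl.2.2
    exact ⟨_, _, H', e, hl.1, _, hd⟩
  | line13_lose m o bef prefer aft _ h =>
    obtain ⟨k, hk, rfl, hs, _⟩ := hl.2.1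
    rcases hk.lt_or_eq with hk | rfl
    · rw [H.decided k hk] at h
      cases h
      exact stay ⟨hl.1, k, hk, rfl, hs, rfl⟩
    -- A decision was read at `bef`, so `bef` cannot be the last node.
    · rw [H.undecided] at h
      cases h
  | line14 => exact stay ⟨hl.1, hl.2, List.prefix_rfl⟩
  | line15_success m o bef aft g _ h =>
    obtain ⟨h₁, ⟨k, hd⟩, h₂⟩ := hl
    obtain ⟨H', e⟩ := H.setHist hd h h₂
    refine ⟨C, L, H', e, h₁, ⟨k, hd.extends e⟩, ?_⟩
    rw [UShared.setNode_self]
    nofun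
  | line15_fail m o bef aft g _ h => exact stay ⟨hl.1, hl.2.1, h⟩
  | line16 m o bef aft l _ h =>
    obtain ⟨h₁, ⟨k, hd⟩, _⟩ := hl
    exact stay ⟨h₁, k, hd, H.linFor hd h⟩
  | line17_success m o bef aft l _ h =>
    obtain ⟨h₁, k, hd, h₂⟩ := hl
    obtain ⟨H', e⟩ := H.setLin hd h h₂
    refine ⟨C, L, H', e, h₁, ⟨k, hd.extends e⟩, ?_⟩
    rw [UShared.setNode_self]
    nofun
  | line17_fail m o bef aft l _ h =>
    obtain ⟨h₁, k, hd, _⟩ := hl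
    exact stay ⟨h₁, ⟨k, hd⟩, h⟩
  | line18 m o bef aft =>
    obtain ⟨h₁, ⟨k, hd⟩, h₂⟩ := hl
    obtain ⟨H', e⟩ := H.setNext hd h₂
    refine ⟨C, L, H', e, h₁, ⟨k, hd.extends e⟩, ?_⟩
    rw [UShared.setNode_self]
    nofun
  | line19 m o bef aft =>
    obtain ⟨h₁, ⟨k, hd⟩, h₂⟩ := hl
    obtain ⟨H', e⟩ := H.setSeq hd h₂
    refine ⟨C, L, H', e, h₁, k + 1, hd.1, hd.2.2.2, ?_⟩
    rw [UShared.setNode_self]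
    exact Nat.succ_ne_zero _
  | line20 m o aft =>
    exact ⟨C, L, H.setHead i hl.2, .refl_of_heap rfl List.prefix_rfl, hl.1⟩
  | line21 m o =>
    refine ⟨C, L, H.setHead i ?_, .refl_of_heap rfl List.prefix_rfl, hl.1, hl.2⟩
    rw [hl.1]
    exact H.onList_of_seq hl.2
  | line22 => exact stay trivial
  | line23 => exact ⟨C, L, H.setRecorder _, .refl_of_heap rfl (List.prefix_append ..), trivial⟩

end UniversalLocal

/-! ### From the recorded history to linearizability of the universal object. -/

section UniversalLinearizable

variable {n : ℕ} {M A B : Type u}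

/-! ## The recorded history -/

/-- The invocation of `m` by process `i` has been recorded as operation `o`, after the completed
operations `ops`; the history of the process is `y`. -/
def Active (s : UShared n M A B) (i : Fin n) (y : List (Event n M A B))
    (ops : List (Fin n × Op M A B)) (m m' : M) (o : Oid n) : Prop :=
  m' = m ∧ o = (i, ops.length) ∧ s.idGen i = ops.length + 1 ∧
    ∃ a, subhistory s.recorder i = procHistory i ops (some (m, a)) ∧
      y = procHistory i ops (some (m, a))

/-- The relation between the recorded completed operations `ops` of process `i`, its history `y`,
and its control state. -/
def Phase (s : UShared n M A B) (C : ℕ → NodeRef n) (L : ℕ) (i : Fin n)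
    (y : List (Event n M A B)) (ops : List (Fin n × Op M A B)) :
    Option (M × ULoc n M A B) → Prop
  | none => s.idGen i = ops.length ∧ subhistory s.recorder i = procHistory i ops none ∧
      y = procHistory i ops none
  | some (m, .line2 m' a) => m' = m ∧ s.idGen i = ops.length ∧
      subhistory s.recorder i = procHistory i ops none ∧ y = procHistory i ops (some (m, a))
  | some (m, .line3 m' a o) => m' = m ∧ o = (i, ops.length) ∧ s.idGen i = ops.length + 1 ∧
      subhistory s.recorder i = procHistory i ops none ∧ y = procHistory i ops (some (m, a))
  | some (m, .line23 m' b) =>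
      Active s i y ops m m' (i, ops.length) ∧ Listed s C L (i, ops.length) b
  -- The return is recorded but not yet executed: the last operation of `ops` is still pending in
  -- `y`.
  | some (m, .line24 b) => ∃ ops₀ a, ops = ops₀ ++ [(i, ⟨m, a, b⟩)] ∧
      s.idGen i = ops.length ∧ subhistory s.recorder i = procHistory i ops none ∧
      y = procHistory i ops₀ (some (m, a))
  | some (m, .line4 m' _ o) | some (m, .line5 m' o _ _) | some (m, .line6 m' o)
  | some (m, .line7 m' o) | some (m, .line8 m' o _) | some (m, .line9 m' o _ _)
  | some (m, .line13 m' o _ _) | some (m, .line14 m' o _ _) | some (m, .line15 m' o _ _ _)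
  | some (m, .line16 m' o _ _) | some (m, .line17 m' o _ _ _) | some (m, .line18 m' o _ _)
  | some (m, .line19 m' o _ _) | some (m, .line20 m' o _) | some (m, .line21 m' o)
  | some (m, .line22 m' o) => Active s i y ops m m' o

/-- The invariant of the history of process `i`. -/
def ProcInv (s : UShared n M A B) (C : ℕ → NodeRef n) (L : ℕ) (i : Fin n)
    (y : List (Event n M A B)) (x : Option (M × ULoc n M A B)) : Prop :=
  ∃ ops, (∀ z ∈ ops, z.1 = i) ∧
    (∀ (q : ℕ) (b : B), (ops[q]?).map (fun z => z.2.val) = some b → Listed s C L (i, q) b) ∧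
    Phase s C L i y ops x

variable {Spec : Set (List (Op M A B))} {s s' : UShared n M A B} {C C' : ℕ → NodeRef n}
  {L L' : ℕ} {i : Fin n} {y : List (Event n M A B)}

theorem Active.delayed {ops : List (Fin n × Op M A B)} {m m' : M} {o : Oid n}
    (h : Active s i y ops m m' o) (hops : ∀ z ∈ ops, z.1 = i) :
    Delayed i y (subhistory s.recorder i) := by
  obtain ⟨-, -, -, a, h₁, h₂⟩ := h
  exact ⟨ops, hops, .inl ⟨_, h₂, h₁⟩⟩

theorem ProcInv.delayed {x : Option (M × ULoc n M A B)} (h : ProcInv s C L i y x) :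
    Delayed i y (subhistory s.recorder i) := by
  obtain ⟨ops, hops, -, h⟩ := h
  rcases x with _ | ⟨m, l⟩
  · exact ⟨ops, hops, .inl ⟨_, h.2.2, h.2.1⟩⟩
  · cases l
    case line2 => exact ⟨ops, hops, .inr (.inl ⟨_, _, h.2.2.2, h.2.2.1⟩)⟩
    case line3 => exact ⟨ops, hops, .inr (.inl ⟨_, _, h.2.2.2.2, h.2.2.2.1⟩)⟩
    case line23 => exact h.1.delayed hops
    case line24 =>
      obtain ⟨ops₀, a, rfl, _, h₁, h₂⟩ := h
      exact ⟨ops₀, fun z hz => hops z (by simp [hz]), .inr (.inr ⟨_, _, _, h₂, h₁⟩)⟩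
    all_goals exact Active.delayed h hops

/-- Calls are recorded after they happen and returns before they happen. The two resulting
inequalities are what preserves `OrderInv`. -/
theorem Delayed.numCalls_le {y z : List (Event n M A B)} (h : Delayed i y z) :
    numCalls z i ≤ numCalls y i := by
  obtain ⟨ops, hops, ⟨p, rfl, rfl⟩ | ⟨m, a, rfl, rfl⟩ | ⟨m, a, b, rfl, rfl⟩⟩ := h
  · exact le_rfl
  · rw [numCalls_procHistory _ hops, numCalls_procHistory _ hops]
    simp [pendingCall]
  · rw [numCalls_procHistory _ hops, numCalls_procHistory]
    · simp [pendingCall]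
    · intro z hz
      rcases List.mem_append.1 hz with hz | hz
      · exact hops z hz
      · rw [List.mem_singleton.1 hz]

theorem Delayed.numRets_le {y z : List (Event n M A B)} (h : Delayed i y z) :
    numRets y i ≤ numRets z i := by
  obtain ⟨ops, hops, ⟨p, rfl, rfl⟩ | ⟨m, a, rfl, rfl⟩ | ⟨m, a, b, rfl, rfl⟩⟩ := h
  · exact le_rfl
  · rw [numRets_procHistory _ hops, numRets_procHistory _ hops]
  · rw [numRets_procHistory _ hops, numRets_procHistory]
    · simp
    · intro z hz
      rcases List.mem_append.1 hz with hz | hz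
      · exact hops z hz
      · rw [List.mem_singleton.1 hz]

theorem ProcInv.extends {x : Option (M × ULoc n M A B)} (h : ProcInv s C L i y x)
    (e : Extends s C L s' C' L') (f : SameFor i s s') : ProcInv s' C' L' i y x := by
  obtain ⟨ops, hops, hl, h⟩ := h
  refine ⟨ops, hops, fun q b hq => (hl q b hq).extends e, ?_⟩
  rcases x with _ | ⟨m, l⟩
  · simpa only [Phase, f.idGen, f.recorder] using h
  · cases l <;> simp only [Phase, Active, f.idGen, f.recorder] at h ⊢
    case line23 => exact ⟨h.1, h.2.extends e⟩
    all_goals exact h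

theorem UStep.procInv {l l' : ULoc n M A B} {m : M} (h : UStep Spec i l s l' s')
    (hl : LocInv Spec s C L i l) (H : ListInv Spec s C L) (e : Extends s C L s' C' L')
    (hp : ProcInv s C L i y (some (m, l))) : ProcInv s' C' L' i y (some (m, l')) := by
  obtain ⟨ops, hops, hlist, hp⟩ := hp
  have hlist' : ∀ (q : ℕ) (b : B), (ops[q]?).map (fun z => z.2.val) = some b →
      Listed s' C' L' (i, q) b := fun q b hq => (hlist q b hq).extends e
  cases h
  case line2 m' a =>
    obtain ⟨rfl, h₁, h₂, h₃⟩ := hp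
    exact ⟨ops, hops, hlist', rfl, by rw [h₁], by simp [h₁], h₂, h₃⟩
  case line3 m' a o =>
    obtain ⟨rfl, rfl, h₁, h₂, h₃⟩ := hp
    refine ⟨ops, hops, hlist', rfl, rfl, h₁, a, ?_, h₃⟩
    rw [subhistory_append, h₂, ← procHistory_none_call]
    congr 1
    exact subhistory_singleton_self (.call i m' a)
  case line22 m' o l b hb _ hlin =>
    obtain ⟨rfl, rfl, h₄⟩ := hp
    exact ⟨ops, hops, hlist', ⟨rfl, rfl, h₄⟩, (H.onList_of_seq hl.2).extends e, l,
      e.lin _ l hlin, hb⟩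
  case line23 m' b =>
    obtain ⟨⟨rfl, -, h₁, a, h₂, h₃⟩, h₄⟩ := hp
    refine ⟨ops ++ [(i, ⟨m', a, b⟩)], fun z hz => ?_, fun q b' hq => ?_, ops, a, rfl, ?_, ?_, h₃⟩
    · rcases List.mem_append.1 hz with hz | hz
      · exact hops z hz
      · rw [List.mem_singleton.1 hz]
    -- Only index `ops.length` is new; its value was read from the list before the return was
    -- recorded.
    · rcases lt_trichotomy q ops.length with h | rfl | h
      · rw [List.getElem?_append_left h] at hq
        exact hlist' q b' hq
      · simp only [List.getElem?_concat_length, Option.map_some, Option.some.injEq] at hq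
        subst hq
        exact h₄.extends e
      · rw [List.getElem?_eq_none (by simp; omega)] at hq
        cases hq
    · simpa using h₁
    · rw [subhistory_append, h₂, ← procHistory_some_ret]
      congr 1
      exact subhistory_singleton_self (.ret i m' b)
  all_goals exact ⟨ops, hops, hlist', hp⟩

/-- The happen-before order of the history `h` is respected by the recorded history `r`. -/
def OrderInv (h r : List (Event n M A B)) : Prop :=
  ∀ o₁ o₂, HappensBefore h o₁ o₂ → o₂.2 < numCalls r o₂.1 → HappensBefore r o₁ o₂

/-- Only recording a call can create new obligations. By `hle`, every return that has happened is
already recorded, so the new call is recorded after all of them. -/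
theorem UStep.orderInv {l l' : ULoc n M A B} {h : List (Event n M A B)}
    (hs : UStep Spec i l s l' s') (hle : ∀ j, numRets h j ≤ numRets s.recorder j)
    (ho : OrderInv h s.recorder) : OrderInv h s'.recorder := by
  cases hs
  case line3 m a o =>
    intro o₁ o₂ h₁ h₂
    by_cases h₃ : o₂.2 < numCalls s.recorder o₂.1
    · exact (ho o₁ o₂ h₁ h₃).append _
    · dsimp only at h₂ ⊢
      rw [numCalls_append] at h₂
      have hi : o₂.1 = i := by
        by_contra hne
        simp [numCalls, Ne.symm hne] at h₂ h₃
        omega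
      have h₄ : o₂ = (i, numCalls s.recorder i) := by
        obtain ⟨j, q⟩ := o₂
        subst hi
        simp [numCalls] at h₂ h₃ ⊢
        omega
      rw [h₄]
      exact HappensBefore.append_call m a (h₁.lt_numRets.trans_le (hle _))
  case line23 m b =>
    intro o₁ o₂ h₁ h₂
    refine (ho o₁ o₂ h₁ ?_).append _
    simpa [numCalls] using h₂
  all_goals exact ho

/-! ## The universal object is linearizable -/

/-- The invariant of the universal object, for the history `h`. -/
structure UInv (Spec : Set (List (Op M A B))) (h : List (Event n M A B))
    (c : Config (universalObject n Spec)) (C : ℕ → NodeRef n) (L : ℕ) : Prop where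
  list : ListInv Spec c.shared C L
  loc : ∀ i m l, c.ctrl i = some (m, l) → LocInv Spec c.shared C L i l
  proc : ∀ i, ProcInv c.shared C L i (subhistory h i) (c.ctrl i)
  order : OrderInv h (UShared.recorder c.shared)

theorem UInv.initial (Spec : Set (List (Op M A B))) :
    UInv Spec [] (sem (universalObject n Spec)).initial (fun _ => none) 0 where
  list :=
    { zero := rfl
      inj := fun j hj k hk _ => by omega
      alloc := fun _ _ h => absurd rfl h
      fresh := fun x hx => by
        rcases x with _ | o
        · exact absurd rfl (hx 0 le_rfl)
        · rfl
      decided := nofun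
      undecided := rfl
      seq_eq := fun k hk _ => by obtain rfl := Nat.le_zero.1 hk; rfl
      seq_ne := fun k _ _ => Nat.one_ne_zero
      next := fun k _ y hy => by cases hy
      seq_next := nofun
      next_lin := nofun
      lin := nofun
      hist := fun x h hh => by rcases x with _ | o <;> cases hh
      announce := fun _ h => absurd rfl h
      head := fun _ => ⟨0, le_rfl, rfl, Nat.one_ne_zero⟩
      idGen := fun _ _ => rfl }
  loc _ _ _ h := by cases h
  proc i := ⟨[], by simp, by simp, rfl, rfl, rfl⟩
  order o₁ o₂ h _ := absurd h.lt_numRets (by simp [numRets])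

theorem UInv.step {h : List (Event n M A B)} {c c' : Config (universalObject n Spec)}
    {α : Label n M A B} (H : UInv Spec h c C L) (ht : Trans (universalObject n Spec) c α c') :
    ∃ C' L', UInv Spec (h ++ history [α]) c' C' L' := by
  obtain ⟨s, f⟩ := c
  have hlist : ListInv Spec s C L := H.list
  have hproc : ∀ i, ProcInv s C L i (subhistory h i) (f i) := H.proc
  cases ht with
  | call i m a hc =>
    refine ⟨C, L, hlist, fun j m' l hj => ?_, fun j => ?_, fun o₁ o₂ h₁ h₂ => ?_⟩
    · by_cases hji : j = i
      · subst hji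
        cases (Function.update_self ..).symm.trans hj
        trivial
      · exact H.loc j m' l ((Function.update_of_ne hji ..).symm.trans hj)
    · change ProcInv s C L j (subhistory (h ++ [.call i m a]) j) (Function.update f i _ j)
      rw [subhistory_append]
      by_cases hji : j = i
      · subst hji
        have := hproc j
        rw [show f j = none from hc] at this
        obtain ⟨ops, hops, hl, h₁, h₂, h₃⟩ := this
        rw [Function.update_self]
        refine ⟨ops, hops, hl, rfl, h₁, h₂, ?_⟩
        rw [h₃, ← procHistory_none_call]
        congr 1
        exact subhistory_singleton_self (.call j m a)
      · rw [Function.update_of_ne hji, subhistory_singleton_of_ne (by exact Ne.symm hji),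
          List.append_nil]
        exact hproc j
    -- An operation whose call is recorded was called earlier, so `o₂` is not the operation that is
    -- called now.
    · refine H.order o₁ o₂ (h₁.of_append (lt_of_lt_of_le h₂ ?_)) h₂
      have := (hproc o₂.1).delayed.numCalls_le
      rwa [numCalls_subhistory, numCalls_subhistory] at this
  | ret i m l b hc hr =>
    cases l <;> cases hr
    refine ⟨C, L, hlist, fun j m' l hj => ?_, fun j => ?_, fun o₁ o₂ h₁ h₂ => ?_⟩
    · by_cases hji : j = i
      · subst hji
        cases (Function.update_self ..).symm.trans hj
      · exact H.loc j m' l ((Function.update_of_ne hji ..).symm.trans hj)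
    · change ProcInv s C L j (subhistory (h ++ [.ret i m b]) j) (Function.update f i _ j)
      rw [subhistory_append]
      by_cases hji : j = i
      · subst hji
        have := hproc j
        rw [show f j = _ from hc] at this
        obtain ⟨ops, hops, hl, ops₀, a, rfl, h₁, h₂, h₃⟩ := this
        rw [Function.update_self]
        refine ⟨_, hops, hl, h₁, h₂, ?_⟩
        rw [h₃, ← procHistory_some_ret]
        congr 1
        exact subhistory_singleton_self (.ret j m b)
      · rw [Function.update_of_ne hji, subhistory_singleton_of_ne (by exact Ne.symm hji),
          List.append_nil]
        exact hproc j
    · exact H.order o₁ o₂ h₁.of_append_ret h₂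
  | internal i m l l' s' hc hst =>
    have hst : UStep Spec i l s l' s' := hst
    have hl : LocInv Spec s C L i l := H.loc i m l hc
    obtain ⟨C', L', H', e, hl'⟩ := hst.listInv hlist hl
    have hnil : h ++ history [.internal i] = h := List.append_nil h
    rw [hnil]
    refine ⟨C', L', H', fun j m' l₁ hj => ?_, fun j => ?_, ?_⟩
    · by_cases hji : j = i
      · subst hji
        cases (Function.update_self ..).symm.trans hj
        exact hl'
      · exact (H.loc j m' l₁ ((Function.update_of_ne hji ..).symm.trans hj)).extends e
          (hst.sameFor hl hji)
    · change ProcInv s' C' L' j (subhistory h j) (Function.update f i _ j)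
      by_cases hji : j = i
      · subst hji
        have := hproc j
        rw [show f j = _ from hc] at this
        rw [Function.update_self]
        exact hst.procInv hl hlist e this
      · rw [Function.update_of_ne hji]
        exact (hproc j).extends e (hst.sameFor hl hji)
    · refine hst.orderInv (fun j => ?_) H.order
      have := (hproc j).delayed.numRets_le
      rwa [numRets_subhistory, numRets_subhistory] at this

theorem UInv.path {c c' : (sem (universalObject n Spec)).State} {ls : List (Label n M A B)}
    (hp : (sem (universalObject n Spec)).Path c ls c') {h : List (Event n M A B)}
    (H : ∃ C L, UInv Spec h c C L) : ∃ C L, UInv Spec (h ++ history ls) c' C L := by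
  induction hp generalizing h with
  | nil => simpa [history] using H
  | @cons q q' q'' l ls ht hp ih =>
    obtain ⟨C, L, H⟩ := H
    have := ih (H.step ht)
    rwa [List.append_assoc, ← history_append, List.singleton_append] at this

/-- The recorded history has a linearization that agrees with the returned values. -/
theorem ListInv.exists_linearization (H : ListInv Spec s C L) (hnil : [] ∈ Spec)
    (hr : ∀ i, ∃ ops p, (∀ z ∈ ops, z.1 = i) ∧ subhistory s.recorder i = procHistory i ops p ∧
      ∀ (q : ℕ) (b : B), (ops[q]?).map (fun z => z.2.val) = some b → Listed s C L (i, q) b) :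
    ∃ l, IsLinearization Spec s.recorder l := by
  -- The last numbered node is `C L` or its predecessor.
  have last : ∃ K ≤ L, (s.heap (C K)).seq ≠ 0 ∧ ∀ k ≤ L, (s.heap (C k)).seq ≠ 0 → k ≤ K := by
    by_cases hL : (s.heap (C L)).seq = 0
    · rcases L with _ | L
      · exact absurd hL (H.seq_ne 0 le_rfl (.inl rfl))
      · refine ⟨L, by omega, H.seq_ne L (by omega) (.inr (by omega)), fun k hk hs => ?_⟩
        by_contra h
        obtain rfl : k = L + 1 := by omega
        exact hs hL
    · exact ⟨L, le_rfl, hL, fun k hk _ => hk⟩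
  obtain ⟨K, hK, hs, hmax⟩ := last
  have index : ∀ {o : Oid n} {b : B}, Listed s C L o b → ∃ k < K, C (k + 1) = some o := by
    rintro o b ⟨⟨k, hk, ho, hsk⟩, _⟩
    rcases k with _ | k
    · rw [H.zero] at ho; cases ho
    · rw [ho] at hsk
      exact ⟨k, hmax _ hk hsk, ho.symm⟩
  -- If only `tail` is numbered, no return has been recorded, and the empty sequence is a
  -- linearization in which all pending calls are dropped.
  rcases K with _ | K
  · refine ⟨[], isLinearization_iff.2 ⟨hnil, fun i => ?_, fun o₁ o₂ h =>
      absurd h (by simp [procOps])⟩⟩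
    obtain ⟨ops, p, hops, hi, hv⟩ := hr i
    rcases ops with _ | ⟨z, ops⟩
    · exact ⟨[], p, hops, hi, .inl rfl⟩
    · obtain ⟨k, hk, _⟩ := index (hv 0 z.2.val rfl)
      omega
  -- The candidate is the linearization stored at the last numbered node. It was made for a prefix
  -- of the recorder, and every operation with a recorded return lies on the list up to that node,
  -- where values agree.
  · obtain ⟨l, hl⟩ := Option.ne_none_iff_exists'.1 (H.next_lin K hK (H.seq_next K hK hs))
    have hlin := H.lin K hK l hl
    obtain ⟨h, hh, hl'⟩ := hlin.hist
    refine ⟨l, hl'.extend (H.hist _ h hh) fun i => ?_⟩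
    obtain ⟨ops, p, hops, hi, hv⟩ := hr i
    refine ⟨ops, p, hops, hi, fun q b hq => ?_⟩
    have hL := hv q b hq
    obtain ⟨k, hk, hko⟩ := index hL
    obtain ⟨_, l₁, hl₁, hb₁⟩ := hL
    rcases (Nat.lt_succ_iff.1 hk).lt_or_eq with hk | rfl
    · obtain ⟨l₂, b₂, h₁, h₂, h₃⟩ := hlin.agree k hk _ hko
      rw [hl₁] at h₁
      cases h₁
      rw [h₂] at hb₁
      cases hb₁
      exact h₃
    · rw [hko, hl₁] at hl
      cases hl
      exact hb₁

theorem ProcInv.exists_ops {x : Option (M × ULoc n M A B)} (h : ProcInv s C L i y x) :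
    ∃ ops p, (∀ z ∈ ops, z.1 = i) ∧ subhistory s.recorder i = procHistory i ops p ∧
      ∀ (q : ℕ) (b : B), (ops[q]?).map (fun z => z.2.val) = some b → Listed s C L (i, q) b := by
  obtain ⟨ops, hops, hl, h⟩ := h
  rcases x with _ | ⟨m, l⟩
  · exact ⟨ops, _, hops, h.2.1, hl⟩
  · cases l
    case line2 => exact ⟨ops, _, hops, h.2.2.1, hl⟩
    case line3 => exact ⟨ops, _, hops, h.2.2.2.1, hl⟩
    case line23 =>
      obtain ⟨⟨-, -, -, a, h₁, -⟩, -⟩ := h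
      exact ⟨ops, _, hops, h₁, hl⟩
    case line24 =>
      obtain ⟨_, _, -, -, h₁, -⟩ := h
      exact ⟨ops, _, hops, h₁, hl⟩
    all_goals
      obtain ⟨-, -, -, a, h₁, -⟩ := h
      exact ⟨ops, _, hops, h₁, hl⟩

theorem linearizable_universalObject (hnil : [] ∈ Spec) :
    Linearizable Spec (universalObject n Spec) := by
  rintro ls ⟨c, hc⟩
  obtain ⟨C, L, H⟩ := UInv.path hc ⟨_, _, UInv.initial Spec⟩
  rw [List.nil_append] at H
  obtain ⟨l, hl⟩ := H.list.exists_linearization hnil fun i => (H.proc i).exists_ops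
  exact ⟨l, hl.of_delayed (fun i => (H.proc i).delayed) H.order⟩

end UniversalLinearizable

/-! ## The lattice -/

section Main

variable {n : ℕ} {M A B : Type u} {Spec : Set (List (Op M A B))}

theorem IsDetNonBlocking.nil_mem (h : IsDetNonBlocking Spec) : [] ∈ Spec := by
  obtain ⟨T, rfl, -⟩ := h
  exact ⟨T.initial, .nil _⟩

/-- No analysis of histories is needed: the universal object is an upper bound of `O₁` and `O₂`, so
it simulates their least upper bound. -/
theorem linearizable_lubObject (hnil : [] ∈ Spec) {O₁ O₂ : ConcObject n M A B}
    (h₁ : Linearizable Spec O₁) (h₂ : Linearizable Spec O₂) :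
    Linearizable Spec (lubObject O₁ O₂) :=
  (linearizable_universalObject hnil).of_simulated
    (lubObject_simulated (simulated_universalObject h₁) (simulated_universalObject h₂))

theorem linearizable_glbObject {O₁ O₂ : ConcObject n M A B} (h₁ : Linearizable Spec O₁) :
    Linearizable Spec (glbObject O₁ O₂) :=
  h₁.of_simulated (glbObject_simulated_left O₁ O₂)

theorem linearizable_neverObject (hnil : [] ∈ Spec) :
    Linearizable Spec (neverObject n M A B) :=
  (linearizable_universalObject hnil).of_simulated (neverObject_simulated _)

namespace SimClass

variable {S T U : SimClass n Spec} {O₁ O₂ O : ConcObject n M A B}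

attribute [local instance] SimClass.le SimClass.partialOrder

theorem isLUB_of_lubObject (h₁ : sem O₁ ∈ S.carrier) (h₂ : sem O₂ ∈ T.carrier)
    (h : sem (lubObject O₁ O₂) ∈ U.carrier) : IsLUB {S, T} U := by
  constructor
  · rintro _ (rfl | rfl)
    · exact (le_iff h₁ h).2 (simulated_lubObject_left O₁ O₂)
    · exact (le_iff h₂ h).2 (simulated_lubObject_right O₁ O₂)
  · intro V hV
    obtain ⟨O, -, hO⟩ := V.exists_object
    exact (le_iff h hO).2 (lubObject_simulated ((le_iff h₁ hO).1 (hV (by simp)))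
      ((le_iff h₂ hO).1 (hV (by simp))))

theorem isGLB_of_glbObject (h₁ : sem O₁ ∈ S.carrier) (h₂ : sem O₂ ∈ T.carrier)
    (h : sem (glbObject O₁ O₂) ∈ U.carrier) : IsGLB {S, T} U := by
  constructor
  · rintro _ (rfl | rfl)
    · exact (le_iff h h₁).2 (glbObject_simulated_left O₁ O₂)
    · exact (le_iff h h₂).2 (glbObject_simulated_right O₁ O₂)
  · intro V hV
    obtain ⟨O, -, hO⟩ := V.exists_object
    exact (le_iff hO h).2 (simulated_glbObject ((le_iff hO h₁).1 (hV (by simp)))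
      ((le_iff hO h₂).1 (hV (by simp))))

/-- An object of the class. -/
noncomputable def object (S : SimClass n Spec) : ConcObject n M A B := S.exists_object.choose

theorem linearizable_object (S : SimClass n Spec) : Linearizable Spec S.object :=
  S.exists_object.choose_spec.1

theorem sem_object_mem (S : SimClass n Spec) : sem S.object ∈ S.carrier :=
  S.exists_object.choose_spec.2

/-- The lattice of the classes of linearizable objects. -/
noncomputable abbrev lattice (hnil : [] ∈ Spec) : Lattice (SimClass n Spec) where
  sup S T := of (lubObject S.object T.object)
    (linearizable_lubObject hnil S.linearizable_object T.linearizable_object)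
  inf S T := of (glbObject S.object T.object) (linearizable_glbObject S.linearizable_object)
  le_sup_left S T :=
    (isLUB_of_lubObject S.sem_object_mem T.sem_object_mem (mem_of _ _)).1 (by simp)
  le_sup_right S T :=
    (isLUB_of_lubObject S.sem_object_mem T.sem_object_mem (mem_of _ _)).1 (by simp)
  sup_le S T U h₁ h₂ :=
    (isLUB_of_lubObject S.sem_object_mem T.sem_object_mem (mem_of _ _)).2
      (by rintro _ (rfl | rfl) <;> assumption)
  inf_le_left S T :=
    (isGLB_of_glbObject S.sem_object_mem T.sem_object_mem (mem_of _ _)).1 (by simp)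
  inf_le_right S T :=
    (isGLB_of_glbObject S.sem_object_mem T.sem_object_mem (mem_of _ _)).1 (by simp)
  le_inf S T U h₁ h₂ :=
    (isGLB_of_glbObject T.sem_object_mem U.sem_object_mem (mem_of _ _)).2
      (by rintro _ (rfl | rfl) <;> assumption)

/-- The least and the greatest class. -/
abbrev boundedOrder (hnil : [] ∈ Spec) : BoundedOrder (SimClass n Spec) where
  top := of (universalObject n Spec) (linearizable_universalObject hnil)
  bot := of (neverObject n M A B) (linearizable_neverObject hnil)
  le_top S := (le_iff S.sem_object_mem (mem_of _ _)).2
    (simulated_universalObject S.linearizable_object)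
  bot_le S := (le_iff (mem_of _ _) S.sem_object_mem).2 (neverObject_simulated _)

end SimClass

end Main

end LinLattice

theorem theorem3 (n : ℕ) {M A B : Type u} (Spec : Set (List (LinLattice.Op M A B)))
    (hSpec : LinLattice.IsDetNonBlocking Spec) :
    ∃ (_ : Lattice (LinLattice.SimClass n Spec)) (_ : BoundedOrder (LinLattice.SimClass n Spec)),
      (∀ S T : LinLattice.SimClass n Spec,
        S ≤ T ↔ ∃ X ∈ S.carrier, ∃ Y ∈ T.carrier, LinLattice.Simulated X Y) ∧
      (∀ O : LinLattice.ConcObject n M A B, LinLattice.Linearizable Spec O →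
        ∃! S : LinLattice.SimClass n Spec, LinLattice.sem O ∈ S.carrier) ∧
      (∀ (S T : LinLattice.SimClass n Spec) (O₁ O₂ : LinLattice.ConcObject n M A B),
        LinLattice.sem O₁ ∈ S.carrier → LinLattice.sem O₂ ∈ T.carrier →
          LinLattice.sem (LinLattice.lubObject O₁ O₂) ∈ (S ⊔ T).carrier ∧
          LinLattice.sem (LinLattice.glbObject O₁ O₂) ∈ (S ⊓ T).carrier) ∧
      LinLattice.sem (LinLattice.universalObject n Spec) ∈
        (⊤ : LinLattice.SimClass n Spec).carrier ∧
      LinLattice.sem (LinLattice.neverObject n M A B) ∈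
        (⊥ : LinLattice.SimClass n Spec).carrier := by
  open LinLattice in
  have hnil := hSpec.nil_mem
  refine ⟨SimClass.lattice hnil, SimClass.boundedOrder hnil, fun S T => Iff.rfl, fun O hO => ?_,
    fun S T O₁ O₂ h₁ h₂ => ?_, SimClass.mem_of _ _, SimClass.mem_of _ _⟩
  · exact ⟨SimClass.of O hO, SimClass.mem_of O hO, fun S hS =>
      SimClass.eq_of_mem hS (SimClass.mem_of O hO)⟩
  · have hO₁ := SimClass.linearizable_of_mem h₁
    have hO₂ := SimClass.linearizable_of_mem h₂
    let := SimClass.lattice (n := n) hnil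
    -- Suprema and infima were built from chosen representatives. By uniqueness of bounds, the given
    -- `O₁` and `O₂` lead to the same classes.
    have e₁ := (isLUB_pair (a := S) (b := T)).unique
      (SimClass.isLUB_of_lubObject h₁ h₂ (SimClass.mem_of _ (linearizable_lubObject hnil hO₁ hO₂)))
    have e₂ := (isGLB_pair (a := S) (b := T)).unique
      (SimClass.isGLB_of_glbObject h₁ h₂ (SimClass.mem_of _ (linearizable_glbObject hO₁)))
    rw [e₁, e₂]
    exact ⟨SimClass.mem_of _ _, SimClass.mem_of _ _⟩
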